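/- Let $K$ be a field (for instance an algebraically closed field of arbitrary characteristic), let $\delta\in K$ with $\delta\neq 0$, and let $r\ge 0$. All modules are right modules, and all of them are finite dimensional. **Hyperoctahedral groups.** $W_n$ is the group of signed permutations of $\{-n,\dots,-1,1,\dots,n\}$, and $\mathcal W_n=KW_n$. A bi-partition $\lambda=(\lambda^1,\lambda^2)$ of $n$ is a pair of partitions with $|\lambda^1|+|\lambda^2|=n$. A $\lambda$-bi-tableau $\mathfrak t=(\mathfrak t^1,\mathfrak t^2)$ is a filling of the boxes of $\lambda^1$ and $\lambda^2$ with elements of $\{\pm1,\dots,\pm n\}$ such that for each $i$ exactly one of $i,-i$ occurs, once. Its row permutations are the elements of $W_n$ that permute the entries within each row and may change the signs of entries in $\mathfrak t^2$; its column permutations permute the entries within each column and may change the signs of entries in $\mathfrak t^1$. The permutation module $M(\lambda)$ has as basis the bi-tabloids $\{\mathfrak t\}$ (classes of bi-tableaux up to row permutations). The Specht module $S(\lambda)\subseteq M(\lambda)$ is spanned by the elements $\{\mathfrak t\}\sum_{\sigma}\mathrm{sgn}(\sigma)\,\sigma$, the sum being over the column permutations $\sigma$ of $\mathfrak t$, where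 $\mathrm{sgn}(\sigma)$ is $(-1)^{\text{number of sign changes}}$ times the sign of the underlying permutation of $\{1,\dots,n\}$. The Young module $Y(\lambda)$ is the indecomposable direct summand of $M(\lambda)$ that contains $S(\lambda)$. For bi-partitions $\lambda,\mu$ of $n$, write $\lambda\unrhd\mu$ if for all $j\ge 0$ $$\sum_{i\le j}\lambda^2_i\ \ge\ \sum_{i\le j}\mu^2_i\qquad\text{and}\qquad |\lambda^2|+\sum_{i\le j}\lambda^1_i\ \ge\ |\mu^2|+\sum_{i\le j}\mu^1_i .$$ **The Brauer algebra of type $C$.** $B=\mathcal B(C_r,\delta)$ has as basis the perfect matchings (diagrams) of two rows of vertices, each labelled $-r,\dots,-1,1,\dots,r$, that are symmetric under $v\mapsto -v$; diagrams are multiplied by concatenation, each closed loop being replaced by $\delta$. For $0\le l\le r$ let $e_l\in B$ be $\delta^{-l}$ times the diagram with horizontal edges $\{i,-i\}$, $1\le i\le l$, in both rows and vertical edges elsewhere, and let $J_k$ be the two-sided ideal generated by the diagrams with at least $k$ horizontal edges in each row. The group algebra $\mathcal W_{r-l}$, acting on $\pm(l+1),\dots,\pm r$, is contained in $B$ and commutes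 with $e_l$. For a $\mathcal W_{r-l}$-module $X$ put $$\mathrm{Ind}_l X=X\otimes_{\mathcal W_{r-l}}e_lB,\qquad \mathrm{ind}_l X=X\otimes_{\mathcal W_{r-l}}e_l(B/J_{l+1}).$$ Let $\Lambda$ be the set of pairs $(l,\lambda)$ with $0\le l\le r$ and $\lambda$ a bi-partition of $r-l$. For $(l,\lambda)\in\Lambda$ put $M(l,\lambda)=\mathrm{Ind}_l M(\lambda)$, and let $Y(l,\lambda)$ be the indecomposable direct summand of $M(l,\lambda)$ that admits a surjection onto $\mathrm{ind}_l Y(\lambda)$. **Proposition.** The modules $Y(\lambda)$ and $Y(l,\lambda)$ exist and are unique up to isomorphism. For $(l,\lambda),(m,\mu)\in\Lambda$: 1. $Y(l,\lambda)$ occurs exactly once in $M(l,\lambda)$: the module $M(l,\lambda)$ is a finite direct sum of indecomposable submodules, and in each such decomposition exactly one summand is isomorphic to $Y(l,\lambda)$. 2. If $l<m$, then $Y(l,\lambda)$ is not isomorphic to a direct summand of $M(m,\mu)$. 3. If $l=m$, then $Y(l,\lambda)$ is isomorphic to a direct summand of $M(l,\mu)$ if and only if $Y(\lambda)$ is isomorphic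 to a direct summand of $M(\mu)$, and this can happen only if $\lambda\unrhd\mu$. 4. If $Y(l,\lambda)\cong Y(m,\mu)$, then $(l,\lambda)=(m,\mu)$. -/

import Mathlib

open scoped TensorProduct

noncomputable section

namespace TypeC

section Gluing

variable {X Y Z U : Type}

/-- The inclusion of the two upper rows into three rows. -/
def upper : X ⊕ Y → X ⊕ Y ⊕ Z := Sum.elim Sum.inl (Sum.inr ∘ Sum.inl)

/-- The inclusion of the outer (first and third) rows into three rows. -/
def outer : X ⊕ Z → X ⊕ Y ⊕ Z := Sum.elim Sum.inl (Sum.inr ∘ Sum.inr)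

/-- Put a diagram `s` on top of a diagram `t`: the equivalence relation on the three rows of
vertices generated by `s` on the two upper rows and by `t` on the two lower rows. -/
def glue (s : Setoid (X ⊕ Y)) (t : Setoid (Y ⊕ Z)) : Setoid (X ⊕ Y ⊕ Z) :=
  Relation.EqvGen.setoid fun a b =>
    (∃ p q, s p q ∧ a = upper p ∧ b = upper q) ∨
      (∃ p q, t p q ∧ a = Sum.inr p ∧ b = Sum.inr q)

/-- Concatenation of diagrams: two outer vertices are joined when they lie in the same connected
component after putting `s` on top of `t`. -/
def comp (s : Setoid (X ⊕ Y)) (t : Setoid (Y ⊕ Z)) : Setoid (X ⊕ Z) :=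
  (glue s t).comap outer

/-- The classes of an equivalence relation which contain no element of the form `f x`. -/
def Avoiding {A B : Type} (R : Setoid B) (f : A → B) : Type :=
  {q : Quotient R // ∀ p, Quotient.mk R (f p) ≠ q}

/-- The number of closed loops that arise when `s` is put on top of `t`: the connected components
which contain no outer vertex. -/
def loops (s : Setoid (X ⊕ Y)) (t : Setoid (Y ⊕ Z)) : ℕ :=
  Nat.card (Avoiding (glue s t) outer)

theorem glue_upper {s : Setoid (X ⊕ Y)} {t : Setoid (Y ⊕ Z)} {p q : X ⊕ Y} (h : s p q) :
    glue s t (upper p) (upper q) :=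
  Relation.EqvGen.rel _ _ (Or.inl ⟨p, q, h, rfl, rfl⟩)

theorem glue_lower {s : Setoid (X ⊕ Y)} {t : Setoid (Y ⊕ Z)} {p q : Y ⊕ Z} (h : t p q) :
    glue s t (Sum.inr p) (Sum.inr q) :=
  Relation.EqvGen.rel _ _ (Or.inr ⟨p, q, h, rfl, rfl⟩)

theorem glue_le {s : Setoid (X ⊕ Y)} {t : Setoid (Y ⊕ Z)} {E : Setoid (X ⊕ Y ⊕ Z)}
    (hs : ∀ p q, s p q → E (upper p) (upper q))
    (ht : ∀ p q, t p q → E (Sum.inr p) (Sum.inr q)) : glue s t ≤ E := by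
  refine Setoid.eqvGen_le ?_
  rintro _ _ (⟨p, q, h, rfl, rfl⟩ | ⟨p, q, h, rfl, rfl⟩)
  exacts [hs p q h, ht p q h]

/-- Gluing `S` and `P` along `O`, abstractly: components of the glued object `T`. -/
theorem pushout_aux {T S P O A : Type} [Finite T] [Finite S] [Finite P]
    (h : P → T) (f : S → T) (o : O → P) (k : O → S)
    (hfk : ∀ x, f (k x) = h (o x))
    (G : Setoid P) (J : Setoid T) (J' : Setoid S)
    (hG : ∀ p q, G p q → J (h p) (h q)) (hJ' : ∀ p q, J' p q → J (f p) (f q))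
    (hk : ∀ p q, G (o p) (o q) → J' (k p) (k q))
    (hcov : ∀ x : T, (∃ p, h p = x) ∨ ∃ p, f p = x)
    (hφ : ∀ ψ : P → Quotient J' ⊕ Avoiding G o,
      (∀ p q, G p q → ψ p = ψ q) → (∀ x, ψ (o x) = Sum.inl (Quotient.mk _ (k x))) →
      ∃ φ : T → Quotient J' ⊕ Avoiding G o,
        (∀ p, φ (h p) = ψ p) ∧ (∀ p, φ (f p) = Sum.inl (Quotient.mk _ p)) ∧
        ∀ x y, J x y → φ x = φ y) (a : A → S) :
    J.comap (f ∘ a) = J'.comap a ∧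
      Nat.card (Avoiding J (f ∘ a)) = Nat.card (Avoiding J' a) + Nat.card (Avoiding G o) := by
  classical
  let ψ₀ : Quotient G → Quotient J' ⊕ Avoiding G o := fun q =>
    if hq : ∃ x, Quotient.mk G (o x) = q then Sum.inl (Quotient.mk _ (k hq.choose))
    else Sum.inr ⟨q, fun p hp => hq ⟨p, hp⟩⟩
  obtain ⟨φ, h1, h2, h3⟩ := hφ (fun p => ψ₀ (Quotient.mk _ p))
    (fun p q hpq => by rw [Quotient.sound (s := G) hpq])
    (fun x => by
      have hx : ∃ y, Quotient.mk G (o y) = Quotient.mk G (o x) := ⟨x, rfl⟩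
      simp only [ψ₀, dif_pos hx]
      congr 1
      exact Quotient.sound (s := J') (hk _ _ (Quotient.exact hx.choose_spec)))
  have hinr : ∀ (q : P) (hq : ∀ x, Quotient.mk G (o x) ≠ Quotient.mk G q),
      ψ₀ (Quotient.mk _ q) = Sum.inr ⟨_, hq⟩ := by
    intro q hq
    have hx : ¬ ∃ y, Quotient.mk G (o y) = Quotient.mk G q := fun ⟨y, hy⟩ => hq y hy
    simp only [ψ₀, dif_neg hx]
  let inv : Quotient J' ⊕ Avoiding G o → Quotient J :=
    Sum.elim (Quotient.map' f hJ') (fun q => Quotient.map' h hG q.1)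
  have hinvφ : ∀ x, inv (φ x) = Quotient.mk _ x := by
    have hf : ∀ p, inv (φ (f p)) = Quotient.mk _ (f p) := fun p => by rw [h2]; rfl
    intro x
    rcases hcov x with ⟨p, rfl⟩ | ⟨p, rfl⟩
    · by_cases hq : ∃ x, Quotient.mk G (o x) = Quotient.mk G p
      · obtain ⟨y, hy⟩ := hq
        have e : J (h (o y)) (h p) := hG _ _ (Quotient.exact hy)
        rw [← h3 _ _ e, ← hfk, hf, hfk]
        exact Quotient.sound (s := J) e
      · rw [h1, hinr p (fun y hy => hq ⟨y, hy⟩)]; rfl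
    · exact hf p
  let e : Quotient J ≃ Quotient J' ⊕ Avoiding G o :=
    { toFun := Quotient.lift φ h3
      invFun := inv
      left_inv := by rintro ⟨x⟩; exact hinvφ x
      right_inv := by
        rintro (⟨⟨p⟩⟩ | ⟨⟨p⟩, hp⟩)
        · exact h2 p
        · exact (h1 p).trans (hinr p hp) }
  have he : ∀ p, e (Quotient.mk _ (f p)) = Sum.inl (Quotient.mk _ p) := h2
  constructor
  · ext x y
    change J (f (a x)) (f (a y)) ↔ J' (a x) (a y)
    refine ⟨fun hxy => ?_, hJ' _ _⟩
    have := h3 _ _ hxy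
    rw [h2, h2] at this
    exact Quotient.exact (Sum.inl_injective this)
  · have : Finite (Quotient J') := Quotient.finite _
    have : Finite (Quotient G) := Quotient.finite _
    have : Finite (Avoiding J' a) := inferInstanceAs (Finite (Subtype _))
    have : Finite (Avoiding G o) := inferInstanceAs (Finite (Subtype _))
    rw [← Nat.card_sum]
    refine Nat.card_congr ?_
    refine (Equiv.subtypeEquiv e (q := fun z => ∀ p, Sum.inl (Quotient.mk J' (a p)) ≠ z)
      (fun q => forall_congr' fun p => ?_)).trans ?_
    · rw [← he, Function.comp, ne_eq, ne_eq, e.injective.eq_iff]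
    · refine Equiv.subtypeSum.trans (Equiv.sumCongr (Equiv.subtypeEquivRight fun q => ?_)
        (Equiv.subtypeUnivEquiv fun q => ?_))
      · simp [Sum.inl_injective.eq_iff]
      · simp

theorem comp_left_aux [Finite X] [Finite Y] [Finite Z] [Finite U]
    (s : Setoid (X ⊕ Y)) (t : Setoid (Y ⊕ Z)) (u : Setoid (Z ⊕ U)) :
    (glue s (glue t u)).comap (outer ∘ outer) = comp (comp s t) u ∧
      Nat.card (Avoiding (glue s (glue t u)) (outer ∘ outer)) =
        loops (comp s t) u + loops s t := by
  have hs : ∀ p q, glue s t p q → glue s (glue t u)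
      (Sum.map id (Sum.map id Sum.inl) p) (Sum.map id (Sum.map id Sum.inl) q) := by
    refine glue_le (E := (glue s (glue t u)).comap (Sum.map id (Sum.map id Sum.inl))) ?_ ?_
    · rintro (p | p) (q | q) h <;> exact glue_upper h
    · rintro (p | p) (q | q) h <;> exact glue_lower (glue_upper h)
  refine pushout_aux (T := X ⊕ Y ⊕ Z ⊕ U) (S := X ⊕ Z ⊕ U) (P := X ⊕ Y ⊕ Z) (O := X ⊕ Z)
    (Sum.map id (Sum.map id Sum.inl)) outer outer upper ?_ _ _ _ hs ?_ ?_ ?_ ?_ outer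
  · rintro (x | x) <;> rfl
  · refine glue_le (E := (glue s (glue t u)).comap outer) ?_ ?_
    · rintro (p | p) (q | q) h <;> exact hs _ _ h
    · rintro (p | p) (q | q) h <;> exact glue_lower (glue_lower h)
  · intro p q h
    exact glue_upper h
  · rintro (x | x | x | x)
    exacts [Or.inl ⟨.inl x, rfl⟩, Or.inl ⟨.inr (.inl x), rfl⟩, Or.inl ⟨.inr (.inr x), rfl⟩,
      Or.inr ⟨.inr (.inr x), rfl⟩]
  · intro ψ h1 h2
    have hx : ∀ x, ψ (Sum.inl x) = Sum.inl (Quotient.mk _ (Sum.inl x)) := fun x => h2 (Sum.inl x)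
    have hz : ∀ x, ψ (Sum.inr (Sum.inr x)) = Sum.inl (Quotient.mk _ (Sum.inr (Sum.inl x))) :=
      fun x => h2 (Sum.inr x)
    refine ⟨Sum.elim (fun x => ψ (.inl x)) (Sum.elim (fun y => ψ (.inr (.inl y)))
      (fun z => Sum.inl (Quotient.mk _ (Sum.inr z)))), ?_, ?_, ?_⟩
    · rintro (x | x | x)
      exacts [rfl, rfl, (hz x).symm]
    · rintro (x | x)
      exacts [hx x, rfl]
    · refine glue_le (E := Setoid.ker _) ?_ (fun p q h => glue_le
        (E := (Setoid.ker (Sum.elim (fun x => ψ (.inl x)) (Sum.elim (fun y => ψ (.inr (.inl y)))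
          (fun z => Sum.inl (Quotient.mk _ (Sum.inr z)))))).comap Sum.inr) ?_ ?_ h)
      · rintro (p | p) (q | q) h <;> exact h1 _ _ (glue_upper h)
      · rintro (p | p) (q | q) h
        · exact h1 _ _ (glue_lower h)
        · exact (h1 _ _ (glue_lower h)).trans (hz q)
        · exact (hz p).symm.trans (h1 _ _ (glue_lower h))
        · exact (hz p).symm.trans ((h1 _ _ (glue_lower h)).trans (hz q))
      · intro p q h
        exact congrArg Sum.inl (Quotient.sound (glue_lower h))

theorem comp_right_aux [Finite X] [Finite Y] [Finite Z] [Finite U]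
    (s : Setoid (X ⊕ Y)) (t : Setoid (Y ⊕ Z)) (u : Setoid (Z ⊕ U)) :
    (glue s (glue t u)).comap (outer ∘ outer) = comp s (comp t u) ∧
      Nat.card (Avoiding (glue s (glue t u)) (outer ∘ outer)) =
        loops s (comp t u) + loops t u := by
  have e : (outer ∘ outer : X ⊕ U → X ⊕ Y ⊕ Z ⊕ U) =
      Sum.map id outer ∘ (outer : X ⊕ U → X ⊕ Y ⊕ U) := by
    funext x; rcases x with x | x <;> rfl
  rw [e]
  refine pushout_aux (T := X ⊕ Y ⊕ Z ⊕ U) (S := X ⊕ Y ⊕ U) (P := Y ⊕ Z ⊕ U) (O := Y ⊕ U)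
    Sum.inr (Sum.map id outer) outer Sum.inr (fun _ => rfl) _ _ _ (fun _ _ h => glue_lower h)
    ?_ ?_ ?_ ?_ outer
  · refine glue_le (E := (glue s (glue t u)).comap (Sum.map id outer)) ?_ ?_
    · rintro (p | p) (q | q) h <;> exact glue_upper h
    · intro p q h
      exact glue_lower h
  · intro p q h
    exact glue_lower h
  · rintro (x | x)
    exacts [Or.inr ⟨.inl x, rfl⟩, Or.inl ⟨x, rfl⟩]
  · intro ψ h1 h2
    have hy : ∀ x, ψ (Sum.inl x) = Sum.inl (Quotient.mk _ (Sum.inr (Sum.inl x))) :=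
      fun x => h2 (Sum.inl x)
    refine ⟨Sum.elim (fun x => Sum.inl (Quotient.mk _ (Sum.inl x))) ψ, fun _ => rfl, ?_, ?_⟩
    · rintro (x | x)
      exacts [rfl, h2 x]
    · refine glue_le (E := Setoid.ker _) ?_ h1
      have hu : ∀ p : X ⊕ Y, (Sum.elim (fun x => Sum.inl (Quotient.mk _ (Sum.inl x))) ψ :
          X ⊕ Y ⊕ Z ⊕ U → _) (upper p) = Sum.inl (Quotient.mk (glue s (comp t u)) (upper p)) := by
        rintro (p | p)
        exacts [rfl, hy p]
      intro p q h
      exact (hu p).trans ((congrArg Sum.inl (Quotient.sound (glue_upper h))).trans (hu q).symm)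

theorem comp_assoc [Finite X] [Finite Y] [Finite Z] [Finite U]
    (s : Setoid (X ⊕ Y)) (t : Setoid (Y ⊕ Z)) (u : Setoid (Z ⊕ U)) :
    comp (comp s t) u = comp s (comp t u) :=
  (comp_left_aux s t u).1.symm.trans (comp_right_aux s t u).1

theorem loops_assoc [Finite X] [Finite Y] [Finite Z] [Finite U]
    (s : Setoid (X ⊕ Y)) (t : Setoid (Y ⊕ Z)) (u : Setoid (Z ⊕ U)) :
    loops s t + loops (comp s t) u = loops t u + loops s (comp t u) := by
  rw [add_comm, add_comm (loops t u)]
  exact (comp_left_aux s t u).2.symm.trans (comp_right_aux s t u).2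

/-- The diagram of a bijection `σ`, in which the top vertex `σ v` is joined to the bottom
vertex `v`. -/
def graphOf (σ : X ≃ Y) : Setoid (Y ⊕ X) := Setoid.ker (Sum.elim id σ)

theorem glue_graphOf_left (σ : X ≃ Y) (t : Setoid (X ⊕ Z)) :
    glue (graphOf σ) t = t.comap (Sum.elim (Sum.inl ∘ σ.symm) id) := by
  have key : ∀ a : Y ⊕ X ⊕ Z, glue (graphOf σ) t a
      (Sum.inr (Sum.elim (Sum.inl ∘ σ.symm) id a)) := by
    rintro (a | a)
    · exact glue_upper (p := .inl a) (q := .inr (σ.symm a)) (σ.apply_symm_apply a).symm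
    · exact Setoid.refl' _ _
  refine le_antisymm (glue_le ?_ fun p q h => h) ?_
  · have hg : ∀ p : Y ⊕ X, Sum.elim (Sum.inl ∘ σ.symm) id (upper p) =
        (Sum.inl (σ.symm (Sum.elim id σ p)) : X ⊕ Z) := by
      rintro (p | p) <;> simp [upper]
    intro p q h
    rw [Setoid.comap_rel, hg, hg, show Sum.elim id σ p = Sum.elim id σ q from h]
  · intro a b h
    exact Setoid.trans' _ (key a) (Setoid.trans' _ (glue_lower h) (Setoid.symm' _ (key b)))

theorem comp_graphOf_left (σ : X ≃ Y) (t : Setoid (X ⊕ Z)) :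
    comp (graphOf σ) t = t.comap (Sum.map σ.symm id) := by
  rw [comp, glue_graphOf_left, ← Setoid.comap_comp]
  congr 1
  funext x; rcases x with x | x <;> rfl

theorem loops_graphOf_left (σ : X ≃ Y) (t : Setoid (X ⊕ Z)) : loops (graphOf σ) t = 0 := by
  have : IsEmpty (Avoiding (glue (graphOf σ) t) outer) := by
    refine ⟨?_⟩
    rintro ⟨⟨a | a | a⟩, h⟩
    · exact h (.inl a) rfl
    · refine h (.inl (σ a)) (Quotient.sound ?_)
      exact glue_upper (p := .inl (σ a)) (q := .inr a) rfl
    · exact h (.inr a) rfl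
  exact Nat.card_of_isEmpty

theorem glue_graphOf_right (s : Setoid (X ⊕ Y)) (σ : Z ≃ Y) :
    glue s (graphOf σ) = s.comap (Sum.elim Sum.inl (Sum.elim Sum.inr (Sum.inr ∘ σ))) := by
  have key : ∀ a : X ⊕ Y ⊕ Z, glue s (graphOf σ) a
      (upper (Sum.elim Sum.inl (Sum.elim Sum.inr (Sum.inr ∘ σ)) a)) := by
    rintro (a | a | a)
    · exact Setoid.refl' _ _
    · exact Setoid.refl' _ _
    · exact glue_lower (p := .inr a) (q := .inl (σ a)) rfl
  refine le_antisymm (glue_le ?_ ?_) ?_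
  · rintro (p | p) (q | q) h <;> exact h
  · have hg : ∀ p : Y ⊕ Z, Sum.elim Sum.inl (Sum.elim Sum.inr (Sum.inr ∘ σ)) (Sum.inr p) =
        (Sum.inr (Sum.elim id σ p) : X ⊕ Y) := by
      rintro (p | p) <;> simp
    intro p q h
    rw [Setoid.comap_rel, hg, hg, show Sum.elim id σ p = Sum.elim id σ q from h]
  · intro a b h
    exact Setoid.trans' _ (key a) (Setoid.trans' _ (glue_upper h) (Setoid.symm' _ (key b)))

theorem comp_graphOf_right (s : Setoid (X ⊕ Y)) (σ : Z ≃ Y) :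
    comp s (graphOf σ) = s.comap (Sum.map id σ) := by
  rw [comp, glue_graphOf_right, ← Setoid.comap_comp]
  congr 1
  funext x; rcases x with x | x <;> rfl

theorem loops_graphOf_right (s : Setoid (X ⊕ Y)) (σ : Z ≃ Y) : loops s (graphOf σ) = 0 := by
  have : IsEmpty (Avoiding (glue s (graphOf σ)) outer) := by
    refine ⟨?_⟩
    rintro ⟨⟨a | a | a⟩, h⟩
    · exact h (.inl a) rfl
    · refine h (.inr (σ.symm a)) (Quotient.sound ?_)
      exact glue_lower (p := .inr (σ.symm a)) (q := .inl a) (σ.apply_symm_apply a)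
    · exact h (.inr a) rfl
  exact Nat.card_of_isEmpty

/-- Every class has exactly two elements: the relation is a perfect matching. -/
def IsMatching (s : Setoid X) : Prop := ∀ x, ∃! y, y ≠ x ∧ s x y

theorem isMatching_graphOf (σ : X ≃ Y) : IsMatching (graphOf σ) := by
  rintro (x | x)
  · refine ⟨.inr (σ.symm x), ⟨by simp, (σ.apply_symm_apply x).symm⟩, ?_⟩
    rintro (y | y) ⟨h1, h2⟩
    · exact absurd (congrArg Sum.inl h2.symm) h1
    · exact congrArg Sum.inr (σ.injective (h2.symm.trans (σ.apply_symm_apply x).symm))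
  · refine ⟨.inl (σ x), ⟨by simp, rfl⟩, ?_⟩
    rintro (y | y) ⟨h1, h2⟩
    · exact congrArg Sum.inl h2.symm
    · exact absurd (congrArg Sum.inr (σ.injective h2.symm)) h1

/-- A set of classes of a perfect matching has an even number of elements. -/
theorem IsMatching.even_card [Finite X] {s : Setoid X} (hs : IsMatching s) (C : Set X)
    (hC : ∀ x y, s x y → x ∈ C → y ∈ C) : Even C.ncard := by
  classical
  have := Fintype.ofFinite X
  choose f hf huniq using hs
  have hff : ∀ x, f (f x) = x := fun x =>
    (huniq (f x) x ⟨(hf x).1.symm, Setoid.symm' _ (hf x).2⟩).symm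
  have h := Finset.sum_involution (s := C.toFinset) (f := fun _ => (1 : ZMod 2))
    (fun x _ => f x) (fun _ _ => by decide) (fun x _ _ => (hf x).1)
    (fun x hx => by simpa using hC _ _ (hf x).2 (by simpa using hx)) (fun x _ => hff x)
  rw [Finset.sum_const, nsmul_eq_mul, mul_one, ZMod.natCast_eq_zero_iff_even] at h
  rwa [Set.ncard_eq_toFinset_card']

theorem two_mul_card_le_of_connected {A : Type} [Fintype A] (H : SimpleGraph A)
    (h : H.Connected) (N : A → Finset A) (hN : ∀ a b, H.Adj a b → b ∈ N a) :
    2 * Fintype.card A ≤ (∑ a, (N a).card) + 2 := by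
  classical
  have h1 := h.card_vert_le_card_edgeSet_add_one
  rw [Nat.card_eq_fintype_card, Nat.card_eq_fintype_card, ← SimpleGraph.edgeFinset_card] at h1
  have h2 := H.sum_degrees_eq_twice_card_edges
  have h3 : ∑ a, H.degree a ≤ ∑ a, (N a).card := Finset.sum_le_sum fun a _ =>
    Finset.card_le_card fun b hb => hN a b (by simpa using hb)
  omega

theorem IsMatching.comp [Finite X] [Finite Y] [Finite Z] {s : Setoid (X ⊕ Y)}
    {t : Setoid (Y ⊕ Z)} (hs : IsMatching s) (ht : IsMatching t) : IsMatching (comp s t) := by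
  classical
  have := Fintype.ofFinite X
  have := Fintype.ofFinite Y
  have := Fintype.ofFinite Z
  intro p₀
  have hs' := hs
  have ht' := ht
  choose f hf hfu using hs'
  choose g hg hgu using ht'
  let G : SimpleGraph (X ⊕ Y ⊕ Z) := SimpleGraph.fromRel fun a b =>
    (∃ p q, s p q ∧ a = upper p ∧ b = upper q) ∨ (∃ p q, t p q ∧ a = Sum.inr p ∧ b = Sum.inr q)
  have hGJ : ∀ a b, G.Reachable a b ↔ glue s t a b := by
    intro a b
    constructor
    · rintro ⟨w⟩
      induction w with
      | nil => exact Setoid.refl' _ _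
      | cons h _ ih =>
        refine Setoid.trans' _ ?_ ih
        rcases h.2 with h | h
        · exact Relation.EqvGen.rel _ _ h
        · exact Setoid.symm' _ (Relation.EqvGen.rel _ _ h)
    · have : glue s t ≤ G.reachableSetoid := by
        refine Setoid.eqvGen_le fun x y h => ?_
        by_cases hxy : x = y
        · subst hxy; exact SimpleGraph.Reachable.refl _
        · exact SimpleGraph.Adj.reachable ⟨hxy, Or.inl h⟩
      exact fun h => this h
  let N : X ⊕ Y ⊕ Z → Finset (X ⊕ Y ⊕ Z) := Sum.elim (fun x => {upper (f (.inl x))})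
    (Sum.elim (fun y => {upper (f (.inr y)), .inr (g (.inl y))}) (fun z => {.inr (g (.inr z))}))
  let w : X ⊕ Y ⊕ Z → ℕ := Sum.elim (fun _ => 1) (Sum.elim (fun _ => 2) (fun _ => 1))
  have hNs : ∀ p q : X ⊕ Y, s p q → p ≠ q → (upper q : X ⊕ Y ⊕ Z) ∈ N (upper p) := by
    intro p q h hne
    rw [hfu p q ⟨hne.symm, h⟩]
    rcases p with p | p <;> simp [N, upper]
  have hNt : ∀ p q : Y ⊕ Z, t p q → p ≠ q → (.inr q : X ⊕ Y ⊕ Z) ∈ N (.inr p) := by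
    intro p q h hne
    rw [hgu p q ⟨hne.symm, h⟩]
    rcases p with p | p <;> simp [N]
  have hN : ∀ a b, G.Adj a b → b ∈ N a := by
    rintro a b ⟨hne, (⟨p, q, h, rfl, rfl⟩ | ⟨p, q, h, rfl, rfl⟩) |
      (⟨p, q, h, rfl, rfl⟩ | ⟨p, q, h, rfl, rfl⟩)⟩
    · exact hNs _ _ h (fun e => hne (congrArg _ e))
    · exact hNt _ _ h (fun e => hne (congrArg _ e))
    · exact hNs _ _ (Setoid.symm' _ h) (fun e => hne (congrArg _ e))
    · exact hNt _ _ (Setoid.symm' _ h) (fun e => hne (congrArg _ e))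
  have hNw : ∀ a, (N a).card ≤ w a := by
    rintro (a | a | a)
    · simp [N, w]
    · exact Finset.card_le_two
    · simp [N, w]
  let C := G.connectedComponentMk (outer p₀)
  obtain ⟨c, hcC⟩ : ∃ c : X ⊕ Y ⊕ Z → Prop, ∀ a, c a ↔ a ∈ C.supp := ⟨_, fun _ => Iff.rfl⟩
  have hc : ∀ a, c a ↔ glue s t (outer p₀) a := by
    intro a
    rw [← hGJ, hcC]
    exact SimpleGraph.ConnectedComponent.eq.trans ⟨fun h => h.symm, fun h => h.symm⟩
  have hedge := two_mul_card_le_of_connected C.toSimpleGraph C.connected_toSimpleGraph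
    (fun a => (N a).subtype _) (fun a b hab => by simpa using hN _ _ hab)
  have hsum : ∑ a : C, ((N a).subtype (· ∈ C)).card ≤ ∑ a, if c a then w a else 0 := by
    rw [← Finset.sum_filter]
    refine (Finset.sum_le_sum fun a _ => ?_).trans
      (le_of_eq (Finset.sum_subtype _ (fun a => by rw [Finset.mem_filter, and_iff_right (Finset.mem_univ a)]; exact hcC a) w).symm)
    rw [Finset.card_subtype]
    exact (Finset.card_filter_le _ _).trans (hNw a)
  have hcard : Fintype.card C = ∑ a, if c a then 1 else 0 := by
    rw [← Finset.card_filter]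
    exact Fintype.card_of_subtype _ (fun a => by rw [Finset.mem_filter, and_iff_right (Finset.mem_univ a)]; exact hcC a)
  replace hedge := hedge.trans (Nat.add_le_add_right hsum 2)
  rw [hcard] at hedge
  have hev : ∀ {A : Type} [Fintype A] (P : A → Prop) [DecidablePred P],
      {x | P x}.ncard = ∑ x, if P x then 1 else 0 := by
    intro A _ P _
    rw [← Finset.card_filter, Set.ncard_eq_toFinset_card']
    congr 1; ext; simp
  have e1 : Even ((∑ x, if c (Sum.inl x) then 1 else 0) +
      ∑ y, if c (Sum.inr (Sum.inl y)) then 1 else 0) := by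
    have h := hs.even_card {p | c (upper p)} fun x y hxy hx =>
      (hc _).2 (Setoid.trans' _ ((hc _).1 hx) (glue_upper hxy))
    rw [hev, Fintype.sum_sum_type] at h
    exact h
  have e2 : Even ((∑ y, if c (Sum.inr (Sum.inl y)) then 1 else 0) +
      ∑ z, if c (Sum.inr (Sum.inr z)) then 1 else 0) := by
    have h := ht.even_card {p | c (Sum.inr p)} fun x y hxy hx =>
      (hc _).2 (Setoid.trans' _ ((hc _).1 hx) (glue_lower hxy))
    rw [hev, Fintype.sum_sum_type] at h
    exact h
  have hk : {q : X ⊕ Z | c (outer q)}.ncard = (∑ x, if c (Sum.inl x) then 1 else 0) +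
      ∑ z, if c (Sum.inr (Sum.inr z)) then 1 else 0 := by
    rw [hev, Fintype.sum_sum_type]; rfl
  have hp₀ : p₀ ∈ {q : X ⊕ Z | c (outer q)} := (hc _).2 (Setoid.refl' _ _)
  have hpos : 0 < {q : X ⊕ Z | c (outer q)}.ncard := (Set.ncard_pos (Set.toFinite _)).2 ⟨_, hp₀⟩
  have hw2 : (∑ a, if c (Sum.inr (Sum.inl a)) then (2 : ℕ) else 0) =
      2 * ∑ a, if c (Sum.inr (Sum.inl a)) then 1 else 0 := by
    rw [Finset.mul_sum]; exact Finset.sum_congr rfl fun a _ => by split_ifs <;> rfl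
  simp only [Fintype.sum_sum_type, w, Sum.elim_inl, Sum.elim_inr] at hedge
  rw [hw2] at hedge
  have h2 : {q : X ⊕ Z | c (outer q)}.ncard = 2 := by
    rw [Nat.even_iff] at e1 e2
    omega
  have h1 := Set.ncard_sdiff_singleton_of_mem hp₀
  rw [h2] at h1
  obtain ⟨q, hq⟩ := Set.ncard_eq_one.1 h1
  have hqq : ∀ y, (y ≠ p₀ ∧ TypeC.comp s t p₀ y) ↔ y = q := by
    intro y
    have := Set.ext_iff.1 hq y
    simp only [Set.mem_sdiff, Set.mem_ofPred_eq, Set.mem_singleton_iff, hc] at this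
    rw [← this, and_comm]; rfl
  exact ⟨q, (hqq q).2 rfl, fun y hy => (hqq y).1 hy⟩

end Gluing
/-! ### Hyperoctahedral groups -/

/-- The vertices `-n, …, -1, 1, …, n`: the pair `(i, ε)` stands for `ε * (i + 1)`. -/
abbrev Node (n : ℕ) : Type := Fin n × ℤˣ

/-- The reflection `v ↦ -v`. -/
def reflect {A : Type} (v : A × ℤˣ) : A × ℤˣ := (v.1, -v.2)

theorem reflect_reflect {A : Type} (v : A × ℤˣ) : reflect (reflect v) = v := by
  simp [reflect]

/-- The signed permutations of `-n, …, -1, 1, …, n`. -/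
def signedPerm (n : ℕ) : Subgroup (Equiv.Perm (Node n)) where
  carrier := {σ | ∀ v, σ (reflect v) = reflect (σ v)}
  mul_mem' {σ τ} hσ hτ v := by
    rw [Equiv.Perm.mul_apply, Equiv.Perm.mul_apply, hτ, hσ]
  one_mem' _ := rfl
  inv_mem' {σ} hσ v := by
    rw [Equiv.Perm.inv_eq_iff_eq, hσ]; exact congrArg reflect (σ.apply_symm_apply v).symm

/-- The hyperoctahedral group `W_n`. -/
abbrev Hyp (n : ℕ) : Type := signedPerm n

instance (n : ℕ) : Fintype (Hyp n) := Fintype.ofFinite _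

/-- The permutation of `1, …, n` underlying a signed permutation. -/
def Hyp.underlying {n : ℕ} (σ : Hyp n) : Equiv.Perm (Fin n) where
  toFun i := (σ.1 (i, 1)).1
  invFun i := (σ.1.symm (i, 1)).1
  left_inv i := by
    beta_reduce
    rcases Int.units_eq_one_or (σ.1 (i, 1)).2 with h | h
    · have : ((σ.1 (i, 1)).1, 1) = σ.1 (i, 1) := Prod.ext rfl h.symm
      rw [this, Equiv.symm_apply_apply]
    · have : ((σ.1 (i, 1)).1, 1) = σ.1 (reflect (i, 1)) := by
        rw [σ.2]; exact Prod.ext rfl (by simp [reflect, h])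
      rw [this, Equiv.symm_apply_apply]; rfl
  right_inv i := by
    beta_reduce
    have hs : ∀ v, σ.1.symm (reflect v) = reflect (σ.1.symm v) := (σ⁻¹).2
    rcases Int.units_eq_one_or (σ.1.symm (i, 1)).2 with h | h
    · have : ((σ.1.symm (i, 1)).1, 1) = σ.1.symm (i, 1) := Prod.ext rfl h.symm
      rw [this, Equiv.apply_symm_apply]
    · have : ((σ.1.symm (i, 1)).1, 1) = σ.1.symm (reflect (i, 1)) := by
        rw [hs]; exact Prod.ext rfl (by simp [reflect, h])
      rw [this, Equiv.apply_symm_apply]; rfl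

/-- The sign of a signed permutation: `(-1)` to the number of sign changes, times the sign of the
underlying permutation. -/
def Hyp.sgn {n : ℕ} (σ : Hyp n) : ℤˣ :=
  (∏ i, (σ.1 (i, 1)).2) * Equiv.Perm.sign σ.underlying

/-! ### The Brauer algebra of type `C` -/

/-- A Brauer diagram of type `C`: a perfect matching of the top vertices `Sum.inl v` and the bottom
vertices `Sum.inr v`, symmetric under the reflection `v ↦ -v`. -/
@[ext]
structure Diagram (r : ℕ) where
  rel : Setoid (Node r ⊕ Node r)
  matching : IsMatching rel
  mirror : ∀ x y, rel x y → rel (Sum.map reflect reflect x) (Sum.map reflect reflect y)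

/-- Concatenation: the first diagram is put on top of the second one. -/
def Diagram.mul {r : ℕ} (d e : Diagram r) : Diagram r where
  rel := comp d.rel e.rel
  matching := d.matching.comp e.matching
  mirror := by
    have h : glue d.rel e.rel ≤ (glue d.rel e.rel).comap
        (Sum.map reflect (Sum.map reflect reflect)) := by
      refine glue_le ?_ ?_
      · rintro (p | p) (q | q) h <;> exact glue_upper (d.mirror _ _ h)
      · rintro p q h; exact glue_lower (e.mirror _ _ h)
    rintro (x | x) (y | y) hxy <;> exact h hxy

/-- The diagram of a signed permutation `σ`: the top vertex `σ v` is joined to the bottom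
vertex `v`. -/
def Diagram.ofPerm {r : ℕ} (σ : Hyp r) : Diagram r where
  rel := graphOf σ.1
  matching := isMatching_graphOf σ.1
  mirror := by
    have hh : ∀ x : Node r ⊕ Node r, Sum.elim id σ.1 (Sum.map reflect reflect x) =
        reflect (Sum.elim id σ.1 x) := by
      rintro (x | x)
      exacts [rfl, σ.2 x]
    intro x y h
    have h' : Sum.elim id σ.1 x = Sum.elim id σ.1 y := h
    change Sum.elim id σ.1 _ = Sum.elim id σ.1 _
    rw [hh, hh, h']

theorem Diagram.ofPerm_mul {r : ℕ} (σ τ : Hyp r) :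
    (ofPerm σ).mul (ofPerm τ) = ofPerm (σ * τ) := by
  refine Diagram.ext ?_
  change comp (graphOf σ.1) (graphOf τ.1) = graphOf (σ.1 * τ.1)
  rw [comp_graphOf_left]
  have hh : ∀ x : Node r ⊕ Node r, Sum.elim id (σ.1 * τ.1) x =
      σ.1 (Sum.elim id τ.1 (Sum.map σ.1.symm id x)) := by
    rintro (x | x) <;> simp
  ext x y
  change Sum.elim id τ.1 _ = Sum.elim id τ.1 _ ↔ Sum.elim id _ _ = Sum.elim id _ _
  rw [hh, hh, σ.1.injective.eq_iff]

section Algebra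

variable (K : Type*) [Field K] (δ : K) (r : ℕ)

/-- The Brauer algebra of type `C` with parameter `δ`: the vector space with basis the diagrams. -/
def Brauer (_ : K) (r : ℕ) : Type _ := Diagram r →₀ K

instance : AddCommGroup (Brauer K δ r) := inferInstanceAs (AddCommGroup (Diagram r →₀ K))

instance : Module K (Brauer K δ r) := inferInstanceAs (Module K (Diagram r →₀ K))

variable {K δ r}

/-- The basis element given by a diagram. -/
def Brauer.diag (d : Diagram r) : Brauer K δ r := Finsupp.single d (1 : K)

variable (K δ r)

/-- The multiplication: `d * e = δ ^ (number of closed loops) • (d on top of e)` for diagrams `d`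
and `e`, extended bilinearly. -/
def Brauer.mulLin : Brauer K δ r →ₗ[K] Brauer K δ r →ₗ[K] Brauer K δ r :=
  Finsupp.linearCombination K fun d : Diagram r =>
    (Finsupp.linearCombination K fun e : Diagram r =>
      δ ^ loops d.rel e.rel • (Brauer.diag (d.mul e) : Brauer K δ r) :
        Brauer K δ r →ₗ[K] Brauer K δ r)

variable {K δ r}

instance : Mul (Brauer K δ r) := ⟨fun x y => Brauer.mulLin K δ r x y⟩

instance : One (Brauer K δ r) := ⟨Brauer.diag (Diagram.ofPerm 1)⟩

theorem Brauer.mul_def (x y : Brauer K δ r) : x * y = Brauer.mulLin K δ r x y := rfl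

theorem Brauer.diag_mul_diag (d e : Diagram r) :
    (Brauer.diag d * Brauer.diag e : Brauer K δ r) =
      δ ^ loops d.rel e.rel • Brauer.diag (d.mul e) := by
  rw [Brauer.mul_def, Brauer.mulLin, Brauer.diag, Brauer.diag]
  erw [Finsupp.linearCombination_single, one_smul, Finsupp.linearCombination_single, one_smul]

theorem Brauer.induction {P : Brauer K δ r → Prop} (x : Brauer K δ r)
    (h0 : P 0) (hadd : ∀ x y, P x → P y → P (x + y))
    (hd : ∀ (a : K) d, P (a • Brauer.diag d)) : P x := by
  refine Finsupp.induction_linear (motive := P) x h0 hadd fun d a => ?_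
  have := hd a d
  rw [Brauer.diag] at this
  erw [Finsupp.smul_single, smul_eq_mul, mul_one] at this
  exact this

theorem Brauer.one_def : (1 : Brauer K δ r) = Brauer.diag (Diagram.ofPerm 1) := rfl

theorem Brauer.ofPerm_mul_diag (σ : Hyp r) (d : Diagram r) :
    (Brauer.diag (Diagram.ofPerm σ) * Brauer.diag d : Brauer K δ r) =
      Brauer.diag ((Diagram.ofPerm σ).mul d) := by
  rw [Brauer.diag_mul_diag]
  change δ ^ loops (graphOf σ.1) d.rel • _ = _
  rw [loops_graphOf_left, pow_zero, one_smul]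

theorem Brauer.diag_mul_ofPerm (σ : Hyp r) (d : Diagram r) :
    (Brauer.diag d * Brauer.diag (Diagram.ofPerm σ) : Brauer K δ r) =
      Brauer.diag (d.mul (Diagram.ofPerm σ)) := by
  rw [Brauer.diag_mul_diag]
  change δ ^ loops d.rel (graphOf σ.1) • _ = _
  rw [loops_graphOf_right, pow_zero, one_smul]

protected theorem Brauer.smul_mul (a : K) (x y : Brauer K δ r) : a • x * y = a • (x * y) := by
  simp only [Brauer.mul_def, map_smul, LinearMap.smul_apply]

protected theorem Brauer.mul_smul' (a : K) (x y : Brauer K δ r) : x * a • y = a • (x * y) := by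
  simp only [Brauer.mul_def, map_smul]

protected theorem Brauer.add_mul' (x y z : Brauer K δ r) : (x + y) * z = x * z + y * z := by
  simp only [Brauer.mul_def, map_add, LinearMap.add_apply]

protected theorem Brauer.mul_add' (x y z : Brauer K δ r) : x * (y + z) = x * y + x * z := by
  simp only [Brauer.mul_def, map_add]

protected theorem Brauer.zero_mul' (x : Brauer K δ r) : 0 * x = 0 := by
  simp only [Brauer.mul_def, map_zero, LinearMap.zero_apply]

protected theorem Brauer.mul_zero' (x : Brauer K δ r) : x * 0 = 0 := by
  simp only [Brauer.mul_def, map_zero]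

instance : Ring (Brauer K δ r) where
  __ := (inferInstance : AddCommGroup (Brauer K δ r))
  left_distrib := Brauer.mul_add'
  right_distrib := Brauer.add_mul'
  zero_mul := Brauer.zero_mul'
  mul_zero := Brauer.mul_zero'
  one_mul x := by
    refine Brauer.induction (P := fun x => 1 * x = x) x (Brauer.mul_zero' _) (fun x y hx hy => ?_) (fun a d => ?_)
    · rw [Brauer.mul_add', hx, hy]
    · rw [Brauer.mul_smul', Brauer.one_def, Brauer.ofPerm_mul_diag]
      congr 2
      refine Diagram.ext ?_
      change comp (graphOf (1 : Equiv.Perm (Node r))) d.rel = d.rel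
      rw [comp_graphOf_left]
      ext x y
      rcases x with x | x <;> rcases y with y | y <;> rfl
  mul_one x := by
    refine Brauer.induction (P := fun x => x * 1 = x) x (Brauer.zero_mul' _) (fun x y hx hy => ?_) (fun a d => ?_)
    · rw [Brauer.add_mul', hx, hy]
    · rw [Brauer.smul_mul, Brauer.one_def, Brauer.diag_mul_ofPerm]
      congr 2
      refine Diagram.ext ?_
      change comp d.rel (graphOf (1 : Equiv.Perm (Node r))) = d.rel
      rw [comp_graphOf_right]
      ext x y
      rcases x with x | x <;> rcases y with y | y <;> rfl
  mul_assoc x y z := by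
    refine Brauer.induction (P := fun x => x * y * z = x * (y * z)) x ?_ (fun x x' hx hx' => ?_) (fun a d => ?_)
    · simp only [Brauer.zero_mul']
    · simp only [Brauer.add_mul', hx, hx']
    refine Brauer.induction (P := fun y => _ * y * z = _ * (y * z)) y ?_ (fun x x' hx hx' => ?_) (fun b e => ?_)
    · simp only [Brauer.zero_mul', Brauer.mul_zero']
    · simp only [Brauer.add_mul', Brauer.mul_add', hx, hx']
    refine Brauer.induction (P := fun z => _ * _ * z = _ * (_ * z)) z ?_ (fun x x' hx hx' => ?_) (fun c f => ?_)
    · simp only [Brauer.mul_zero']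
    · simp only [Brauer.mul_add', hx, hx']
    simp only [Brauer.smul_mul, Brauer.mul_smul', Brauer.diag_mul_diag]
    have h1 : loops d.rel e.rel + loops (d.mul e).rel f.rel =
        loops e.rel f.rel + loops d.rel (e.mul f).rel := loops_assoc _ _ _
    have h2 : (d.mul e).mul f = d.mul (e.mul f) := Diagram.ext (comp_assoc _ _ _)
    have h3 : δ ^ loops d.rel e.rel * δ ^ loops (d.mul e).rel f.rel =
        δ ^ loops e.rel f.rel * δ ^ loops d.rel (e.mul f).rel := by
      rw [← pow_add, ← pow_add, h1]
    simp only [smul_smul]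
    rw [h2]
    congr 1
    linear_combination (a * b * c) * h3

instance : Algebra K (Brauer K δ r) :=
  Algebra.ofModule Brauer.smul_mul Brauer.mul_smul'

variable (K δ r) in
/-- The group `W_r` inside the Brauer algebra. -/
def Brauer.ofHyp : Hyp r →* Brauer K δ r where
  toFun σ := Brauer.diag (Diagram.ofPerm σ)
  map_one' := rfl
  map_mul' σ τ := by rw [Brauer.ofPerm_mul_diag, Diagram.ofPerm_mul]

end Algebra

/-- The vertices of `W_{r-l}` identified with the vertices `±(l+1), …, ±r`. -/
def shiftEquiv {r : ℕ} (l : Fin (r + 1)) :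
    Node (r - l) ≃ {v : Node r // (l : ℕ) ≤ v.1} where
  toFun v := ⟨(⟨l + v.1, by have := v.1.2; omega⟩, v.2), by simp⟩
  invFun v := (⟨v.1.1 - l, by have := v.1.1.2; have := v.2; omega⟩, v.1.2)
  left_inv v := by ext <;> simp
  right_inv v := by
    have := v.2
    ext <;> simp
    omega

/-- The embedding of `W_{r-l}` into `W_r` as the signed permutations that fix `±1, …, ±l`. -/
def Hyp.shift {r : ℕ} (l : Fin (r + 1)) : Hyp (r - l) →* Hyp r :=
  ((Equiv.Perm.extendDomainHom (shiftEquiv l)).comp (signedPerm (r - l)).subtype).codRestrict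
    (signedPerm r) (by
      intro σ v
      change σ.1.extendDomain (shiftEquiv l) (reflect v) =
        reflect (σ.1.extendDomain (shiftEquiv l) v)
      by_cases hv : (l : ℕ) ≤ v.1
      · obtain ⟨w, hw⟩ := (shiftEquiv l).surjective ⟨v, hv⟩
        have e1 : v = (shiftEquiv l w : Node r) := by rw [hw]
        have e2 : ∀ u, reflect (shiftEquiv l u : Node r) = shiftEquiv l (reflect u) :=
          fun u => rfl
        rw [e1, e2, Equiv.Perm.extendDomain_apply_image, Equiv.Perm.extendDomain_apply_image,
          σ.2, e2]
      · rw [Equiv.Perm.extendDomain_apply_not_subtype (p := fun v : Node r => (l : ℕ) ≤ v.1) _ _ hv,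
          Equiv.Perm.extendDomain_apply_not_subtype (p := fun v : Node r => (l : ℕ) ≤ v.1)]
        exact hv)

theorem Hyp.shift_of_lt {r : ℕ} (l : Fin (r + 1)) (σ : Hyp (r - l)) (v : Node r)
    (hv : ¬ (l : ℕ) ≤ v.1) : (Hyp.shift l σ).1 v = v :=
  Equiv.Perm.extendDomain_apply_not_subtype (p := fun v : Node r => (l : ℕ) ≤ v.1) _ _ hv

theorem Hyp.le_shift {r : ℕ} (l : Fin (r + 1)) (σ : Hyp (r - l)) (v : Node r)
    (hv : (l : ℕ) ≤ v.1) : (l : ℕ) ≤ ((Hyp.shift l σ).1 v).1 := by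
  change (l : ℕ) ≤ (σ.1.extendDomain (shiftEquiv l) v).1
  rw [Equiv.Perm.extendDomain_apply_subtype (p := fun v : Node r => (l : ℕ) ≤ v.1) _ _ hv]
  exact (shiftEquiv l _).2

theorem eq_neg_of_ne {a b : ℤˣ} : b ≠ a → b = -a := by
  revert a b; decide

/-- Labels for the edges of the diagram with the horizontal edges `{i, -i}` for `1 ≤ i ≤ l` in both
rows and with vertical edges elsewhere. -/
def arcLabel {r : ℕ} (l : ℕ) : Node r ⊕ Node r → (Fin r ⊕ Fin r) ⊕ Node r :=
  Sum.elim (fun v => if l ≤ v.1 then .inr v else .inl (.inl v.1))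
    (fun v => if l ≤ v.1 then .inr v else .inl (.inr v.1))

/-- The diagram with the horizontal edges `{i, -i}` for `1 ≤ i ≤ l` in both rows and with vertical
edges elsewhere. -/
def Diagram.arcs {r : ℕ} (l : ℕ) : Diagram r where
  rel := Setoid.ker (arcLabel l)
  matching := by
    have hu' : ∀ a : ℤˣ, -a ≠ a := by decide
    rintro (⟨i, a⟩ | ⟨i, a⟩)
    · by_cases h : l ≤ i
      · refine ⟨.inr (i, a), ⟨by simp, by simp [arcLabel, h]⟩, ?_⟩
        rintro (⟨j, b⟩ | ⟨j, b⟩) ⟨h1, h2⟩ <;>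
          change arcLabel l _ = arcLabel l _ at h2 <;>
          simp only [arcLabel, Sum.elim_inl, Sum.elim_inr] at h2 <;>
          split_ifs at h2 <;> simp_all
      · refine ⟨.inl (i, -a), ⟨by simp [hu'], by simp [arcLabel, h]⟩, ?_⟩
        rintro (⟨j, b⟩ | ⟨j, b⟩) ⟨h1, h2⟩
        · have h3 : i = j := by
            change arcLabel l _ = arcLabel l _ at h2
            simp only [arcLabel, Sum.elim_inl] at h2
            split_ifs at h2
            simpa using h2
          subst h3
          rw [eq_neg_of_ne (a := a) (b := b) (fun e => h1 (by rw [e]))]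
        · change arcLabel l _ = arcLabel l _ at h2
          simp only [arcLabel, Sum.elim_inl, Sum.elim_inr] at h2
          split_ifs at h2; simp at h2
    · by_cases h : l ≤ i
      · refine ⟨.inl (i, a), ⟨by simp, by simp [arcLabel, h]⟩, ?_⟩
        rintro (⟨j, b⟩ | ⟨j, b⟩) ⟨h1, h2⟩ <;>
          change arcLabel l _ = arcLabel l _ at h2 <;>
          simp only [arcLabel, Sum.elim_inl, Sum.elim_inr] at h2 <;>
          split_ifs at h2 <;> simp_all
      · refine ⟨.inr (i, -a), ⟨by simp [hu'], by simp [arcLabel, h]⟩, ?_⟩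
        rintro (⟨j, b⟩ | ⟨j, b⟩) ⟨h1, h2⟩
        · change arcLabel l _ = arcLabel l _ at h2
          simp only [arcLabel, Sum.elim_inl, Sum.elim_inr] at h2
          split_ifs at h2; simp at h2
        · have h3 : i = j := by
            change arcLabel l _ = arcLabel l _ at h2
            simp only [arcLabel, Sum.elim_inr] at h2
            split_ifs at h2
            simpa using h2
          subst h3
          rw [eq_neg_of_ne (a := a) (b := b) (fun e => h1 (by rw [e]))]
  mirror := by
    have hh : ∀ x : Node r ⊕ Node r, arcLabel l (Sum.map reflect reflect x) =
        Sum.map id reflect (arcLabel l x) := by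
      rintro (⟨i, a⟩ | ⟨i, a⟩) <;> by_cases h : l ≤ i <;> simp [arcLabel, reflect, h]
    intro x y h
    have h' : arcLabel l x = arcLabel l y := h
    change arcLabel l _ = arcLabel l _
    rw [hh, hh, h']

theorem Diagram.shift_mul_arcs {r : ℕ} (l : Fin (r + 1)) (σ : Hyp (r - l)) :
    (ofPerm (Hyp.shift l σ)).mul (arcs l) = (arcs l).mul (ofPerm (Hyp.shift l σ)) := by
  refine Diagram.ext ?_
  change comp (graphOf (Hyp.shift l σ).1) (arcs l).rel = comp (arcs l).rel (graphOf _)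
  rw [comp_graphOf_left, comp_graphOf_right]
  set τ := (Hyp.shift l σ).1 with hτ
  have h1 : ∀ v : Node r, ¬ (l : ℕ) ≤ v.1 → τ v = v := Hyp.shift_of_lt l σ
  have h2 : ∀ v : Node r, (l : ℕ) ≤ v.1 → (l : ℕ) ≤ (τ v).1 := Hyp.le_shift l σ
  have h3 : ∀ v : Node r, ¬ (l : ℕ) ≤ v.1 → τ.symm v = v := fun v hv => by
    rw [Equiv.symm_apply_eq, h1 v hv]
  have h4 : ∀ v : Node r, (l : ℕ) ≤ v.1 → (l : ℕ) ≤ (τ.symm v).1 := fun v hv => by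
    by_contra hc
    have := h1 _ hc
    rw [Equiv.apply_symm_apply] at this
    exact hc (this ▸ hv)
  have hh : ∀ x : Node r ⊕ Node r, arcLabel l (Sum.map id τ x) =
      Sum.map id τ (arcLabel l (Sum.map τ.symm id x)) := by
    rintro (v | v) <;> by_cases hv : (l : ℕ) ≤ v.1
    · simp [arcLabel, hv, h4 v hv]
    · simp [arcLabel, hv, h3 v hv]
    · simp [arcLabel, hv, h2 v hv]
    · simp [arcLabel, hv, h1 v hv]
  ext x y
  change arcLabel l _ = arcLabel l _ ↔ arcLabel l _ = arcLabel l _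
  rw [hh, hh, (Function.Injective.sumMap Function.injective_id τ.injective).eq_iff]

/-- `d.HasHorizontal k`: at least `k` horizontal edges in the top row, that is, at least `2 * k` top
vertices are joined to another top vertex. (There are as many horizontal edges in the bottom
row.) -/
def Diagram.HasHorizontal {r : ℕ} (d : Diagram r) (k : ℕ) : Prop :=
  2 * k ≤ Nat.card {v : Node r // ∃ u, u ≠ v ∧ d.rel (Sum.inl v) (Sum.inl u)}

section Functors

variable (K : Type*) [Field K] (δ : K) {r : ℕ}

/-- The group algebra of `W_n`. -/
abbrev HypAlg (n : ℕ) : Type _ := MonoidAlgebra K (Hyp n)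

/-- The idempotent `e_l`, namely `δ ^ (-l)` times the diagram with horizontal edges `{i, -i}` for
`1 ≤ i ≤ l` in both rows. -/
def Brauer.idem (l : Fin (r + 1)) : Brauer K δ r :=
  (δ⁻¹) ^ (l : ℕ) • Brauer.diag (Diagram.arcs l)

/-- The group algebra of `W_{r-l}` inside the Brauer algebra, acting on `±(l+1), …, ±r`. -/
def Brauer.ofHypAlg (l : Fin (r + 1)) : HypAlg K (r - l) →ₐ[K] Brauer K δ r :=
  MonoidAlgebra.lift K _ _ ((Brauer.ofHyp K δ r).comp (Hyp.shift l))

theorem Brauer.ofHypAlg_mul_idem (l : Fin (r + 1)) (a : HypAlg K (r - l)) :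
    Brauer.ofHypAlg K δ l a * Brauer.idem K δ l = Brauer.idem K δ l * Brauer.ofHypAlg K δ l a := by
  induction a using MonoidAlgebra.induction_on with
  | of σ =>
    have h : Brauer.ofHypAlg K δ l (MonoidAlgebra.of K _ σ) =
        Brauer.diag (Diagram.ofPerm (Hyp.shift l σ)) := by
      simp [Brauer.ofHypAlg, Brauer.ofHyp]
    rw [h, Brauer.idem, mul_smul_comm, smul_mul_assoc, Brauer.ofPerm_mul_diag,
      Brauer.diag_mul_ofPerm, Diagram.shift_mul_arcs]
  | add a b ha hb => rw [map_add, add_mul, mul_add, ha, hb]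
  | smul c a ha => rw [map_smul, smul_mul_assoc, mul_smul_comm, ha]

/-- The two-sided ideal `J_k` generated by the diagrams with at least `k` horizontal edges. -/
def Brauer.idealJ (r k : ℕ) : Ideal (Brauer K δ r) :=
  (TwoSidedIdeal.span
    (Set.range fun d : {d : Diagram r // d.HasHorizontal k} =>
      (Brauer.diag d.1 : Brauer K δ r))).asIdeal

instance (r k : ℕ) : (Brauer.idealJ K δ r k).IsTwoSided :=
  inferInstanceAs (TwoSidedIdeal.asIdeal _).IsTwoSided

variable {K δ} {Q : Type*} [Ring Q] [Algebra K Q]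

/-- For a homomorphism `π` from the Brauer algebra to `Q`, the right ideal `e_l Q`. It is a
`W_{r-l}`-`Brauer`-bimodule. -/
def Corner (π : Brauer K δ r →ₐ[K] Q) (l : Fin (r + 1)) : Type _ :=
  LinearMap.range (LinearMap.mulLeft K (π (Brauer.idem K δ l)))

variable (π : Brauer K δ r →ₐ[K] Q) (l : Fin (r + 1))

instance : AddCommGroup (Corner π l) := inferInstanceAs (AddCommGroup (LinearMap.range _))

instance : Module K (Corner π l) := inferInstanceAs (Module K (LinearMap.range _))

/-- The element of `Q` given by an element of `e_l Q`. -/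
def Corner.val {π : Brauer K δ r →ₐ[K] Q} {l : Fin (r + 1)} : Corner π l →ₗ[K] Q :=
  Submodule.subtype _

theorem Corner.ext {π : Brauer K δ r →ₐ[K] Q} {l : Fin (r + 1)} {x y : Corner π l}
    (h : x.val = y.val) : x = y := Subtype.ext h

/-- The left action of `W_{r-l}` on `e_l Q`. -/
instance : Module (HypAlg K (r - l)) (Corner π l) where
  smul a x := ⟨π (Brauer.ofHypAlg K δ l a) * x.val, by
    obtain ⟨_, y, rfl⟩ := x
    refine ⟨π (Brauer.ofHypAlg K δ l a) * y, ?_⟩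
    change π _ * (π _ * y) = π _ * (π _ * y)
    rw [← mul_assoc, ← mul_assoc, ← map_mul, ← map_mul, Brauer.ofHypAlg_mul_idem]⟩
  one_smul x := Corner.ext <| by
    change π (Brauer.ofHypAlg K δ l 1) * x.val = x.val
    rw [map_one, map_one, one_mul]
  mul_smul a b x := Corner.ext <| by
    change π (Brauer.ofHypAlg K δ l (a * b)) * x.val = π _ * (π _ * x.val)
    rw [map_mul, map_mul, mul_assoc]
  smul_zero a := Corner.ext <| mul_zero (π (Brauer.ofHypAlg K δ l a))
  smul_add a x y := Corner.ext <| mul_add (π (Brauer.ofHypAlg K δ l a)) x.val y.val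
  add_smul a b x := Corner.ext <| by
    change π (Brauer.ofHypAlg K δ l (a + b)) * x.val = π _ * x.val + π _ * x.val
    rw [map_add, map_add, add_mul]
  zero_smul x := Corner.ext <| by
    change π (Brauer.ofHypAlg K δ l 0) * x.val = 0
    rw [map_zero, map_zero, zero_mul]

/-- The right action of the Brauer algebra on `e_l Q`. -/
instance : Module (Brauer K δ r)ᵐᵒᵖ (Corner π l) where
  smul b x := ⟨x.val * π b.unop, by
    obtain ⟨_, y, rfl⟩ := x
    exact ⟨y * π b.unop, (mul_assoc _ _ _).symm⟩⟩
  one_smul x := Corner.ext <| by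
    change x.val * π 1 = x.val
    rw [map_one, mul_one]
  mul_smul a b x := Corner.ext <| by
    change x.val * π (b.unop * a.unop) = x.val * π b.unop * π a.unop
    rw [map_mul, mul_assoc]
  smul_zero a := Corner.ext <| zero_mul (π a.unop)
  smul_add a x y := Corner.ext <| add_mul x.val y.val (π a.unop)
  add_smul a b x := Corner.ext <| by
    change x.val * π (a.unop + b.unop) = x.val * π a.unop + x.val * π b.unop
    rw [map_add, mul_add]
  zero_smul x := Corner.ext <| by
    change x.val * π 0 = 0
    rw [map_zero, mul_zero]

instance : SMulCommClass K (Brauer K δ r)ᵐᵒᵖ (Corner π l) where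
  smul_comm c b x := Corner.ext <| (smul_mul_assoc c x.val (π b.unop)).symm

variable (M : Type*) [AddCommGroup M] [Module K M] [Module (HypAlg K (r - l))ᵐᵒᵖ M]

/-- The relations `a x ⊗ m = x ⊗ m a` that define the tensor product over the group algebra. -/
def balanced : Submodule (Brauer K δ r)ᵐᵒᵖ (Corner π l ⊗[K] M) :=
  Submodule.span _ {z | ∃ (a : HypAlg K (r - l)) (x : Corner π l) (m : M),
    z = (a • x) ⊗ₜ[K] m - x ⊗ₜ[K] (MulOpposite.op a • m)}

/-- The right module `M ⊗ e_l Q` over the Brauer algebra, where the tensor product is over the group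
algebra of `W_{r-l}`. The two factors are written in the opposite order. -/
abbrev TensorCorner : Type _ := (Corner π l ⊗[K] M) ⧸ balanced π l M

variable (δ)

/-- `Ind_l M = M ⊗ e_l B`. -/
abbrev IndBig : Type _ := TensorCorner (AlgHom.id K (Brauer K δ r)) l M

/-- `ind_l M = M ⊗ e_l (B / J_{l+1})`. -/
abbrev IndLayer : Type _ :=
  TensorCorner (Ideal.Quotient.mkₐ K (Brauer.idealJ K δ r (l + 1))) l M

end Functors

/-! ### Bi-partitions, tabloids, permutation modules -/

/-- A bi-partition of `n`. -/
@[ext]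
structure BiPartition (n : ℕ) where
  fst : YoungDiagram
  snd : YoungDiagram
  card_add : fst.card + snd.card = n

/-- The dominance order `lam ⊵ mu` on bi-partitions in which the second components are compared
first. The second component is the one in which row permutations may change signs. -/
def BiPartition.Dominates {n : ℕ} (lam mu : BiPartition n) : Prop :=
  (∀ j, ∑ i ∈ Finset.range j, mu.snd.rowLen i ≤ ∑ i ∈ Finset.range j, lam.snd.rowLen i) ∧
    ∀ j, mu.snd.card + ∑ i ∈ Finset.range j, mu.fst.rowLen i ≤
      lam.snd.card + ∑ i ∈ Finset.range j, lam.fst.rowLen i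

section Tabloids

variable (K : Type*) [Field K] {n : ℕ} (lam : BiPartition n)

/-- The boxes of a bi-partition; a box is a pair (row, column) in one of the two diagrams. -/
abbrev BiPartition.Box : Type := lam.fst.cells ⊕ lam.snd.cells

/-- A bi-tableau: a filling of the boxes with elements of `{-n, …, -1, 1, …, n}` such that for each
`i` exactly one of `i`, `-i` occurs, and it occurs once. It is recorded as a bijection from signed
boxes to `{-n, …, -1, 1, …, n}` that commutes with `-1`; the entry of the box `c` is the image
of `(c, 1)`. -/
structure BiTableau where
  entry : lam.Box × ℤˣ ≃ Node n
  entry_reflect : ∀ x, entry (reflect x) = reflect (entry x)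

variable {lam}

/-- What row permutations preserve of a signed box: the row, and in the first diagram the sign. -/
def rowLabel (x : lam.Box × ℤˣ) : (ℕ × ℤˣ) ⊕ ℕ :=
  Sum.elim (fun c => .inl (c.1.1, x.2)) (fun c => .inr c.1.1) x.1

/-- What column permutations preserve of a signed box: the column, and in the second diagram the
sign. -/
def colLabel (x : lam.Box × ℤˣ) : ℕ ⊕ (ℕ × ℤˣ) :=
  Sum.elim (fun c => .inl c.1.2) (fun c => .inr (c.1.2, x.2)) x.1

namespace BiTableau

/-- The signed permutations that preserve the labels of the entries. -/
def labelGroup {A : Type} (t : BiTableau lam) (f : lam.Box × ℤˣ → A) : Subgroup (Hyp n) where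
  carrier := {σ | ∀ v, f (t.entry.symm (σ.1 v)) = f (t.entry.symm v)}
  mul_mem' {σ τ} hσ hτ v := (hσ (τ.1 v)).trans (hτ v)
  one_mem' _ := rfl
  inv_mem' {σ} hσ v := by
    have := hσ (σ.1.symm v)
    rw [Equiv.apply_symm_apply] at this
    exact this.symm

/-- The row permutations: they permute the entries within each row and may change the signs of
entries in the second diagram. -/
def rowGroup (t : BiTableau lam) : Subgroup (Hyp n) := t.labelGroup rowLabel

/-- The column permutations: they permute the entries within each column and may change the signs
of entries in the first diagram. -/
def colGroup (t : BiTableau lam) : Subgroup (Hyp n) := t.labelGroup colLabel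

/-- The right action of `W_n` on bi-tableaux by permuting the entries. -/
def act (t : BiTableau lam) (σ : Hyp n) : BiTableau lam where
  entry := t.entry.trans σ.1.symm
  entry_reflect x := by
    have hs : ∀ v, σ.1.symm (reflect v) = reflect (σ.1.symm v) := (σ⁻¹).2
    change σ.1.symm (t.entry (reflect x)) = reflect (σ.1.symm (t.entry x))
    rw [t.entry_reflect, hs]

theorem act_one (t : BiTableau lam) : t.act 1 = t := rfl

theorem act_mul (t : BiTableau lam) (σ τ : Hyp n) : t.act (σ * τ) = (t.act σ).act τ := rfl

/-- The action on tableaux replaces the row group by a conjugate. -/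
theorem mem_rowGroup_act (t : BiTableau lam) (σ τ : Hyp n) :
    τ ∈ (t.act σ).rowGroup ↔ σ * τ * σ⁻¹ ∈ t.rowGroup := by
  change (∀ v, rowLabel (t.entry.symm (σ.1 (τ.1 v))) = rowLabel (t.entry.symm (σ.1 v))) ↔
    ∀ v, rowLabel (t.entry.symm (σ.1 (τ.1 (σ.1.symm v)))) = rowLabel (t.entry.symm v)
  constructor
  · intro h v
    rw [h, Equiv.apply_symm_apply]
  · intro h v
    have := h (σ.1 v)
    rwa [Equiv.symm_apply_apply] at this

end BiTableau

variable (lam) in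
/-- Row equivalence of bi-tableaux. -/
def rowEquiv : Setoid (BiTableau lam) where
  r t s := ∃ σ ∈ t.rowGroup, s = t.act σ
  iseqv :=
    { refl := fun t => ⟨1, one_mem _, rfl⟩
      symm := by
        rintro t _ ⟨σ, hσ, rfl⟩
        refine ⟨σ⁻¹, ?_, ?_⟩
        · rw [BiTableau.mem_rowGroup_act]
          simpa using hσ
        · rw [← BiTableau.act_mul, mul_inv_cancel, BiTableau.act_one]
      trans := by
        rintro t _ _ ⟨σ, hσ, rfl⟩ ⟨τ, hτ, rfl⟩
        refine ⟨σ * τ, ?_, (BiTableau.act_mul _ _ _).symm⟩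
        rw [BiTableau.mem_rowGroup_act] at hτ
        simpa using mul_mem hτ hσ }

variable (lam) in
/-- Bi-tabloids: row equivalence classes of bi-tableaux. -/
def Tabloid : Type := Quotient (rowEquiv lam)

/-- The right action of `W_n` on bi-tabloids. -/
def Tabloid.act (σ : Hyp n) : Tabloid lam → Tabloid lam :=
  Quotient.map (fun t => t.act σ) (by
    rintro t _ ⟨τ, hτ, rfl⟩
    refine ⟨σ⁻¹ * τ * σ, ?_, ?_⟩
    · rw [BiTableau.mem_rowGroup_act]
      simpa [mul_assoc] using hτ
    · rw [← BiTableau.act_mul, ← BiTableau.act_mul]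
      congr 1
      group)

variable (lam) in
/-- The permutation module `M(λ)` of `W_n`, with basis the bi-tabloids. -/
def PermMod : Type _ := Tabloid lam →₀ K

instance : AddCommGroup (PermMod K lam) := inferInstanceAs (AddCommGroup (Tabloid lam →₀ K))

instance : Module K (PermMod K lam) := inferInstanceAs (Module K (Tabloid lam →₀ K))

/-- The linear extension of the right action of a signed permutation on bi-tabloids. -/
def PermMod.actLin (σ : Hyp n) : Module.End K (PermMod K lam) :=
  Finsupp.lmapDomain K K (Tabloid.act (lam := lam) σ)

theorem PermMod.actLin_one : PermMod.actLin K (lam := lam) 1 = 1 := by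
  refine (congrArg (Finsupp.lmapDomain K K) (funext ?_)).trans (Finsupp.lmapDomain_id K K)
  rintro ⟨t⟩; rfl

theorem PermMod.actLin_mul (σ τ : Hyp n) :
    PermMod.actLin K (lam := lam) (σ * τ) = PermMod.actLin K τ * PermMod.actLin K σ := by
  refine (congrArg (Finsupp.lmapDomain K K) (funext ?_)).trans
    (Finsupp.lmapDomain_comp K K (Tabloid.act σ) (Tabloid.act τ))
  rintro ⟨t⟩; rfl

variable (lam) in
/-- The linear extension of the right action on bi-tabloids. -/
def PermMod.action : (HypAlg K n)ᵐᵒᵖ →ₐ[K] Module.End K (PermMod K lam) :=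
  AlgHom.opComm (MonoidAlgebra.lift K _ _
    { toFun := fun σ => MulOpposite.op (PermMod.actLin K σ)
      map_one' := by rw [PermMod.actLin_one, MulOpposite.op_one]
      map_mul' := fun σ τ => by rw [PermMod.actLin_mul, MulOpposite.op_mul] })

/-- `M(λ)` as a right module over the group algebra of `W_n`. -/
instance : Module (HypAlg K n)ᵐᵒᵖ (PermMod K lam) :=
  Module.compHom _ (PermMod.action K lam).toRingHom

instance : IsScalarTower K (HypAlg K n)ᵐᵒᵖ (PermMod K lam) where
  smul_assoc c a m := by
    change PermMod.action K lam (c • a) m = c • PermMod.action K lam a m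
    rw [map_smul, LinearMap.smul_apply]

/-- The alternating column sum of a bi-tableau. -/
def colSum (t : BiTableau lam) : HypAlg K n := by
  classical exact ∑ σ with σ ∈ t.colGroup, MonoidAlgebra.single σ (((σ.sgn : ℤ) : K))

/-- The basis element `{t}` of `M(λ)`. -/
def tabloidOf (t : BiTableau lam) : PermMod K lam :=
  Finsupp.single (Quotient.mk (rowEquiv lam) t : Tabloid lam) (1 : K)

/-- The polytabloid `{t} k_t`. -/
def polytabloid (t : BiTableau lam) : PermMod K lam :=
  MulOpposite.op (colSum K t) • tabloidOf K t

variable (lam) in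
/-- The Specht module `S(λ)`. -/
def specht : Submodule (HypAlg K n)ᵐᵒᵖ (PermMod K lam) :=
  Submodule.span _ (Set.range (polytabloid K))

end Tabloids

/-! ### Direct summands and Young modules -/

section Summands

variable (R : Type*) [Ring R]

/-- A nonzero module that is not the direct sum of two nonzero submodules. -/
def Indecomposable (M : Type*) [AddCommGroup M] [Module R M] : Prop :=
  Nontrivial M ∧ ∀ P Q : Submodule R M, IsCompl P Q → P = ⊥ ∨ Q = ⊥

/-- `N` is isomorphic to a direct summand of `M`. -/
def IsSummand (N M : Type*) [AddCommGroup N] [Module R N] [AddCommGroup M] [Module R M] : Prop :=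
  ∃ P Q : Submodule R M, IsCompl P Q ∧ Nonempty (N ≃ₗ[R] P)

variable {R} in
/-- `M` is the internal direct sum of the indecomposable submodules `P 0, …, P (k - 1)`. -/
def IsDecomposition {M : Type*} [AddCommGroup M] [Module R M] {k : ℕ}
    (P : Fin k → Submodule R M) : Prop :=
  DirectSum.IsInternal P ∧ ∀ i, Indecomposable R (P i)

/-- `M` is a finite direct sum of indecomposable submodules, and in every such decomposition exactly
one of the summands is isomorphic to `N`. -/
def OccursOnce (N M : Type*) [AddCommGroup N] [Module R N] [AddCommGroup M] [Module R M] : Prop :=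
  (∃ (k : ℕ) (P : Fin k → Submodule R M), IsDecomposition P) ∧
    ∀ (k : ℕ) (P : Fin k → Submodule R M), IsDecomposition P →
      ∃! i, Nonempty (N ≃ₗ[R] P i)

end Summands

section Young

variable (K : Type*) [Field K]

/-- `Y` is the Young module `Y(λ)` of `W_n`: an indecomposable direct summand of `M(λ)` that
contains the Specht module. -/
def IsYoungHyp {n : ℕ} (lam : BiPartition n)
    (Y : Submodule (HypAlg K n)ᵐᵒᵖ (PermMod K lam)) : Prop :=
  Indecomposable (HypAlg K n)ᵐᵒᵖ Y ∧ (∃ Z, IsCompl Y Z) ∧ specht K lam ≤ Y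

/-- The index set of pairs `(l, λ)` with `0 ≤ l ≤ r` and `λ` a bi-partition of `r - l`. -/
abbrev Index (r : ℕ) : Type := Σ l : Fin (r + 1), BiPartition (r - l)

variable {K} (δ : K) {r : ℕ}

/-- The permutation module `M(l, λ) = Ind_l M(λ)` of the Brauer algebra. -/
abbrev BPermMod (x : Index r) : Type _ := IndBig δ x.1 (PermMod K x.2)

/-- `N` is the Young module `Y(l, λ)`: an indecomposable direct summand of `M(l, λ)` that has a
quotient isomorphic to `ind_l Y(λ)`. -/
def IsYoung (x : Index r) (N : Submodule (Brauer K δ r)ᵐᵒᵖ (BPermMod δ x)) : Prop :=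
  Indecomposable (Brauer K δ r)ᵐᵒᵖ N ∧ (∃ P, IsCompl N P) ∧
    ∃ Y, IsYoungHyp K x.2 Y ∧
      ∃ f : N →ₗ[(Brauer K δ r)ᵐᵒᵖ] IndLayer δ x.1 Y, Function.Surjective f

end Young

end TypeC

end

open scoped TensorProduct

noncomputable section

namespace TypeC

/-! All claims are read off from ring homomorphisms χ from an endomorphism ring to the field `K`.
Let `M` have finite length and let χ : End M → K be such a character. In a decomposition of `M` into
indecomposables the projections are orthogonal idempotents with sum 1, so χ is nonzero on exactly
one of them. If the projections onto two indecomposable summands both have nonzero character, the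
round trips between the summands through `M` are not nilpotent, so they are bijective by Fitting's
lemma and the summands are isomorphic. Thus χ singles out one isomorphism class of summands, and it
occurs once (`nonempty_equiv_of_character_ne_zero`, `occursOnce_of_character_ne_zero`);
Krull–Schmidt is not needed.

For W_n the character comes from James's argument. Let k_t be the alternating column sum of a
tableau t of shape λ. If {s} k_t ≠ 0, then no two entries share a row of s and a column of t
(`Transverse`): otherwise a sign change or signed transposition, of sign -1, fixes {s} and the sum
cancels. Counting entries gives λ ⊵ μ when s has shape μ, and {s} k_t = ± {t} k_t when μ = λ. So
M(λ) k_t is the line through the polytabloid {t} k_t, and every endomorphism of M(λ) scales that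
polytabloid (`polyChar`). An indecomposable summand contains S(λ) exactly when its projection has
nonzero character. The characteristic of `K` plays no role, because {t} has coefficient 1 in {t}
k_t.

For the Brauer algebra, δ ≠ 0 makes e_l idempotent, and e_l (B / J_{l+1}) e_l is the group algebra
of W_{r-l}: every e_l x e_l is congruent to φ(x) e_l for a unique φ(x) (`symbol`). The maps m ↦ m ⊗
e_l and m ⊗ x ↦ m φ(x) turn a homomorphism Ind_l M → Ind_l M' into one M → M'. This localization
respects composition (`localizeBig_comp`) and undoes induction (`localize_tensorCornerMap`).
Followed by `polyChar` it gives a character `youngChar` of End M(l, λ), and Y(l, λ) is characterized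
as an indecomposable summand on which it does not vanish.

Existence, uniqueness and claim 1 follow at once. For claim 2, e_m lies in J_{l+1} when l < m, so an
endomorphism of M(l, λ) that factors through Ind_m X localizes to zero (`localizeBig_eq_zero`). For
claim 3, factorizations of maps of nonzero character are carried back and forth by localization and
induction, and Y(λ) k_t ≠ 0 forces dominance. Claim 4 combines these with antisymmetry of dominance.
-/

/-! ### Modules of finite length -/

section Fitting

variable {R : Type*} [Ring R] {N : Type*} [AddCommGroup N] [Module R N]

/-- Fitting's lemma. -/
theorem Indecomposable.bijective_of_not_isNilpotent [IsNoetherian R N] [IsArtinian R N]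
    (hN : Indecomposable R N) {u : Module.End R N} (hu : ¬ IsNilpotent u) :
    Function.Bijective u := by
  obtain ⟨n, hn⟩ := (u.eventually_isCompl_ker_pow_range_pow.and
    (Filter.eventually_gt_atTop 0)).exists
  -- A positive exponent is needed so that a factor `u` splits off on either side: one side yields
  -- injectivity, the other surjectivity.
  obtain ⟨n, rfl⟩ : ∃ k, n = k + 1 := ⟨n - 1, by omega⟩
  rcases hN.2 _ _ hn.1 with h | h
  · have h2 : LinearMap.range (u ^ (n + 1)) = ⊤ := by
      have := hn.1.sup_eq_top
      rwa [h, bot_sup_eq] at this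
    constructor
    · have := LinearMap.ker_eq_bot.1 h
      rw [pow_succ] at this
      exact Function.Injective.of_comp (f := ⇑(u ^ n)) this
    · have := LinearMap.range_eq_top.1 h2
      rw [pow_succ'] at this
      exact Function.Surjective.of_comp (g := ⇑(u ^ n)) this
  · exact absurd ⟨n + 1, LinearMap.range_eq_bot.1 h⟩ hu

end Fitting

/-! ### Decompositions into indecomposable submodules -/

section Decomposition

variable {R : Type*} [Ring R] {M : Type*} [AddCommGroup M] [Module R M]

/-- Well-founded induction on `N`: a decomposable `N` splits into two strictly smaller submodules.
Working inside the lattice of submodules of the fixed module `M` lets the two families be joined by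
a union. -/
theorem exists_finset_indecomposable [IsArtinian R M] (N : Submodule R M) :
    ∃ s : Finset (Submodule R M), s.SupIndep id ∧ s.sup id = N ∧
      ∀ P ∈ s, Indecomposable R P := by
  classical
  induction N using WellFoundedLT.induction with
  | ind N ih =>
    by_cases h0 : N = ⊥
    · exact ⟨∅, Finset.supIndep_empty _, by simp [h0], by simp⟩
    by_cases hN : Indecomposable R N
    · exact ⟨{N}, Finset.supIndep_singleton _ _, by simp, by simpa using hN⟩
    have : Nontrivial N := Submodule.nontrivial_iff_ne_bot.2 h0
    simp only [Indecomposable, this, true_and, not_forall, not_or] at hN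
    obtain ⟨P, Q, hPQ, hP, hQ⟩ := hN
    have hinj : Function.Injective N.subtype := N.injective_subtype
    have hdis : Disjoint (P.map N.subtype) (Q.map N.subtype) := by
      rw [disjoint_iff, ← Submodule.map_inf _ hinj, hPQ.inf_eq_bot, Submodule.map_bot]
    have hsup : P.map N.subtype ⊔ Q.map N.subtype = N := by
      rw [← Submodule.map_sup, hPQ.sup_eq_top, Submodule.map_subtype_top]
    have hlt : ∀ A B : Submodule R N, B ≠ ⊥ → Disjoint (A.map N.subtype) (B.map N.subtype) →
        A.map N.subtype < N := by
      intro A B hB hd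
      refine lt_of_le_of_ne (Submodule.map_subtype_le _ _) fun e => hB ?_
      rw [e, disjoint_iff, inf_eq_right.2 (Submodule.map_subtype_le _ _)] at hd
      exact Submodule.map_injective_of_injective hinj (hd.trans (Submodule.map_bot _).symm)
    obtain ⟨s, hs1, hs2, hs3⟩ := ih _ (hlt P Q hQ hdis)
    obtain ⟨t, ht1, ht2, ht3⟩ := ih _ (hlt Q P hP hdis.symm)
    refine ⟨s ∪ t, hs1.union ht1 (by rwa [hs2, ht2]), by rw [Finset.sup_union, hs2, ht2, hsup], ?_⟩
    intro A hA
    rcases Finset.mem_union.1 hA with h | h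
    exacts [hs3 A h, ht3 A h]

theorem exists_isDecomposition (R M : Type*) [Ring R] [AddCommGroup M] [Module R M]
    [IsArtinian R M] : ∃ (k : ℕ) (P : Fin k → Submodule R M), IsDecomposition P := by
  obtain ⟨s, h1, h2, h3⟩ := exists_finset_indecomposable (⊤ : Submodule R M)
  refine ⟨s.card, fun i => s.equivFin.symm i, ?_, fun i => h3 _ (s.equivFin.symm i).2⟩
  rw [DirectSum.isInternal_submodule_iff_iSupIndep_and_iSup_eq_top]
  constructor
  · exact (iSupIndep_comp_coe_iff_supIndep.2 h1).comp s.equivFin.symm.injective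
  · rw [← h2, Finset.sup_eq_iSup, iSup_subtype', ← s.equivFin.symm.iSup_comp]
    rfl

variable {k : ℕ} {P : Fin k → Submodule R M}

/-- The projections of a direct sum onto its summands. -/
theorem exists_projections (h : DirectSum.IsInternal P) :
    ∃ p : ∀ i, M →ₗ[R] P i, (∀ i, p i ∘ₗ (P i).subtype = LinearMap.id) ∧
      (∀ i j, i ≠ j → p i ∘ₗ (P j).subtype = 0) ∧ ∑ i, (P i).subtype ∘ₗ p i = LinearMap.id := by
  classical
  let e : (DirectSum (Fin k) fun i => P i) ≃ₗ[R] M :=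
    LinearEquiv.ofBijective (DirectSum.coeLinearMap P) h
  have he : ∀ i (x : P i), e.symm x = DirectSum.lof R _ (fun i => P i) i x := by
    intro i x
    rw [LinearEquiv.symm_apply_eq]
    exact (DirectSum.coeLinearMap_lof P i x).symm
  refine ⟨fun i => DirectSum.component R _ _ i ∘ₗ e.symm.toLinearMap, ?_, ?_, ?_⟩
  · intro i
    ext x
    simp [he, DirectSum.component.lof_self]
  · intro i j hij
    ext x
    simp [he, DirectSum.component.of, hij.symm]
  · ext x
    obtain ⟨y, rfl⟩ := e.surjective x
    induction y using DirectSum.induction_on with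
    | zero => simp
    | add y z hy hz => rw [map_add, map_add, hy, hz, map_add]
    | of i y =>
      have : e (DirectSum.of (fun i => P i) i y) = (y : M) := DirectSum.coeLinearMap_lof P i y
      rw [this]
      simp only [LinearMap.coe_sum, Finset.sum_apply, LinearMap.comp_apply, LinearMap.id_apply]
      rw [Finset.sum_eq_single i]
      · simp [he, DirectSum.component.lof_self]
      · intro j _ hj
        simp [he, DirectSum.component.of, hj.symm]
      · simp

end Decomposition

/-! ### Direct summands and split homomorphisms -/

section Summands

variable {R : Type*} [Ring R] {N M : Type*} [AddCommGroup N] [Module R N]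
  [AddCommGroup M] [Module R M]

/-- The image of `f` is complemented by the kernel of `g`: subtract `f (g ∘ f)⁻¹ g x` from `x`. -/
theorem isSummand_of_bijective {f : N →ₗ[R] M} {g : M →ₗ[R] N}
    (h : Function.Bijective (g ∘ₗ f)) : IsSummand R N M := by
  let e := LinearEquiv.ofBijective _ h
  have hf : Function.Injective f := Function.Injective.of_comp (f := ⇑g) h.1
  refine ⟨LinearMap.range f, LinearMap.ker g, ?_, ⟨LinearEquiv.ofInjective f hf⟩⟩
  constructor
  · rw [Submodule.disjoint_def]
    rintro _ ⟨x, rfl⟩ hx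
    rw [show x = 0 from h.1 (hx.trans (map_zero (g ∘ₗ f)).symm), map_zero]
  · rw [codisjoint_iff, Submodule.eq_top_iff']
    intro x
    rw [Submodule.mem_sup]
    have : g (f (e.symm (g x))) = g x := e.apply_symm_apply (g x)
    exact ⟨f (e.symm (g x)), ⟨_, rfl⟩, x - f (e.symm (g x)), by simp [this], by simp⟩

theorem IsSummand.exists_comp_eq_id (h : IsSummand R N M) :
    ∃ (i : N →ₗ[R] M) (p : M →ₗ[R] N), p ∘ₗ i = LinearMap.id := by
  obtain ⟨P, Q, hPQ, ⟨e⟩⟩ := h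
  refine ⟨P.subtype ∘ₗ e.toLinearMap, e.symm.toLinearMap ∘ₗ P.projectionOnto Q hPQ, ?_⟩
  ext x
  simp

end Summands

/-! ### Summands detected by a character of the endomorphism ring -/

section Character

variable {R : Type*} [Ring R] {K : Type*} [Field K] {M : Type*} [AddCommGroup M] [Module R M]
  (χ : Module.End R M →+* K)

/-- The two idempotents have the form `u * v` and `v * u`, and `K` is commutative. So the character
of a summand depends on neither the embedding nor the complement. -/
theorem character_comm {N : Type*} [AddCommGroup N] [Module R N]
    {i j : N →ₗ[R] M} {p q : M →ₗ[R] N} (hp : p ∘ₗ i = LinearMap.id) (hq : q ∘ₗ j = LinearMap.id) :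
    χ (i ∘ₗ p) = χ (j ∘ₗ q) := by
  have h1 : i ∘ₗ p = (i ∘ₗ q) * (j ∘ₗ p) := by
    rw [Module.End.mul_eq_comp, LinearMap.comp_assoc, ← LinearMap.comp_assoc p j q, hq,
      LinearMap.id_comp]
  have h2 : j ∘ₗ q = (j ∘ₗ p) * (i ∘ₗ q) := by
    rw [Module.End.mul_eq_comp, LinearMap.comp_assoc, ← LinearMap.comp_assoc q i p, hp,
      LinearMap.id_comp]
  rw [h1, h2, map_mul, map_mul, mul_comm]

/-- Since `p ∘ i = 1`, powers of `i ∘ u ∘ p` are `i ∘ uⁿ ∘ p`. A nilpotent `u` would therefore give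
a nilpotent value of χ, which is zero in a field; Fitting's lemma covers the remaining `u`. -/
theorem bijective_of_character_ne_zero {N : Type*} [AddCommGroup N] [Module R N]
    [IsNoetherian R N] [IsArtinian R N] (hN : Indecomposable R N)
    {i : N →ₗ[R] M} {p : M →ₗ[R] N} (hp : p ∘ₗ i = LinearMap.id) {u : Module.End R N}
    (hu : χ (i ∘ₗ u ∘ₗ p) ≠ 0) : Function.Bijective u := by
  refine hN.bijective_of_not_isNilpotent ?_
  rintro ⟨n, hn⟩
  have h : ∀ n, (i ∘ₗ u ∘ₗ p : Module.End R M) ^ (n + 1) = i ∘ₗ (u ^ (n + 1)) ∘ₗ p := by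
    intro n
    induction n with
    | zero => rw [zero_add, pow_one, pow_one]
    | succ n ih =>
      rw [pow_succ, ih, pow_succ u (n + 1)]
      ext x
      have := fun y => LinearMap.congr_fun hp y
      simp only [LinearMap.comp_apply, LinearMap.id_apply] at this
      simp [this]
  refine hu (pow_eq_zero_iff (n + 1).succ_ne_zero |>.1 ?_ : χ (i ∘ₗ u ∘ₗ p) = 0)
  rw [← map_pow, h, pow_succ', pow_succ', hn]
  simp

/-- The round trips `N → N' → N` and `N' → N → N'` through `M` have as character a product of three
nonzero scalars, so both are bijective. -/
theorem nonempty_equiv_of_character_ne_zero {N N' : Type*} [AddCommGroup N] [Module R N]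
    [IsNoetherian R N] [IsArtinian R N] (hN : Indecomposable R N) [AddCommGroup N'] [Module R N']
    [IsNoetherian R N'] [IsArtinian R N'] (hN' : Indecomposable R N')
    {i : N →ₗ[R] M} {p : M →ₗ[R] N} (hp : p ∘ₗ i = LinearMap.id) (h : χ (i ∘ₗ p) ≠ 0)
    {i' : N' →ₗ[R] M} {p' : M →ₗ[R] N'} (hp' : p' ∘ₗ i' = LinearMap.id) (h' : χ (i' ∘ₗ p') ≠ 0) :
    Nonempty (N ≃ₗ[R] N') := by
  have h1 : Function.Bijective ((p ∘ₗ i') ∘ₗ (p' ∘ₗ i)) := by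
    refine bijective_of_character_ne_zero χ hN hp ?_
    have : i ∘ₗ ((p ∘ₗ i') ∘ₗ (p' ∘ₗ i)) ∘ₗ p = (i ∘ₗ p) * (i' ∘ₗ p') * (i ∘ₗ p) := rfl
    rw [this, map_mul, map_mul]
    exact mul_ne_zero (mul_ne_zero h h') h
  have h2 : Function.Bijective ((p' ∘ₗ i) ∘ₗ (p ∘ₗ i')) := by
    refine bijective_of_character_ne_zero χ hN' hp' ?_
    have : i' ∘ₗ ((p' ∘ₗ i) ∘ₗ (p ∘ₗ i')) ∘ₗ p' = (i' ∘ₗ p') * (i ∘ₗ p) * (i' ∘ₗ p') := rfl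
    rw [this, map_mul, map_mul]
    exact mul_ne_zero (mul_ne_zero h' h) h'
  exact ⟨LinearEquiv.ofBijective (p' ∘ₗ i) ⟨Function.Injective.of_comp (f := ⇑(p ∘ₗ i')) h1.1,
    Function.Surjective.of_comp (g := ⇑(p ∘ₗ i')) h2.2⟩⟩

theorem exists_summand_character_ne_zero [IsArtinian R M] : ∃ N P : Submodule R M,
    Indecomposable R N ∧ ∃ h : IsCompl N P, χ (N.projection P h) ≠ 0 := by
  obtain ⟨k, P, hP, hPi⟩ := exists_isDecomposition R M
  obtain ⟨p, h1, h2, h3⟩ := exists_projections hP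
  obtain ⟨i, hi⟩ : ∃ i, χ ((P i).subtype ∘ₗ p i) ≠ 0 := by
    by_contra! hc
    have := congrArg χ h3
    rw [map_sum, Finset.sum_eq_zero fun i _ => hc i] at this
    exact zero_ne_one (this.trans (map_one χ))
  -- The complement is the kernel of `p i`; `character_comm` identifies the character of the
  -- resulting projection with that of `p i`.
  have hc := LinearMap.isCompl_of_proj (LinearMap.congr_fun (h1 i))
  refine ⟨P i, _, hPi i, hc, ?_⟩
  rwa [show (P i).projection _ hc = (P i).subtype ∘ₗ (P i).projectionOnto _ hc from rfl,
    character_comm χ (Submodule.projectionOnto_comp_subtype hc) (h1 i)]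

/-- The projections sum to 1, so some summand has nonzero character and is isomorphic to `N`. A
second summand isomorphic to `N` would also have nonzero character, yet the product of two
orthogonal projections is zero. -/
theorem occursOnce_of_character_ne_zero [IsNoetherian R M] [IsArtinian R M] {N : Submodule R M}
    (hN : Indecomposable R N) {P : Submodule R M} (hP : IsCompl N P)
    (h : χ (N.projection P hP) ≠ 0) : OccursOnce R N M := by
  refine ⟨exists_isDecomposition R M, fun k Q hQ => ?_⟩
  obtain ⟨p, h1, h2, h3⟩ := exists_projections hQ.1
  have hNp := Submodule.projectionOnto_comp_subtype hP
  obtain ⟨i, hi⟩ : ∃ i, χ ((Q i).subtype ∘ₗ p i) ≠ 0 := by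
    by_contra! hc
    have := congrArg χ h3
    rw [map_sum, Finset.sum_eq_zero fun i _ => hc i] at this
    exact zero_ne_one (this.trans (map_one χ))
  refine ⟨i, nonempty_equiv_of_character_ne_zero χ hN (hQ.2 i) hNp h (h1 i) hi, ?_⟩
  rintro j ⟨e⟩
  by_contra hij
  -- Through `e` the summand `Q j` becomes another embedding of `N` into `M`, so `character_comm`
  -- applies.
  have hj : χ ((Q j).subtype ∘ₗ p j) ≠ 0 := by
    change χ (N.subtype ∘ₗ N.projectionOnto P hP) ≠ 0 at h
    rw [← character_comm χ (i := (Q j).subtype ∘ₗ e.toLinearMap)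
      (p := e.symm.toLinearMap ∘ₗ p j) ?_ hNp] at h
    · convert h using 2
      ext x; simp
    · ext x
      have := LinearMap.congr_fun (h1 j) (e x)
      simp only [LinearMap.comp_apply, LinearMap.id_apply] at this
      simp only [LinearMap.comp_apply, LinearEquiv.coe_coe, this]
      simp
  refine mul_ne_zero hi hj ?_
  rw [← map_mul, show ((Q i).subtype ∘ₗ p i : Module.End R M) * ((Q j).subtype ∘ₗ p j) =
    (Q i).subtype ∘ₗ (p i ∘ₗ (Q j).subtype) ∘ₗ p j from rfl, h2 i j (Ne.symm hij)]
  simp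

end Character

/-! ### The sign character of the hyperoctahedral group -/

section Sign

theorem reflect_ne {A : Type} (v : A × ℤˣ) : reflect v ≠ v := fun h =>
  absurd (congrArg Prod.snd h) (by
    rcases Int.units_eq_one_or v.2 with h | h <;> simp [reflect, h])

theorem eq_or_eq_reflect {A : Type} {v w : A × ℤˣ} (h : w.1 = v.1) : w = v ∨ w = reflect v := by
  by_cases h' : w.2 = v.2
  · exact Or.inl (Prod.ext h h')
  · exact Or.inr (Prod.ext h (eq_neg_of_ne h'))

variable {n : ℕ}

theorem Hyp.apply_reflect (σ : Hyp n) (v : Node n) : σ.1 (reflect v) = reflect (σ.1 v) := σ.2 v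

theorem Hyp.apply_eq (σ : Hyp n) (v : Node n) :
    σ.1 v = ((σ.1 (v.1, 1)).1, (σ.1 (v.1, 1)).2 * v.2) := by
  rcases v with ⟨i, a⟩
  rcases Int.units_eq_one_or a with rfl | rfl
  · simp
  · have : ((i, -1) : Node n) = reflect (i, 1) := rfl
    rw [this, σ.apply_reflect]
    simp [reflect]

/-- Passing to the underlying permutation is multiplicative, and the sign change of `σ * τ` at `i`
is that of `τ` at `i` times that of `σ` at the image of `i`; reindex the second product along `τ`.
-/
theorem Hyp.sgn_mul (σ τ : Hyp n) : (σ * τ).sgn = σ.sgn * τ.sgn := by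
  have hu : (σ * τ).underlying = σ.underlying * τ.underlying := by
    ext i
    change ((σ.1 (τ.1 (i, 1))).1 : ℕ) = ((σ.1 ((τ.1 (i, 1)).1, 1)).1 : ℕ)
    rw [σ.apply_eq (τ.1 (i, 1))]
  have hp : ∏ i, ((σ * τ).1 (i, 1)).2 = (∏ i, (σ.1 (i, 1)).2) * ∏ i, (τ.1 (i, 1)).2 := by
    rw [← Equiv.prod_comp τ.underlying fun i => (σ.1 (i, 1)).2, ← Finset.prod_mul_distrib]
    refine Finset.prod_congr rfl fun i _ => ?_
    change (σ.1 (τ.1 (i, 1))).2 = _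
    rw [σ.apply_eq (τ.1 (i, 1))]
    rfl
  rw [Hyp.sgn, hu, hp, map_mul, Hyp.sgn, Hyp.sgn]
  exact mul_mul_mul_comm _ _ _ _

theorem Hyp.sgn_one : (1 : Hyp n).sgn = 1 := by
  have := Hyp.sgn_mul (1 : Hyp n) 1
  rw [mul_one] at this
  exact left_eq_mul.1 this

/-- The sign change at `v`. -/
def Hyp.flip (v : Node n) : Hyp n := ⟨Equiv.swap v (reflect v), by
  intro w
  rcases eq_or_ne w v with rfl | h1
  · simp [reflect_reflect]
  rcases eq_or_ne w (reflect v) with rfl | h2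
  · simp [reflect_reflect]
  rw [Equiv.swap_apply_of_ne_of_ne h1 h2, Equiv.swap_apply_of_ne_of_ne]
  · rintro rfl
    exact h2 (reflect_reflect w).symm
  · intro h
    exact h1 (by rw [← reflect_reflect w, h, reflect_reflect])⟩

theorem Hyp.flip_sgn (v : Node n) : (Hyp.flip v).sgn = -1 := by
  have h : ∀ i, ((Hyp.flip v).1 (i, 1)) = (i, if i = v.1 then -1 else 1) := by
    intro i
    change Equiv.swap _ _ _ = _
    rcases eq_or_ne i v.1 with rfl | hi
    · rcases eq_or_eq_reflect (v := v) (w := (v.1, 1)) rfl with h | h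
      · rw [h, Equiv.swap_apply_left, ← h]
        simp [reflect]
      · rw [h, Equiv.swap_apply_right]
        have h' : v = reflect (v.1, 1) := by rw [h, reflect_reflect]
        rw [if_pos rfl]
        exact h'
    · rw [Equiv.swap_apply_of_ne_of_ne, if_neg hi]
      · rintro rfl; exact hi rfl
      · intro e; exact hi (congrArg Prod.fst e)
  have hu : (Hyp.flip v).underlying = 1 := by
    ext i
    change (((Hyp.flip v).1 (i, 1)).1 : ℕ) = i
    rw [h]
  rw [Hyp.sgn, hu, map_one, mul_one]
  simp [h]

/-- The signed transposition which exchanges `v` and `w`, and `-v` and `-w`. -/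
def Hyp.swap (v w : Node n) (h : v.1 ≠ w.1) : Hyp n :=
  ⟨Equiv.swap v w * Equiv.swap (reflect v) (reflect w), by
    have h1 : v ≠ reflect v := (reflect_ne v).symm
    have h2 : w ≠ reflect w := (reflect_ne w).symm
    have h3 : v ≠ w := fun e => h (congrArg Prod.fst e)
    have h4 : v ≠ reflect w := fun e => h (by have := congrArg Prod.fst e; exact this)
    have h5 : w ≠ reflect v := fun e => h (congrArg Prod.fst e).symm
    have h6 : reflect v ≠ reflect w := fun e => h (by have := congrArg Prod.fst e; exact this)
    intro x
    by_cases hv : x.1 = v.1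
    · rcases eq_or_eq_reflect hv with rfl | rfl
      · simp [Equiv.swap_apply_of_ne_of_ne, *, Ne.symm]
      · simp [Equiv.swap_apply_of_ne_of_ne, reflect_reflect, *, Ne.symm]
    by_cases hw : x.1 = w.1
    · rcases eq_or_eq_reflect hw with rfl | rfl
      · simp [Equiv.swap_apply_of_ne_of_ne, *, Ne.symm]
      · simp [Equiv.swap_apply_of_ne_of_ne, reflect_reflect, *, Ne.symm]
    · have key : ∀ y : Node n, y.1 ≠ v.1 → y.1 ≠ w.1 →
          (Equiv.swap v w * Equiv.swap (reflect v) (reflect w)) y = y := by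
        intro y hv hw
        rw [Equiv.Perm.mul_apply, Equiv.swap_apply_of_ne_of_ne (a := reflect v),
          Equiv.swap_apply_of_ne_of_ne]
        all_goals rintro rfl
        exacts [hv rfl, hw rfl, hv rfl, hw rfl]
      rw [key x hv hw, key (reflect x) hv hw]⟩

theorem Hyp.swap_apply (v w : Node n) (h : v.1 ≠ w.1) (x : Node n) :
    (Hyp.swap v w h).1 x =
      if x = v then w else if x = w then v else
        if x = reflect v then reflect w else if x = reflect w then reflect v else x := by
  have h1 : v ≠ reflect v := (reflect_ne v).symm
  have h2 : w ≠ reflect w := (reflect_ne w).symm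
  have h3 : v ≠ w := fun e => h (congrArg Prod.fst e)
  have h4 : v ≠ reflect w := fun e => h (by have := congrArg Prod.fst e; exact this)
  have h5 : w ≠ reflect v := fun e => h (congrArg Prod.fst e).symm
  change Equiv.swap v w (Equiv.swap (reflect v) (reflect w) x) = _
  split_ifs with e1 e2 e3 e4
  · subst e1; simp [Equiv.swap_apply_of_ne_of_ne, *]
  · subst e2; simp [Equiv.swap_apply_of_ne_of_ne, *]
  · subst e3; simp [Equiv.swap_apply_of_ne_of_ne, *, Ne.symm]
  · subst e4; simp [Equiv.swap_apply_of_ne_of_ne, *, Ne.symm]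
  · simp [Equiv.swap_apply_of_ne_of_ne, *]

theorem Hyp.swap_sgn (v w : Node n) (h : v.1 ≠ w.1) : (Hyp.swap v w h).sgn = -1 := by
  have key : ∀ i, (Hyp.swap v w h).1 (i, 1) =
      (Equiv.swap v.1 w.1 i, if i = v.1 ∨ i = w.1 then v.2 * w.2 else 1) := by
    intro i
    rw [Hyp.swap_apply]
    rcases v with ⟨v, a⟩
    rcases w with ⟨w, b⟩
    simp only [reflect, Prod.mk.injEq]
    simp only [ne_eq] at h
    rcases eq_or_ne i v with rfl | hv
    · rcases Int.units_eq_one_or a with rfl | rfl <;> simp [h]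
    · rcases eq_or_ne i w with rfl | hw
      · rcases Int.units_eq_one_or b with rfl | rfl <;> simp [hv]
      · simp [hv, hw, Equiv.swap_apply_of_ne_of_ne hv hw]
  have hu : (Hyp.swap v w h).underlying = Equiv.swap v.1 w.1 := by
    ext i
    change (((Hyp.swap v w h).1 (i, 1)).1 : ℕ) = _
    rw [key]
  rw [Hyp.sgn, hu, Equiv.Perm.sign_swap h]
  -- The two moved positions carry the same sign change `v.2 * w.2`, so these cancel and only the
  -- transposition contributes.
  have : ∏ i, ((Hyp.swap v w h).1 (i, 1)).2 = 1 := by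
    simp only [key]
    rw [← Finset.prod_subset (Finset.subset_univ {v.1, w.1})]
    · rw [Finset.prod_pair h]
      simp
    · intro i _ hi
      simp only [Finset.mem_insert, Finset.mem_singleton] at hi
      rw [if_neg hi]
  rw [this, one_mul]

end Sign

/-! ### Tabloids and polytabloids -/

section Polytabloids

variable {n : ℕ} {lam mu : BiPartition n}

theorem rowLabel_reflect {x y : lam.Box × ℤˣ} (h : rowLabel x = rowLabel y) :
    rowLabel (reflect x) = rowLabel (reflect y) := by
  rcases x with ⟨x | x, a⟩ <;> rcases y with ⟨y | y, b⟩ <;> simp_all [rowLabel, reflect]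

theorem colLabel_reflect {x y : lam.Box × ℤˣ} (h : colLabel x = colLabel y) :
    colLabel (reflect x) = colLabel (reflect y) := by
  rcases x with ⟨x | x, a⟩ <;> rcases y with ⟨y | y, b⟩ <;> simp_all [colLabel, reflect]

/-- Each label forgets the sign in only one of the two diagrams, and not in the same one. This is
why row and column group of a tableau meet trivially. -/
theorem eq_of_labels {x y : lam.Box × ℤˣ} (hr : rowLabel x = rowLabel y)
    (hc : colLabel x = colLabel y) : x = y := by
  rcases x with ⟨⟨⟨x1, x2⟩, hx⟩ | ⟨⟨x1, x2⟩, hx⟩, a⟩ <;>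
    rcases y with ⟨⟨⟨y1, y2⟩, hy⟩ | ⟨⟨y1, y2⟩, hy⟩, b⟩ <;>
    simp_all [rowLabel, colLabel]

namespace BiTableau

theorem symm_reflect (t : BiTableau lam) (v : Node n) :
    t.entry.symm (reflect v) = reflect (t.entry.symm v) := by
  rw [Equiv.symm_apply_eq, t.entry_reflect, Equiv.apply_symm_apply]

theorem ext_entry {t s : BiTableau lam} (h : ∀ v, t.entry.symm v = s.entry.symm v) : t = s := by
  rcases t with ⟨t, ht⟩
  rcases s with ⟨s, hs⟩
  have : t.symm = s.symm := Equiv.ext h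
  obtain rfl : t = s := by rw [← t.symm_symm, this, s.symm_symm]
  rfl

/-- The signed permutation which carries `t` to `s`. -/
def diff (t s : BiTableau lam) : Hyp n := ⟨s.entry.symm.trans t.entry, fun v => by
  change t.entry (s.entry.symm (reflect v)) = reflect (t.entry (s.entry.symm v))
  rw [s.symm_reflect, t.entry_reflect]⟩

theorem symm_diff (t s : BiTableau lam) (v : Node n) :
    t.entry.symm ((t.diff s).1 v) = s.entry.symm v := t.entry.symm_apply_apply _

theorem act_diff (t s : BiTableau lam) : t.act (t.diff s) = s :=
  ext_entry fun v => t.symm_diff s v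

theorem flip_mem_labelGroup {A : Type} (t : BiTableau lam) {f : lam.Box × ℤˣ → A} {v : Node n}
    (h : f (t.entry.symm (reflect v)) = f (t.entry.symm v)) : Hyp.flip v ∈ t.labelGroup f := by
  intro w
  change f (t.entry.symm (Equiv.swap _ _ w)) = _
  rw [Equiv.swap_apply_def]
  split_ifs with h1 h2
  · rw [h1, h]
  · rw [h2, h]
  · rfl

theorem swap_mem_labelGroup {A : Type} (t : BiTableau lam) {f : lam.Box × ℤˣ → A}
    (hf : ∀ {x y}, f x = f y → f (reflect x) = f (reflect y)) {v w : Node n} (hvw : v.1 ≠ w.1)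
    (h : f (t.entry.symm v) = f (t.entry.symm w)) : Hyp.swap v w hvw ∈ t.labelGroup f := by
  have h' := hf h
  rw [← t.symm_reflect, ← t.symm_reflect] at h'
  intro x
  rw [Hyp.swap_apply]
  split_ifs with h1 h2 h3 h4
  · rw [h1, h]
  · rw [h2, h]
  · rw [h3, h']
  · rw [h4, h']
  · rfl

end BiTableau

/-- Two tableaux give the same tabloid if and only if all row labels agree. -/
theorem tabloid_eq_iff {t s : BiTableau lam} :
    (Quotient.mk (rowEquiv lam) t : Tabloid lam) = Quotient.mk (rowEquiv lam) s ↔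
      ∀ v, rowLabel (t.entry.symm v) = rowLabel (s.entry.symm v) := by
  constructor
  · intro h v
    obtain ⟨σ, hσ, rfl⟩ := Quotient.exact h
    exact (hσ v).symm
  · intro h
    refine Quotient.sound ⟨t.diff s, fun v => ?_, (t.act_diff s).symm⟩
    rw [t.symm_diff, h]

variable (K : Type*) [Field K]

theorem op_smul_permMod (a : HypAlg K n) (m : PermMod K lam) :
    MulOpposite.op a • m = PermMod.action K lam (MulOpposite.op a) m := rfl

theorem op_single_smul_tabloidOf (σ : Hyp n) (c : K) (t : BiTableau lam) :
    MulOpposite.op (MonoidAlgebra.single σ c) • tabloidOf K t = c • tabloidOf K (t.act σ) := by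
  have h : PermMod.action K lam (MulOpposite.op (MonoidAlgebra.single σ c)) =
      c • PermMod.actLin K σ := by
    simp [PermMod.action, MonoidAlgebra.lift_single]
  rw [op_smul_permMod, h, LinearMap.smul_apply]
  congr 1
  exact Finsupp.mapDomain_single

open Classical in
theorem tabloidOf_smul_colSum (t : BiTableau lam) (s : BiTableau mu) :
    MulOpposite.op (colSum K t) • tabloidOf K s =
      ∑ σ with σ ∈ t.colGroup, ((σ.sgn : ℤ) : K) • tabloidOf K (s.act σ) := by
  rw [colSum, Finset.op_sum, Finset.sum_smul]
  simp only [op_single_smul_tabloidOf]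

open Classical in
theorem polytabloid_eq (t : BiTableau lam) :
    polytabloid K t = ∑ σ with σ ∈ t.colGroup, ((σ.sgn : ℤ) : K) • tabloidOf K (t.act σ) :=
  tabloidOf_smul_colSum K t t

/-- A column permutation of sign `-1` that fixes a tabloid annihilates its column sum. -/
theorem smul_colSum_eq_zero {t : BiTableau lam} {s : BiTableau mu} {τ : Hyp n}
    (hc : τ ∈ t.colGroup) (hr : τ ∈ s.rowGroup) (hτ : τ.sgn = -1) (h2 : τ * τ = 1) :
    MulOpposite.op (colSum K t) • tabloidOf K s = 0 := by
  classical
  rw [tabloidOf_smul_colSum]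
  have hs : ∀ σ, tabloidOf K (s.act (τ * σ)) = tabloidOf K (s.act σ) := by
    intro σ
    have : (Quotient.mk (rowEquiv mu) (s.act (τ * σ)) : Tabloid mu) =
        Quotient.mk (rowEquiv mu) (s.act σ) := tabloid_eq_iff.2 fun v => hr (σ.1 v)
    rw [tabloidOf, tabloidOf, this]
  -- Pair `σ` with `τ * σ`. The pairing has no fixed point because `sgn` takes values in `ℤˣ`, where
  -- `-1 ≠ 1`; hence characteristic 2 is no exception.
  refine Finset.sum_involution (fun σ _ => τ * σ) ?_ ?_ ?_ ?_
  · intro σ _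
    rw [hs, Hyp.sgn_mul, hτ, ← add_smul]
    simp
  · intro σ _ _ h
    rw [mul_eq_right.1 h, Hyp.sgn_one] at hτ
    exact absurd hτ (by decide)
  · intro σ hσ
    simp only [Finset.mem_filter, Finset.mem_univ, true_and] at hσ ⊢
    exact mul_mem hc hσ
  · intro σ _
    rw [← mul_assoc, h2, one_mul]

/-- If `w = -v`, the sign change at `v` is a column permutation of `t` that fixes the tabloid of
`s`; otherwise the signed transposition of `v` and `w` is. Both are involutions of sign -1. -/
theorem smul_colSum_eq_zero_of_labels {t : BiTableau lam} {s : BiTableau mu} {v w : Node n}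
    (hvw : v ≠ w) (hr : rowLabel (s.entry.symm v) = rowLabel (s.entry.symm w))
    (hc : colLabel (t.entry.symm v) = colLabel (t.entry.symm w)) :
    MulOpposite.op (colSum K t) • tabloidOf K s = 0 := by
  by_cases h : v.1 = w.1
  · obtain rfl : w = reflect v := (eq_or_eq_reflect h.symm).resolve_left hvw.symm
    refine smul_colSum_eq_zero K (t.flip_mem_labelGroup hc.symm) (s.flip_mem_labelGroup hr.symm)
      (Hyp.flip_sgn v) (Subtype.ext ?_)
    exact Equiv.swap_mul_self _ _
  · refine smul_colSum_eq_zero K (t.swap_mem_labelGroup (fun e => colLabel_reflect e) h hc)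
      (s.swap_mem_labelGroup (fun e => rowLabel_reflect e) h hr) (Hyp.swap_sgn v w h) (Subtype.ext ?_)
    ext1 x
    change (Hyp.swap v w h).1 ((Hyp.swap v w h).1 x) = x
    have h1 : v ≠ reflect v := (reflect_ne v).symm
    have h2 : w ≠ reflect w := (reflect_ne w).symm
    have h4 : v ≠ reflect w := fun e => h (by have := congrArg Prod.fst e; exact this)
    have h5 : w ≠ reflect v := fun e => h (congrArg Prod.fst e).symm
    rw [Hyp.swap_apply v w h x]
    split_ifs with e1 e2 e3 e4
    · simp [Hyp.swap_apply, e1, hvw.symm]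
    · simp [Hyp.swap_apply, e2]
    · simp [Hyp.swap_apply, e3, h4.symm, h2.symm]
    · simp [Hyp.swap_apply, e4, h1.symm, h5.symm]
    · simp [Hyp.swap_apply, *]

/-- Acting by `σ` conjugates the column group, and `sgn` is invariant under conjugation. -/
theorem op_single_smul_polytabloid (t : BiTableau lam) (σ : Hyp n) :
    MulOpposite.op (MonoidAlgebra.single σ (1 : K)) • polytabloid K t =
      polytabloid K (t.act σ) := by
  classical
  rw [polytabloid_eq, polytabloid_eq, Finset.smul_sum]
  refine Finset.sum_bij' (fun τ _ => σ⁻¹ * τ * σ) (fun τ _ => σ * τ * σ⁻¹) ?_ ?_ ?_ ?_ ?_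
  · intro τ hτ
    simp only [Finset.mem_filter, Finset.mem_univ, true_and] at hτ ⊢
    intro v
    have := hτ (σ.1 v)
    have e : (σ.1 ((σ⁻¹ * τ * σ).1 v)) = τ.1 (σ.1 v) := by
      change (σ * (σ⁻¹ * τ * σ)).1 v = (τ * σ).1 v
      congr 2
      group
    change colLabel (t.entry.symm (σ.1 ((σ⁻¹ * τ * σ).1 v))) = colLabel (t.entry.symm (σ.1 v))
    rw [e, this]
  · intro τ hτ
    simp only [Finset.mem_filter, Finset.mem_univ, true_and] at hτ ⊢
    intro v
    have := hτ (σ⁻¹.1 v)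
    have e : σ.1 (σ⁻¹.1 v) = v := Equiv.apply_symm_apply _ _
    change colLabel (t.entry.symm (σ.1 (τ.1 (σ⁻¹.1 v)))) =
      colLabel (t.entry.symm (σ.1 (σ⁻¹.1 v))) at this
    rw [e] at this
    exact this
  · intro τ _; group
  · intro τ _; group
  · intro τ _
    have hs : (σ⁻¹ * τ * σ).sgn = τ.sgn := by
      rw [Hyp.sgn_mul, mul_comm, ← Hyp.sgn_mul]
      congr 1
      group
    rw [hs, smul_comm, op_single_smul_tabloidOf, one_smul, ← BiTableau.act_mul,
      ← BiTableau.act_mul]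
    congr 3
    group

/-- W_n is transitive on tableaux, so a single polytabloid generates the Specht module. -/
theorem specht_le {t : BiTableau lam} {Y : Submodule (HypAlg K n)ᵐᵒᵖ (PermMod K lam)}
    (h : polytabloid K t ∈ Y) : specht K lam ≤ Y := by
  refine Submodule.span_le.2 ?_
  rintro _ ⟨s, rfl⟩
  rw [← t.act_diff s, ← op_single_smul_polytabloid]
  exact Y.smul_mem _ h

/-- The coefficient of `{t}` in an element of the permutation module. -/
def coeff (t : BiTableau lam) : PermMod K lam →ₗ[K] K :=
  Finsupp.lapply (Quotient.mk (rowEquiv lam) t : Tabloid lam)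

theorem coeff_tabloidOf_self (t : BiTableau lam) : coeff K t (tabloidOf K t) = 1 :=
  Finsupp.single_eq_same

theorem coeff_tabloidOf_of_ne {t s : BiTableau lam}
    (h : (Quotient.mk (rowEquiv lam) s : Tabloid lam) ≠ Quotient.mk _ t) :
    coeff K t (tabloidOf K s) = 0 :=
  Finsupp.single_eq_of_ne' h

/-- By `eq_of_labels` only the identity is both a row and a column permutation, so {t} appears in
the sum once. -/
theorem coeff_polytabloid (t : BiTableau lam) : coeff K t (polytabloid K t) = 1 := by
  classical
  have h : ∀ σ ∈ t.colGroup, σ ≠ 1 →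
      (Quotient.mk (rowEquiv lam) (t.act σ) : Tabloid lam) ≠ Quotient.mk _ t := by
    intro σ hσ h1 e
    refine h1 (Subtype.ext (Equiv.ext fun v => t.entry.symm.injective ?_))
    exact eq_of_labels (tabloid_eq_iff.1 e v) (hσ v)
  rw [polytabloid_eq, map_sum, Finset.sum_eq_single 1]
  · rw [map_smul, BiTableau.act_one, coeff_tabloidOf_self, Hyp.sgn_one]
    simp
  · intro σ hσ h1
    rw [map_smul, coeff_tabloidOf_of_ne K (h σ (by simpa using hσ) h1), smul_zero]
  · intro h1
    exact absurd (by simp [one_mem]) h1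

theorem polytabloid_ne_zero (t : BiTableau lam) : polytabloid K t ≠ 0 := fun h => by
  have := coeff_polytabloid K t
  rw [h, map_zero] at this
  exact zero_ne_one this

/-- Column permutations change the polytabloid by their sign. -/
theorem smul_colSum_act {t : BiTableau lam} {σ : Hyp n} (hσ : σ ∈ t.colGroup) :
    MulOpposite.op (colSum K t) • tabloidOf K (t.act σ) =
      ((σ.sgn : ℤ) : K) • polytabloid K t := by
  classical
  rw [tabloidOf_smul_colSum, polytabloid_eq, Finset.smul_sum]
  refine Finset.sum_bij' (fun τ _ => σ * τ) (fun τ _ => σ⁻¹ * τ) ?_ ?_ ?_ ?_ ?_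
  · intro τ hτ
    simp only [Finset.mem_filter, Finset.mem_univ, true_and] at hτ ⊢
    exact mul_mem hσ hτ
  · intro τ hτ
    simp only [Finset.mem_filter, Finset.mem_univ, true_and] at hτ ⊢
    exact mul_mem (inv_mem hσ) hτ
  · intro τ _; group
  · intro τ _; group
  · intro τ _
    rw [BiTableau.act_mul, smul_smul, Hyp.sgn_mul, ← Int.cast_mul, ← Units.val_mul, ← mul_assoc,
      Int.units_mul_self, one_mul]

theorem permMod_induction {P : PermMod K lam → Prop} (m : PermMod K lam) (h0 : P 0)
    (hadd : ∀ x y, P x → P y → P (x + y)) (hs : ∀ (c : K) t, P (c • tabloidOf K t)) : P m := by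
  refine Finsupp.induction_linear (motive := P) m h0 hadd fun T c => ?_
  induction T using Quotient.inductionOn with
  | h t =>
    have := hs c t
    rw [tabloidOf] at this
    erw [Finsupp.smul_single, smul_eq_mul, mul_one] at this
    exact this

theorem op_smul_comm (a : HypAlg K n) (c : K) (m : PermMod K lam) :
    MulOpposite.op a • c • m = c • MulOpposite.op a • m := by
  rw [op_smul_permMod, op_smul_permMod, map_smul]

end Polytabloids

/-! ### Counting entries by rows and columns -/

section Counting

theorem card_cells_lt (D : YoungDiagram) (j : ℕ) :
    (D.cells.filter fun x => x.1 < j).card = ∑ i ∈ Finset.range j, D.rowLen i := by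
  rw [Finset.card_eq_sum_card_fiberwise (f := Prod.fst) (t := Finset.range j)]
  · refine Finset.sum_congr rfl fun i hi => ?_
    rw [YoungDiagram.rowLen_eq_card, YoungDiagram.row, Finset.filter_filter]
    congr 1
    refine Finset.filter_congr fun x _ => ?_
    rw [Finset.mem_range] at hi
    exact ⟨fun h => h.2, fun h => ⟨h ▸ hi, h⟩⟩
  · intro x hx
    simp only [Finset.coe_filter, Set.mem_ofPred_eq] at hx
    simpa using hx.2

theorem card_cells_col_lt (D : YoungDiagram) (c j : ℕ) :
    ((D.cells.filter fun x => x.1 < j).filter fun x => x.2 = c).card = min j (D.colLen c) := by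
  have : ((D.cells.filter fun x => x.1 < j).filter fun x => x.2 = c) =
      (Finset.range (min j (D.colLen c))).image fun i => (i, c) := by
    ext ⟨a, b⟩
    simp only [Finset.mem_filter, YoungDiagram.mem_cells, Finset.mem_image, Finset.mem_range,
      lt_min_iff, Prod.mk.injEq]
    constructor
    · rintro ⟨⟨h1, h2⟩, rfl⟩
      exact ⟨a, ⟨h2, YoungDiagram.mem_iff_lt_colLen.1 h1⟩, rfl, rfl⟩
    · rintro ⟨i, ⟨h1, h2⟩, rfl, rfl⟩
      exact ⟨⟨YoungDiagram.mem_iff_lt_colLen.2 h2, h1⟩, rfl⟩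
  rw [this, Finset.card_image_of_injective _ (fun a b h => (Prod.mk.inj h).1), Finset.card_range]

variable {V : Type*} {S : Finset V} {row col : V → ℕ} {D : YoungDiagram}

/-- The factors 2 are there because signed entries are counted: a box accounts for both `v` and
`-v`. The two bounds under the minimum come from the `j` positions and from the whole column. -/
theorem card_row_lt_col_le (h2 : ∀ i c, (S.filter fun v => row v = i ∧ col v = c).card ≤ 2)
    (hc : ∀ c, (S.filter fun v => col v = c).card ≤ 2 * D.colLen c) (j c : ℕ) :
    ((S.filter fun v => row v < j).filter fun v => col v = c).card ≤ 2 * min j (D.colLen c) := by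
  have h1 : ((S.filter fun v => row v < j).filter fun v => col v = c).card ≤ 2 * D.colLen c := by
    refine (Finset.card_le_card ?_).trans (hc c)
    intro v hv
    simp only [Finset.mem_filter] at hv ⊢
    exact ⟨hv.1.1, hv.2⟩
  have h3 : ((S.filter fun v => row v < j).filter fun v => col v = c).card ≤ j * 2 := by
    rw [Finset.card_eq_sum_card_fiberwise (f := row) (t := Finset.range j)]
    · refine (Finset.sum_le_card_nsmul _ _ 2 fun i _ => ?_).trans (by simp)
      refine (Finset.card_le_card ?_).trans (h2 i c)
      intro v hv
      simp only [Finset.mem_filter] at hv ⊢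
      exact ⟨hv.1.1.1, hv.2, hv.1.2⟩
    · intro v hv
      simp only [Finset.coe_filter, Finset.mem_filter, Set.mem_ofPred_eq] at hv
      simpa using hv.1.2
  omega

theorem exists_col_bound (S : Finset V) (col : V → ℕ) (D : YoungDiagram) :
    ∃ C, (∀ v ∈ S, col v < C) ∧ ∀ x ∈ D.cells, x.2 < C := by
  refine ⟨S.sup col + D.cells.sup Prod.snd + 1, fun v hv => ?_, fun x hx => ?_⟩
  · have := Finset.le_sup (f := col) hv
    omega
  · have := Finset.le_sup (f := Prod.snd) hx
    omega

theorem card_filter_eq_sum_col {C : ℕ} (h : ∀ v ∈ S, col v < C) (p : V → Prop) [DecidablePred p] :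
    (S.filter p).card =
      ∑ c ∈ Finset.range C, ((S.filter p).filter fun v => col v = c).card := by
  refine Finset.card_eq_sum_card_fiberwise fun v hv => ?_
  simpa using h v (Finset.mem_filter.1 hv).1

/-- If no position carries more than two elements and no column more than twice the length of
that column in `D`, then the first `j` rows hold at most twice as many elements as in `D`. -/
theorem card_row_lt_le (h2 : ∀ i c, (S.filter fun v => row v = i ∧ col v = c).card ≤ 2)
    (hc : ∀ c, (S.filter fun v => col v = c).card ≤ 2 * D.colLen c) (j : ℕ) :
    (S.filter fun v => row v < j).card ≤ 2 * ∑ i ∈ Finset.range j, D.rowLen i := by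
  obtain ⟨C, hC1, hC2⟩ := exists_col_bound S col D
  rw [← card_cells_lt, card_filter_eq_sum_col hC1, card_filter_eq_sum_col hC2, Finset.mul_sum]
  refine Finset.sum_le_sum fun c _ => ?_
  rw [card_cells_col_lt]
  exact card_row_lt_col_le h2 hc j c

/-- The case of equality in `card_row_lt_le`. Take `j` to be the length of the column of `v` in `D`:
a deficit in that column would make the total over all columns too small, so the first `j` rows
already contain every element of the column, `v` included. -/
theorem mem_of_card_row_lt_eq (h2 : ∀ i c, (S.filter fun v => row v = i ∧ col v = c).card ≤ 2)
    (hc : ∀ c, (S.filter fun v => col v = c).card ≤ 2 * D.colLen c)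
    (hr : ∀ j, 2 * ∑ i ∈ Finset.range j, D.rowLen i ≤ (S.filter fun v => row v < j).card)
    {v : V} (hv : v ∈ S) : (row v, col v) ∈ D := by
  obtain ⟨C, hC1, hC2⟩ := exists_col_bound S col D
  set j := D.colLen (col v) with hj
  have h := hr j
  rw [← card_cells_lt, card_filter_eq_sum_col hC1, card_filter_eq_sum_col hC2, Finset.mul_sum] at h
  simp only [card_cells_col_lt] at h
  have h' : 2 * j ≤ ((S.filter fun w => row w < j).filter fun w => col w = col v).card := by
    by_contra hlt
    refine absurd h (not_le.2 ?_)
    refine Finset.sum_lt_sum (fun c _ => card_row_lt_col_le h2 hc j c)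
      ⟨col v, Finset.mem_range.2 (hC1 v hv), ?_⟩
    rw [← hj, min_self]
    omega
  have hs : ((S.filter fun w => row w < j).filter fun w => col w = col v) =
      S.filter fun w => col w = col v := by
    refine Finset.eq_of_subset_of_card_le ?_ ((hc _).trans h')
    intro w hw
    simp only [Finset.mem_filter] at hw ⊢
    exact ⟨hw.1.1, hw.2⟩
  have : v ∈ S.filter fun w => col w = col v := by simp [hv]
  rw [← hs] at this
  simp only [Finset.mem_filter] at this
  exact YoungDiagram.mem_iff_lt_colLen.2 this.1.2

end Counting

/-! ### Transverse tableaux and the dominance order -/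

section Dominance

variable {n : ℕ} {lam mu : BiPartition n}

/-- The row of a box in its diagram. -/
def boxRow : lam.Box → ℕ := Sum.elim (fun c => c.1.1) fun c => c.1.1

/-- The column of a box in its diagram. -/
def boxCol : lam.Box → ℕ := Sum.elim (fun c => c.1.2) fun c => c.1.2

/-- The entries of a tableau whose boxes satisfy given conditions. -/
theorem card_entries (t : BiTableau lam) (p q : ℕ × ℕ → Prop) [DecidablePred p] [DecidablePred q]
    (P : Node n → Prop) [DecidablePred P]
    (hP : ∀ v, P v ↔ Sum.elim (fun c => p c.1) (fun c => q c.1) (t.entry.symm v).1) :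
    (Finset.univ.filter P).card =
      2 * ((lam.fst.cells.filter p).card + (lam.snd.cells.filter q).card) := by
  classical
  have h1 : (Finset.univ.filter P).card =
      (Finset.univ.filter fun x : lam.Box × ℤˣ =>
        Sum.elim (fun c => p c.1) (fun c => q c.1) x.1).card := by
    refine Finset.card_equiv t.entry.symm fun v => ?_
    simp [hP]
  have h2 : (Finset.univ.filter fun x : lam.Box × ℤˣ =>
        Sum.elim (fun c => p c.1) (fun c => q c.1) x.1) =
      (Finset.univ.filter fun b : lam.Box => Sum.elim (fun c => p c.1) (fun c => q c.1) b) ×ˢ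
        Finset.univ := by
    ext x; simp [-Finset.univ_product_univ, Finset.mem_product]
    exact fun _ => Int.units_eq_one_or _
  have h3 : ∀ (D : YoungDiagram) (p : ℕ × ℕ → Prop) [DecidablePred p],
      (Finset.univ.filter fun c : D.cells => p c.1).card = (D.cells.filter p).card := by
    intro D p _
    rw [← Finset.card_map (Function.Embedding.subtype _)]
    congr 1
    ext x
    simp
    tauto
  rw [h1, h2, Finset.card_product, Finset.card_filter, Fintype.sum_sum_type,
    ← Finset.card_filter, ← Finset.card_filter]
  refine (mul_comm _ _).trans (congrArg₂ _ rfl (congrArg₂ _ ?_ ?_))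
  · convert h3 lam.fst p
    exact Iff.rfl
  · convert h3 lam.snd q
    exact Iff.rfl

/-- Every two entries in the same row of `s` are in different columns of `t`. Here rows and columns
are taken together with the signs that the row and column groups preserve. -/
def Transverse (t : BiTableau lam) (s : BiTableau mu) : Prop :=
  ∀ v w, rowLabel (s.entry.symm v) = rowLabel (s.entry.symm w) →
    colLabel (t.entry.symm v) = colLabel (t.entry.symm w) → v = w

namespace Transverse

variable {t : BiTableau lam} {s : BiTableau mu}

/-- Otherwise `v` and `-v` would share both labels: row labels ignore signs in the second diagram,
column labels in the first. -/
theorem isRight (h : Transverse t s) {v : Node n} (hv : (s.entry.symm v).1.isRight) :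
    (t.entry.symm v).1.isRight := by
  by_contra hc
  refine reflect_ne v (h _ _ ?_ ?_)
  · rw [s.symm_reflect]
    rcases hx : s.entry.symm v with ⟨x | x, a⟩
    · simp [hx] at hv
    · rfl
  · rw [t.symm_reflect]
    rcases hx : t.entry.symm v with ⟨x | x, a⟩
    · rfl
    · simp [hx] at hc

theorem isLeft (h : Transverse t s) {v : Node n} (hv : (t.entry.symm v).1.isLeft) :
    (s.entry.symm v).1.isLeft := by
  by_contra hc
  have := h.isRight (v := v) (by simpa using hc)
  rw [← Sum.not_isRight] at hv
  simp [this] at hv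

/-- These entries lie in the first diagram for both `t` and `s`. Given row and column,
transversality leaves at most one entry for each sign of its box in `s`. -/
theorem card_left_le_two (h : Transverse t s) (i c : ℕ) :
    ((Finset.univ.filter fun v => (t.entry.symm v).1.isLeft).filter fun v =>
      boxRow (s.entry.symm v).1 = i ∧ boxCol (t.entry.symm v).1 = c).card ≤ 2 := by
  refine (Finset.card_le_card_of_injOn (fun v => (s.entry.symm v).2)
    (t := Finset.univ) (fun _ _ => Finset.mem_coe.2 (Finset.mem_univ _)) ?_).trans (by decide)
  intro v hv w hw hvw
  simp only [Finset.coe_filter, Finset.mem_filter, Finset.mem_univ, true_and,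
    Set.mem_ofPred_eq] at hv hw
  have hv' := h.isLeft hv.1
  have hw' := h.isLeft hw.1
  obtain ⟨hv1, hv2, hv3⟩ := hv
  obtain ⟨hw1, hw2, hw3⟩ := hw
  have key : ∀ (x y : mu.Box × ℤˣ) (x' y' : lam.Box × ℤˣ), x.1.isLeft → y.1.isLeft →
      x'.1.isLeft → y'.1.isLeft → x.2 = y.2 → boxRow x.1 = boxRow y.1 →
      boxCol x'.1 = boxCol y'.1 → rowLabel x = rowLabel y ∧ colLabel x' = colLabel y' := by
    rintro ⟨x | x, a⟩ ⟨y | y, b⟩ ⟨x' | x', a'⟩ ⟨y' | y', b'⟩ <;>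
      simp +contextual [boxRow, boxCol, rowLabel, colLabel]
  obtain ⟨k1, k2⟩ := key _ _ _ _ hv' hw' hv1 hw1 hvw (hv2.trans hw2.symm) (hv3.trans hw3.symm)
  exact h v w k1 k2

/-- As on the left, but here the column labels retain the sign, so entries are separated by their
sign in `t`. -/
theorem card_right_le_two (h : Transverse t s) (i c : ℕ) :
    ((Finset.univ.filter fun v => (s.entry.symm v).1.isRight).filter fun v =>
      boxRow (s.entry.symm v).1 = i ∧ boxCol (t.entry.symm v).1 = c).card ≤ 2 := by
  refine (Finset.card_le_card_of_injOn (fun v => (t.entry.symm v).2)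
    (t := Finset.univ) (fun _ _ => Finset.mem_coe.2 (Finset.mem_univ _)) ?_).trans (by decide)
  intro v hv w hw hvw
  simp only [Finset.coe_filter, Finset.mem_filter, Finset.mem_univ, true_and,
    Set.mem_ofPred_eq] at hv hw
  have hv' := h.isRight hv.1
  have hw' := h.isRight hw.1
  obtain ⟨hv1, hv2, hv3⟩ := hv
  obtain ⟨hw1, hw2, hw3⟩ := hw
  have key : ∀ (x y : mu.Box × ℤˣ) (x' y' : lam.Box × ℤˣ), x.1.isRight → y.1.isRight →
      x'.1.isRight → y'.1.isRight → x'.2 = y'.2 → boxRow x.1 = boxRow y.1 →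
      boxCol x'.1 = boxCol y'.1 → rowLabel x = rowLabel y ∧ colLabel x' = colLabel y' := by
    rintro ⟨x | x, a⟩ ⟨y | y, b⟩ ⟨x' | x', a'⟩ ⟨y' | y', b'⟩ <;>
      simp +contextual [boxRow, boxCol, rowLabel, colLabel]
  obtain ⟨k1, k2⟩ := key _ _ _ _ hv1 hw1 hv' hw' hvw (hv2.trans hw2.symm) (hv3.trans hw3.symm)
  exact h v w k1 k2

theorem card_left_col_le (t : BiTableau lam) (c : ℕ) :
    ((Finset.univ.filter fun v => (t.entry.symm v).1.isLeft).filter fun v =>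
      boxCol (t.entry.symm v).1 = c).card ≤ 2 * lam.fst.colLen c := by
  rw [Finset.filter_filter, card_entries t (fun x => x.2 = c) (fun _ => False),
    YoungDiagram.colLen_eq_card]
  · simp [YoungDiagram.col]
  · intro v
    rcases (t.entry.symm v).1 with x | x <;> simp [boxCol]

theorem card_right_col_le (h : Transverse t s) (c : ℕ) :
    ((Finset.univ.filter fun v => (s.entry.symm v).1.isRight).filter fun v =>
      boxCol (t.entry.symm v).1 = c).card ≤ 2 * lam.snd.colLen c := by
  refine (Finset.card_le_card (t := Finset.univ.filter fun v =>
    (t.entry.symm v).1.isRight ∧ boxCol (t.entry.symm v).1 = c) ?_).trans ?_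
  · intro v hv
    simp only [Finset.mem_filter, Finset.mem_univ, true_and] at hv ⊢
    exact ⟨h.isRight hv.1, hv.2⟩
  rw [card_entries t (fun _ => False) (fun x => x.2 = c), YoungDiagram.colLen_eq_card]
  · simp [YoungDiagram.col]
  · intro v
    rcases (t.entry.symm v).1 with x | x <;> simp [boxCol]

theorem card_right_row_lt (s : BiTableau mu) (j : ℕ) :
    ((Finset.univ.filter fun v => (s.entry.symm v).1.isRight).filter fun v =>
      boxRow (s.entry.symm v).1 < j).card = 2 * ∑ i ∈ Finset.range j, mu.snd.rowLen i := by
  rw [Finset.filter_filter, card_entries s (fun _ => False) (fun x => x.1 < j),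
    card_cells_lt]
  · simp
  · intro v
    rcases (s.entry.symm v).1 with x | x <;> simp [boxRow]

theorem card_left_row_lt (s : BiTableau mu) (j : ℕ) :
    ((Finset.univ.filter fun v => (s.entry.symm v).1.isLeft).filter fun v =>
      boxRow (s.entry.symm v).1 < j).card = 2 * ∑ i ∈ Finset.range j, mu.fst.rowLen i := by
  rw [Finset.filter_filter, card_entries s (fun x => x.1 < j) (fun _ => False),
    card_cells_lt]
  · simp
  · intro v
    rcases (s.entry.symm v).1 with x | x <;> simp [boxRow]

theorem card_right (s : BiTableau mu) :
    (Finset.univ.filter fun v => (s.entry.symm v).1.isRight).card = 2 * mu.snd.card := by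
  rw [card_entries s (fun _ => False) (fun _ => True)]
  · simp
  · intro v
    rcases (s.entry.symm v).1 with x | x <;> simp

/-- For the first inequality, entries in the second diagram of `s` lie in the second diagram of `t`,
and `card_row_lt_le` bounds them. For the second, an entry counted for `mu` either lies in the
second diagram of `t`, which has `lam.snd.card` boxes, or lies in the first diagram of both, in one
of the first `j` rows of `s`. -/
theorem dominates (h : Transverse t s) : lam.Dominates mu := by
  constructor
  · intro j
    have := card_row_lt_le h.card_right_le_two h.card_right_col_le j
    rw [card_right_row_lt] at this
    omega
  · intro j
    have h1 := card_row_lt_le h.card_left_le_two (card_left_col_le t) j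
    have h2 : 2 * (mu.snd.card + ∑ i ∈ Finset.range j, mu.fst.rowLen i) ≤
        ((Finset.univ.filter fun v => (t.entry.symm v).1.isLeft).filter fun v =>
          boxRow (s.entry.symm v).1 < j).card +
        (Finset.univ.filter fun v => (t.entry.symm v).1.isRight).card := by
      rw [mul_add, ← card_left_row_lt s, ← card_right s,
        ← Finset.card_union_of_disjoint]
      · refine (Finset.card_le_card ?_).trans (Finset.card_union_le _ _)
        intro v hv
        simp only [Finset.mem_union, Finset.mem_filter, Finset.mem_univ, true_and] at hv ⊢
        rcases ht : (t.entry.symm v).1.isRight with _ | _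
        · left
          rw [← Bool.not_eq_true, Sum.not_isRight] at ht
          refine ⟨ht, ?_⟩
          rcases hv with hv | hv
          · have := h.isRight hv
            rw [← Sum.not_isRight] at ht
            exact absurd this ht
          · exact hv.2
        · exact Or.inr rfl
      · rw [Finset.disjoint_left]
        intro v hv hv'
        simp only [Finset.mem_filter, Finset.mem_univ, true_and] at hv hv'
        rw [← Sum.not_isLeft] at hv
        exact hv hv'.1
    rw [card_right] at h2
    omega

end Transverse

/-- Transverse tableaux of the same shape: a column permutation makes the rows agree. -/
theorem Transverse.exists_colGroup {t s : BiTableau lam} (h : Transverse t s) :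
    ∃ σ ∈ t.colGroup, (Quotient.mk (rowEquiv lam) s : Tabloid lam) = Quotient.mk _ (t.act σ) := by
  -- Equal shapes turn the inclusion of second diagrams into an equality.
  have hS : (Finset.univ.filter fun v => (s.entry.symm v).1.isRight) =
      Finset.univ.filter fun v => (t.entry.symm v).1.isRight := by
    refine Finset.eq_of_subset_of_card_le ?_ (by rw [card_right, card_right])
    intro v hv
    simp only [Finset.mem_filter, Finset.mem_univ, true_and] at hv ⊢
    exact h.isRight hv
  have hR : ∀ v, (s.entry.symm v).1.isRight ↔ (t.entry.symm v).1.isRight := fun v => by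
    simpa using Finset.ext_iff.1 hS v
  have hL : ∀ v, (s.entry.symm v).1.isLeft ↔ (t.entry.symm v).1.isLeft := fun v => by
    rw [← Sum.not_isRight, ← Sum.not_isRight, hR]
  -- By the equality case of the counting, the position with the row of `v` in `s` and the column of
  -- `v` in `t` is a box of `lam`. Its sign is taken from `s` in the first diagram and from `t` in
  -- the second, as the labels require.
  have hx : ∀ v, ∃ x : lam.Box × ℤˣ, rowLabel x = rowLabel (s.entry.symm v) ∧
      colLabel x = colLabel (t.entry.symm v) := by
    intro v
    have hl := mem_of_card_row_lt_eq h.card_left_le_two (card_left_col_le t)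
      (fun j => by rw [← card_left_row_lt s]; simp only [hL]; exact le_rfl) (v := v)
    have hr := mem_of_card_row_lt_eq h.card_right_le_two h.card_right_col_le
      (fun j => by rw [← card_right_row_lt s]) (v := v)
    have hRv := hR v
    simp only [Finset.mem_filter, Finset.mem_univ, true_and] at hl hr
    rcases hs : s.entry.symm v with ⟨x | x, a⟩ <;> rcases ht : t.entry.symm v with ⟨y | y, b⟩
    · simp only [hs, ht, boxRow, boxCol] at hl
      exact ⟨(.inl ⟨(x.1.1, y.1.2), hl rfl⟩, a), rfl, rfl⟩
    · simp [hs, ht] at hRv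
    · simp [hs, ht] at hRv
    · simp only [hs, ht, boxRow, boxCol] at hr
      exact ⟨(.inr ⟨(x.1.1, y.1.2), hr rfl⟩, b), rfl, rfl⟩
  choose f hf1 hf2 using hx
  have hinj : Function.Injective f := fun v w e =>
    h v w (by rw [← hf1, ← hf1, e]) (by rw [← hf2, ← hf2, e])
  have hbij : Function.Bijective f :=
    hinj.bijective_of_nat_card_le (Nat.card_congr t.entry).le
  have hrefl : ∀ v, f (reflect v) = reflect (f v) := fun v => by
    refine eq_of_labels ?_ ?_
    · rw [hf1, s.symm_reflect]
      exact (rowLabel_reflect (hf1 v)).symm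
    · rw [hf2, t.symm_reflect]
      exact (colLabel_reflect (hf2 v)).symm
  -- A tableau with the rows of `s` and the columns of `t`; the permutation from `t` to `u` is the
  -- required one.
  let u : BiTableau lam :=
    { entry := (Equiv.ofBijective f hbij).symm
      entry_reflect := fun x => by
        rw [Equiv.symm_apply_eq]
        refine Eq.symm ((hrefl _).trans ?_)
        exact congrArg reflect ((Equiv.ofBijective f hbij).apply_symm_apply x) }
  have hu : ∀ v, u.entry.symm v = f v := fun v => rfl
  refine ⟨t.diff u, fun v => ?_, ?_⟩
  · rw [t.symm_diff, hu, hf2]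
  · rw [t.act_diff, tabloid_eq_iff]
    intro v
    rw [hu, hf1]

theorem BiPartition.Dominates.antisymm (h : lam.Dominates mu) (h' : mu.Dominates lam) :
    lam = mu := by
  have key : ∀ D E : YoungDiagram, (∀ j, ∑ i ∈ Finset.range j, D.rowLen i =
      ∑ i ∈ Finset.range j, E.rowLen i) → D = E := by
    intro D E hDE
    have : ∀ i, D.rowLen i = E.rowLen i := by
      intro i
      have h1 := hDE i
      have h2 := hDE (i + 1)
      rw [Finset.sum_range_succ, Finset.sum_range_succ] at h2
      omega
    ext ⟨i, j⟩
    rw [YoungDiagram.mem_cells, YoungDiagram.mem_cells, YoungDiagram.mem_iff_lt_rowLen,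
      YoungDiagram.mem_iff_lt_rowLen, this]
  have h2 := key _ _ fun j => le_antisymm (h'.1 j) (h.1 j)
  refine BiPartition.ext (key _ _ fun j => ?_) h2
  have a := h.2 j
  have b := h'.2 j
  rw [h2] at a b
  omega

theorem nonempty_biTableau (lam : BiPartition n) : Nonempty (BiTableau lam) := by
  have : Fintype.card lam.Box = n := by
    simpa using lam.card_add
  let e := Fintype.equivFinOfCardEq this
  exact ⟨⟨Equiv.prodCongr e (Equiv.refl _), fun x => rfl⟩⟩

variable (K : Type*) [Field K]

theorem transverse_of_smul_colSum_ne_zero {t : BiTableau lam} {s : BiTableau mu}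
    (h : MulOpposite.op (colSum K t) • tabloidOf K s ≠ 0) : Transverse t s := by
  intro v w h1 h2
  by_contra hvw
  exact h (smul_colSum_eq_zero_of_labels K hvw h1 h2)

theorem dominates_of_smul_colSum_ne_zero {t : BiTableau lam} {m : PermMod K mu}
    (h : MulOpposite.op (colSum K t) • m ≠ 0) : lam.Dominates mu := by
  by_contra hd
  refine h (permMod_induction K (P := fun m => MulOpposite.op (colSum K t) • m = 0) m (smul_zero _) (fun x y hx hy => ?_) fun c s => ?_)
  · rw [smul_add, hx, hy, add_zero]
  · rw [op_smul_comm]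
    by_contra hs
    exact hd (transverse_of_smul_colSum_ne_zero K fun e => hs (by rw [e, smul_zero])).dominates

/-- The column sum of `t` maps the whole permutation module to multiples of the polytabloid. -/
theorem smul_colSum_eq (t : BiTableau lam) (m : PermMod K lam) :
    ∃ c : K, MulOpposite.op (colSum K t) • m = c • polytabloid K t := by
  refine permMod_induction K (P := fun m => ∃ c : K, MulOpposite.op (colSum K t) • m =
    c • polytabloid K t) m ⟨0, by rw [smul_zero, zero_smul]⟩ ?_ fun c s => ?_
  · rintro x y ⟨a, ha⟩ ⟨b, hb⟩
    exact ⟨a + b, by rw [smul_add, ha, hb, add_smul]⟩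
  · by_cases h : MulOpposite.op (colSum K t) • tabloidOf K s = 0
    · exact ⟨0, by rw [op_smul_comm, h, smul_zero, zero_smul]⟩
    · obtain ⟨σ, hσ, e⟩ := (transverse_of_smul_colSum_ne_zero K h).exists_colGroup
      refine ⟨c * ((σ.sgn : ℤ) : K), ?_⟩
      have : tabloidOf K s = tabloidOf K (t.act σ) := by rw [tabloidOf, tabloidOf, e]
      rw [op_smul_comm, this, smul_colSum_act K hσ, mul_smul]

end Dominance

/-! ### Horizontal edges of diagrams -/

/-- Partners are unique, so two diagrams are equal once the edges of one are edges of the other. -/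
theorem IsMatching.eq_of_le {A : Type} {s t : Setoid A} (hs : IsMatching s) (ht : IsMatching t)
    (h : s ≤ t) : s = t := by
  refine le_antisymm h fun x y hxy => ?_
  by_cases e : y = x
  · subst e; exact Setoid.refl' _ _
  obtain ⟨z, ⟨hz1, hz2⟩, -⟩ := hs x
  rw [(ht x).unique ⟨e, hxy⟩ ⟨hz1, h hz2⟩]
  exact hz2

namespace Diagram

variable {r : ℕ}

/-- The top vertices on horizontal edges. -/
def topArc (d : Diagram r) : Set (Node r) := {v | ∃ u, u ≠ v ∧ d.rel (Sum.inl v) (Sum.inl u)}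

/-- The bottom vertices on horizontal edges. -/
def botArc (d : Diagram r) : Set (Node r) := {v | ∃ u, u ≠ v ∧ d.rel (Sum.inr v) (Sum.inr u)}

theorem hasHorizontal_iff {d : Diagram r} {k : ℕ} :
    d.HasHorizontal k ↔ 2 * k ≤ d.topArc.ncard := Iff.rfl

theorem eq_of_rel {d : Diagram r} {x y z : Node r ⊕ Node r} (hy : d.rel x y) (hz : d.rel x z)
    (hxy : y ≠ x) (hxz : z ≠ x) : y = z :=
  (d.matching x).unique ⟨hxy, hy⟩ ⟨hxz, hz⟩

theorem exists_rel_inr {d : Diagram r} {v : Node r} (hv : v ∉ d.topArc) :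
    ∃ w, d.rel (Sum.inl v) (Sum.inr w) := by
  obtain ⟨u | w, ⟨h1, h2⟩, -⟩ := d.matching (Sum.inl v)
  · exact absurd ⟨u, fun e => h1 (by rw [e]), h2⟩ hv
  · exact ⟨w, h2⟩

theorem exists_rel_inl {d : Diagram r} {w : Node r} (hw : w ∉ d.botArc) :
    ∃ v, d.rel (Sum.inl v) (Sum.inr w) := by
  obtain ⟨v | u, ⟨h1, h2⟩, -⟩ := d.matching (Sum.inr w)
  · exact ⟨v, d.rel.symm' h2⟩
  · exact absurd ⟨u, fun e => h1 (by rw [e]), h2⟩ hw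

theorem notMem_topArc {d : Diagram r} {v w : Node r} (h : d.rel (Sum.inl v) (Sum.inr w)) :
    v ∉ d.topArc := by
  rintro ⟨u, hu, hvu⟩
  exact absurd (eq_of_rel h hvu (by simp) (fun e => hu (Sum.inl_injective e))) (by simp)

theorem notMem_botArc {d : Diagram r} {v w : Node r} (h : d.rel (Sum.inl v) (Sum.inr w)) :
    w ∉ d.botArc := by
  rintro ⟨u, hu, hwu⟩
  exact absurd (eq_of_rel (d.rel.symm' h) hwu (by simp) (fun e => hu (Sum.inr_injective e)))
    (by simp)

/-- The vertical edges match the complements of the two sets. -/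
theorem ncard_topArc (d : Diagram r) : d.topArc.ncard = d.botArc.ncard := by
  have h : (d.topArcᶜ).ncard = (d.botArcᶜ).ncard := by
    refine Set.ncard_congr (fun v hv => (exists_rel_inr hv).choose) ?_ ?_ ?_
    · intro v hv
      exact notMem_botArc (exists_rel_inr hv).choose_spec
    · intro v w hv hw e
      have h1 := (exists_rel_inr hv).choose_spec
      have h2 := (exists_rel_inr hw).choose_spec
      rw [← e] at h2
      exact Sum.inl_injective (eq_of_rel (d.rel.symm' h1) (d.rel.symm' h2) (by simp) (by simp))
    · intro w hw
      obtain ⟨v, hv⟩ := exists_rel_inl hw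
      refine ⟨v, notMem_topArc hv, ?_⟩
      exact Sum.inr_injective (eq_of_rel (exists_rel_inr (notMem_topArc hv)).choose_spec hv
        (by simp) (by simp))
  have h1 := Set.ncard_add_ncard_compl d.topArc
  have h2 := Set.ncard_add_ncard_compl d.botArc
  omega

theorem topArc_subset_mul (d e : Diagram r) : d.topArc ⊆ (d.mul e).topArc := by
  rintro v ⟨u, hu, h⟩
  exact ⟨u, hu, glue_upper h⟩

theorem botArc_subset_mul (d e : Diagram r) : e.botArc ⊆ (d.mul e).botArc := by
  rintro v ⟨u, hu, h⟩
  exact ⟨u, hu, glue_lower h⟩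

theorem HasHorizontal.mul_right {d : Diagram r} {k : ℕ} (h : d.HasHorizontal k) (e : Diagram r) :
    (d.mul e).HasHorizontal k :=
  h.trans (Set.ncard_le_ncard (topArc_subset_mul d e))

theorem HasHorizontal.mul_left {e : Diagram r} {k : ℕ} (h : e.HasHorizontal k) (d : Diagram r) :
    (d.mul e).HasHorizontal k := by
  rw [hasHorizontal_iff, ncard_topArc] at h ⊢
  exact h.trans (Set.ncard_le_ncard (botArc_subset_mul d e))

theorem ncard_lt (l : ℕ) (hl : l ≤ r) : {v : Node r | (v.1 : ℕ) < l}.ncard = 2 * l := by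
  have : {v : Node r | (v.1 : ℕ) < l} =
      ((Finset.univ.filter fun i : Fin r => (i : ℕ) < l) ×ˢ (Finset.univ : Finset ℤˣ) :
        Finset (Node r)) := by
    ext v
    simp only [Set.mem_ofPred_eq, Finset.coe_product, Set.mem_prod, Finset.mem_coe,
      Finset.mem_filter, Finset.mem_univ, true_and, and_true]
  rw [this, Set.ncard_coe_finset, Finset.card_product, Fin.card_filter_val_lt, min_eq_right hl]
  exact mul_comm _ _

theorem arcs_rel {l : ℕ} {x y : Node r ⊕ Node r} :
    (arcs l).rel x y ↔ arcLabel l x = arcLabel l y := Iff.rfl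

theorem arcs_rel_inl_reflect {l : ℕ} {v : Node r} (hv : (v.1 : ℕ) < l) :
    (arcs l).rel (Sum.inl v) (Sum.inl (reflect v)) := by
  rw [arcs_rel]; simp [arcLabel, reflect, not_le.2 hv]

theorem arcs_rel_inr_reflect {l : ℕ} {v : Node r} (hv : (v.1 : ℕ) < l) :
    (arcs l).rel (Sum.inr v) (Sum.inr (reflect v)) := by
  rw [arcs_rel]; simp [arcLabel, reflect, not_le.2 hv]

theorem arcs_rel_inl_inr {l : ℕ} {v : Node r} (hv : l ≤ (v.1 : ℕ)) :
    (arcs l).rel (Sum.inl v) (Sum.inr v) := by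
  rw [arcs_rel]; simp [arcLabel, hv]

/-- A diagram that contains the edges of `arcs l` after the top vertices are relabelled. -/
theorem eq_arcs_mul_ofPerm {l : ℕ} {d : Diagram r} {σ : Hyp r}
    (h1 : ∀ v : Node r, (v.1 : ℕ) < l → d.rel (Sum.inl v) (Sum.inl (reflect v)))
    (h2 : ∀ v : Node r, ((σ.1 v).1 : ℕ) < l → d.rel (Sum.inr v) (Sum.inr (reflect v)))
    (h3 : ∀ v : Node r, l ≤ ((σ.1 v).1 : ℕ) → d.rel (Sum.inl (σ.1 v)) (Sum.inr v)) :
    (arcs l).mul (ofPerm σ) = d := by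
  have hrel : ((arcs l).mul (ofPerm σ)).rel = (arcs l).rel.comap (Sum.map id σ.1) :=
    comp_graphOf_right _ _
  refine Diagram.ext (IsMatching.eq_of_le (Diagram.matching _) d.matching fun x y hxy => ?_)
  rw [hrel] at hxy
  replace hxy : arcLabel l (Sum.map id σ.1 x) = arcLabel l (Sum.map id σ.1 y) := hxy
  have key : ∀ v w : Node r, v.1 = w.1 → (v.1 : ℕ) < l → d.rel (Sum.inl v) (Sum.inl w) := by
    intro v w hvw hv
    rcases eq_or_eq_reflect hvw.symm with rfl | rfl
    · exact Setoid.refl' _ _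
    · exact h1 v hv
  have key' : ∀ v w : Node r, (σ.1 v).1 = (σ.1 w).1 → ((σ.1 v).1 : ℕ) < l →
      d.rel (Sum.inr v) (Sum.inr w) := by
    intro v w hvw hv
    rcases eq_or_eq_reflect hvw.symm with e | e
    · rw [σ.1.injective e]
    · rw [← σ.apply_reflect] at e
      rw [σ.1.injective e]
      exact h2 v hv
  rcases x with x | x <;> rcases y with y | y <;>
    simp only [arcLabel, Sum.map_inl, Sum.map_inr, Sum.elim_inl, Sum.elim_inr, id_eq] at hxy <;>
    split_ifs at hxy with a b b <;> simp at hxy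
  · rw [hxy]
  · exact key _ _ hxy (not_le.1 a)
  · rw [hxy] at a ⊢
    exact h3 y a
  · rw [← hxy]
    exact d.rel.symm' (h3 x a)
  · rw [hxy]
  · exact key' _ _ hxy (not_le.1 a)

theorem topArc_arcs_mul_ofPerm {l : ℕ} (σ : Hyp r) :
    ((arcs l).mul (ofPerm σ)).topArc = {v : Node r | (v.1 : ℕ) < l} := by
  have hrel : ((arcs l).mul (ofPerm σ)).rel = (arcs l).rel.comap (Sum.map id σ.1) :=
    comp_graphOf_right _ _
  ext v
  constructor
  · rintro ⟨u, hu, h⟩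
    rw [hrel] at h
    replace h : arcLabel l (Sum.inl v) = arcLabel l (Sum.inl u) := h
    by_contra hv
    rw [Set.mem_ofPred_eq, not_lt] at hv
    simp only [arcLabel, Sum.elim_inl, if_pos hv] at h
    split_ifs at h
    exact hu (Sum.inr_injective h).symm
  · intro hv
    refine ⟨reflect v, reflect_ne v, ?_⟩
    rw [hrel]
    exact arcs_rel_inl_reflect hv

theorem arcs_mul_one (l : ℕ) : (arcs l : Diagram r).mul (ofPerm 1) = arcs l :=
  eq_arcs_mul_ofPerm (fun _ h => arcs_rel_inl_reflect h) (fun _ h => arcs_rel_inr_reflect h)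
    (fun _ h => arcs_rel_inl_inr h)

theorem hasHorizontal_arcs {l k : ℕ} (hl : l ≤ r) (hk : k ≤ l) :
    (arcs l : Diagram r).HasHorizontal k := by
  rw [hasHorizontal_iff, ← arcs_mul_one, topArc_arcs_mul_ofPerm, ncard_lt l hl]
  omega

theorem not_hasHorizontal_arcs_mul_ofPerm {l : ℕ} (hl : l ≤ r) (σ : Hyp r) :
    ¬ ((arcs l).mul (ofPerm σ)).HasHorizontal (l + 1) := by
  rw [hasHorizontal_iff, topArc_arcs_mul_ofPerm, ncard_lt l hl]
  omega

theorem arcs_mul_arcs (l : ℕ) : (arcs l : Diagram r).mul (arcs l) = arcs l := by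
  have := eq_arcs_mul_ofPerm (l := l) (d := (arcs l : Diagram r).mul (arcs l)) (σ := 1)
    (fun v hv => glue_upper (arcs_rel_inl_reflect hv))
    (fun v hv => glue_lower (arcs_rel_inr_reflect hv))
    (fun v hv => Setoid.trans' (glue (arcs l : Diagram r).rel (arcs l : Diagram r).rel)
      (glue_upper (p := .inl v) (q := .inr v) (arcs_rel_inl_inr hv))
      (glue_lower (p := .inl v) (q := .inr v) (arcs_rel_inl_inr hv)))
  rw [arcs_mul_one] at this
  exact this.symm

/-- For each `i ≤ l` the bottom arc `{i, -i}` of the upper copy and the top arc `{i, -i}` of the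
lower copy close up to one loop; the other components reach an outer row. -/
theorem loops_arcs (l : ℕ) (hl : l ≤ r) :
    loops (arcs l : Diagram r).rel (arcs l : Diagram r).rel = l := by
  -- An invariant of connected components: an arc is recorded by its row (0, 1 or 2) and its
  -- position, a vertical line by its vertex. It separates the loops from each other and from the
  -- outer vertices.
  let g : Node r ⊕ Node r ⊕ Node r → (Fin 3 × Fin r) ⊕ Node r :=
    Sum.elim (fun v => if l ≤ v.1 then .inr v else .inl (0, v.1))
      (Sum.elim (fun v => if l ≤ v.1 then .inr v else .inl (1, v.1))
        (fun v => if l ≤ v.1 then .inr v else .inl (2, v.1)))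
  have hg : glue (arcs l : Diagram r).rel (arcs l : Diagram r).rel ≤ Setoid.ker g := by
    refine glue_le ?_ ?_
    · rintro (p | p) (q | q) h <;>
        replace h : arcLabel l _ = arcLabel l _ := h <;>
        change g _ = g _ <;>
        simp only [arcLabel, upper, g, Sum.elim_inl, Sum.elim_inr, Function.comp_apply] at h ⊢ <;>
        split_ifs at h ⊢ <;> simp_all
    · rintro (p | p) (q | q) h <;>
        replace h : arcLabel l _ = arcLabel l _ := h <;>
        change g _ = g _ <;>
        simp only [arcLabel, g, Sum.elim_inl, Sum.elim_inr] at h ⊢ <;>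
        split_ifs at h ⊢ <;> simp_all
  let f : Fin l → Avoiding (glue (arcs l : Diagram r).rel (arcs l : Diagram r).rel) outer :=
    fun i => ⟨Quotient.mk _ (.inr (.inl (Fin.castLE hl i, 1))), by
      intro p hp
      have := hg (Quotient.exact hp)
      replace this : g _ = g _ := this
      have hi : ¬ l ≤ (i : ℕ) := not_le.2 i.2
      rcases p with p | p <;>
        simp only [outer, g, Sum.elim_inl, Sum.elim_inr, Function.comp_apply, Fin.val_castLE,
          if_neg hi] at this <;>
        split_ifs at this <;> simp at this⟩
  have hf : Function.Bijective f := by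
    constructor
    · intro i j hij
      have := hg (Quotient.exact (congrArg Subtype.val hij))
      replace this : g _ = g _ := this
      have hi : ¬ l ≤ (i : ℕ) := not_le.2 i.2
      have hj : ¬ l ≤ (j : ℕ) := not_le.2 j.2
      simp only [g, Sum.elim_inl, Sum.elim_inr, Fin.val_castLE, if_neg hi, if_neg hj] at this
      simpa [Fin.ext_iff] using this
    · rintro ⟨⟨v | v | v⟩, hv⟩
      · exact absurd rfl (hv (.inl v))
      · by_cases h : l ≤ (v.1 : ℕ)
        · refine absurd (Quotient.sound ?_) (hv (.inl v))
          exact glue_upper (p := .inl v) (q := .inr v) (arcs_rel_inl_inr h)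
        · refine ⟨⟨v.1, not_le.1 h⟩, Subtype.ext (Quotient.sound ?_)⟩
          rcases eq_or_eq_reflect (v := v) (w := (v.1, 1)) rfl with e | e
          · change glue _ _ (.inr (.inl (v.1, 1))) _
            rw [e]
          · change glue _ _ (.inr (.inl (v.1, 1))) _
            rw [e]
            exact Setoid.symm' _ (glue_lower (p := .inl v) (q := .inl (reflect v))
              (arcs_rel_inl_reflect (not_le.1 h)))
      · exact absurd rfl (hv (.inr v))
  rw [loops, ← Nat.card_congr (Equiv.ofBijective f hf), Nat.card_fin]

theorem shift_injective (l : Fin (r + 1)) : Function.Injective (Hyp.shift l) := by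
  intro σ τ h
  refine Subtype.ext (Equiv.ext fun v => ?_)
  have h1 := congrArg (fun ρ : Hyp r => ρ.1 (shiftEquiv l v)) h
  change σ.1.extendDomain (shiftEquiv l) (shiftEquiv l v) =
    τ.1.extendDomain (shiftEquiv l) (shiftEquiv l v) at h1
  rw [Equiv.Perm.extendDomain_apply_image, Equiv.Perm.extendDomain_apply_image] at h1
  exact (shiftEquiv l).injective (Subtype.ext h1)

/-- The vertical edges of the diagram determine the permutation. -/
theorem arcs_mul_shift_injective (l : Fin (r + 1)) :
    Function.Injective fun σ : Hyp (r - l) => (arcs l).mul (ofPerm (Hyp.shift l σ)) := by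
  intro σ τ h
  refine shift_injective l (Subtype.ext (Equiv.ext fun v => ?_))
  by_cases hv : (l : ℕ) ≤ v.1
  · have hrel : ∀ ρ : Hyp (r - l), ((arcs l).mul (ofPerm (Hyp.shift l ρ))).rel
        (Sum.inl ((Hyp.shift l ρ).1 v)) (Sum.inr v) := by
      intro ρ
      have hrel : ((arcs l).mul (ofPerm (Hyp.shift l ρ))).rel =
        (arcs l).rel.comap (Sum.map id (Hyp.shift l ρ).1) := comp_graphOf_right _ _
      rw [hrel]
      exact arcs_rel_inl_inr (Hyp.le_shift l ρ v hv)
    have h1 := hrel σ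
    simp only at h
    rw [h] at h1
    exact Sum.inl_injective (eq_of_rel (Setoid.symm' _ h1) (Setoid.symm' _ (hrel τ))
      (by simp) (by simp))
  · rw [Hyp.shift_of_lt l σ v hv, Hyp.shift_of_lt l τ v hv]

/-- A diagram that contains the horizontal edges of `arcs l` in both rows and has no further
horizontal edges comes from a signed permutation. -/
theorem exists_eq_arcs_mul_shift (l : Fin (r + 1)) {d : Diagram r}
    (ht : ∀ v : Node r, (v.1 : ℕ) < l → d.rel (Sum.inl v) (Sum.inl (reflect v)))
    (hb : ∀ v : Node r, (v.1 : ℕ) < l → d.rel (Sum.inr v) (Sum.inr (reflect v)))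
    (hd : ¬ d.HasHorizontal (l + 1)) :
    ∃ σ : Hyp (r - l), d = (arcs l).mul (ofPerm (Hyp.shift l σ)) := by
  have hl : (l : ℕ) ≤ r := Nat.lt_succ_iff.1 l.2
  have hL := ncard_lt (r := r) l hl
  have hsub : {v : Node r | (v.1 : ℕ) < l} ⊆ d.topArc := fun v hv =>
    ⟨reflect v, reflect_ne v, ht v hv⟩
  have hsub' : {v : Node r | (v.1 : ℕ) < l} ⊆ d.botArc := fun v hv =>
    ⟨reflect v, reflect_ne v, hb v hv⟩
  -- A further top arc `{u, v}` avoids the first `l` positions, whose vertices are already matched,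
  -- and would bring the count to `2 * l + 2`.
  have htop : d.topArc = {v : Node r | (v.1 : ℕ) < l} := by
    refine (hsub.antisymm ?_).symm
    rintro v ⟨u, hu, huv⟩
    by_contra hv
    have hu' : ¬ (u.1 : ℕ) < l := by
      intro h
      have e := eq_of_rel (ht u h) (d.rel.symm' huv)
        (fun e => reflect_ne u (Sum.inl_injective e)) (fun e => hu (Sum.inl_injective e).symm)
      rw [← Sum.inl_injective e] at hv
      exact hv h
    refine hd ?_
    rw [hasHorizontal_iff]
    have h1 : insert v (insert u {v : Node r | (v.1 : ℕ) < l}) ⊆ d.topArc := by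
      refine Set.insert_subset ⟨u, hu, huv⟩ (Set.insert_subset ⟨v, hu.symm, d.rel.symm' huv⟩ hsub)
    have h2 := Set.ncard_le_ncard h1
    rw [Set.ncard_insert_of_notMem, Set.ncard_insert_of_notMem (s := {v : Node r | (v.1 : ℕ) < l}) hu', hL] at h2
    · omega
    · rintro (h | h)
      exacts [hu h.symm, hv h]
  have hbot : {v : Node r | (v.1 : ℕ) < l} = d.botArc :=
    Set.eq_of_subset_of_ncard_le hsub' (by rw [← ncard_topArc, htop])
  have hex : ∀ w : Node r, (l : ℕ) ≤ w.1 → ∃ v : Node r, (l : ℕ) ≤ v.1 ∧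
      d.rel (Sum.inl v) (Sum.inr w) := by
    intro w hw
    obtain ⟨v, hv⟩ := exists_rel_inl (d := d) (w := w) (by rw [← hbot]; exact not_lt.2 hw)
    refine ⟨v, ?_, hv⟩
    have := notMem_topArc hv
    rw [htop] at this
    exact not_lt.1 this
  choose f hf1 hf2 using hex
  -- The permutation sends the bottom end of a vertical edge to its top end; it commutes with the
  -- reflection because `d` is symmetric.
  let g : Node (r - l) → Node (r - l) := fun v =>
    (shiftEquiv l).symm ⟨f (shiftEquiv l v) (shiftEquiv l v).2, hf1 _ _⟩
  have hg : ∀ v, d.rel (Sum.inl (shiftEquiv l (g v) : Node r)) (Sum.inr (shiftEquiv l v)) := by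
    intro v
    simp only [g, Equiv.apply_symm_apply]
    exact hf2 _ _
  have huniq : ∀ {u u' w : Node r}, d.rel (Sum.inl u) (Sum.inr w) → d.rel (Sum.inl u') (Sum.inr w) →
      u = u' := fun h h' =>
    Sum.inl_injective (eq_of_rel (d.rel.symm' h) (d.rel.symm' h') (by simp) (by simp))
  have hginj : Function.Injective g := by
    intro v w hvw
    have h1 := hg v
    rw [hvw] at h1
    exact (shiftEquiv l).injective (Subtype.ext (Sum.inr_injective
      (eq_of_rel h1 (hg w) (by simp) (by simp))))
  let τ : Equiv.Perm (Node (r - l)) := Equiv.ofBijective g (Finite.injective_iff_bijective.1 hginj)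
  have e2 : ∀ u, (shiftEquiv l (reflect u) : Node r) = reflect (shiftEquiv l u) := fun u => rfl
  let σ : Hyp (r - l) := ⟨τ, fun v => by
    refine (shiftEquiv l).injective (Subtype.ext (huniq (hg (reflect v)) ?_))
    rw [e2, e2]
    exact d.mirror _ _ (hg v)⟩
  have hσ : ∀ v, (Hyp.shift l σ).1 (shiftEquiv l v) = shiftEquiv l (g v) := fun v =>
    Equiv.Perm.extendDomain_apply_image _ _ _
  refine ⟨σ, (eq_arcs_mul_ofPerm ht (fun v hv => hb v ?_) (fun v hv => ?_)).symm⟩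
  · by_contra hc
    exact absurd hv (not_lt.2 (Hyp.le_shift l σ v (not_lt.1 hc)))
  · have hv' : (l : ℕ) ≤ v.1 := by
      by_contra hc
      rw [Hyp.shift_of_lt l σ v hc] at hv
      exact hc hv
    obtain ⟨w, hw⟩ := (shiftEquiv l).surjective ⟨v, hv'⟩
    have hw' : v = (shiftEquiv l w : Node r) := by rw [hw]
    rw [hw', hσ]
    exact hg w

end Diagram

/-! ### The corner `e_l (B / J_{l+1}) e_l` -/

namespace Brauer

variable {K : Type*} [Field K] {δ : K} {r : ℕ}

theorem diag_mem_idealJ {d : Diagram r} {k : ℕ} (h : d.HasHorizontal k) :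
    (Brauer.diag d : Brauer K δ r) ∈ Brauer.idealJ K δ r k := by
  rw [idealJ, TwoSidedIdeal.mem_asIdeal]
  exact TwoSidedIdeal.subset_span ⟨⟨d, h⟩, rfl⟩

/-- The span of the diagrams with at least `k` horizontal edges. -/
def horizontalSpan (K : Type*) [Field K] (δ : K) (r k : ℕ) : Submodule K (Brauer K δ r) :=
  Submodule.span K (Set.range fun d : {d : Diagram r // d.HasHorizontal k} =>
    (Brauer.diag d.1 : Brauer K δ r))

theorem mul_mem_horizontalSpan {k : ℕ} {x : Brauer K δ r} (y : Brauer K δ r)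
    (hx : x ∈ horizontalSpan K δ r k) : y * x ∈ horizontalSpan K δ r k := by
  refine Brauer.induction (P := fun y => y * x ∈ horizontalSpan K δ r k) y (by simp)
    (fun a b ha hb => by rw [add_mul]; exact add_mem ha hb) fun a d => ?_
  rw [smul_mul_assoc]
  refine Submodule.smul_mem _ _ ?_
  induction hx using Submodule.span_induction with
  | mem x h =>
    obtain ⟨⟨e, he⟩, rfl⟩ := h
    simp only
    rw [diag_mul_diag]
    exact Submodule.smul_mem _ _ (Submodule.subset_span ⟨⟨_, he.mul_left d⟩, rfl⟩)
  | zero => simp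
  | add a b _ _ ha hb => rw [mul_add]; exact add_mem ha hb
  | smul c a _ ha => rw [mul_smul_comm]; exact Submodule.smul_mem _ _ ha

theorem mul_mem_horizontalSpan' {k : ℕ} {x : Brauer K δ r} (y : Brauer K δ r)
    (hx : x ∈ horizontalSpan K δ r k) : x * y ∈ horizontalSpan K δ r k := by
  refine Brauer.induction (P := fun y => x * y ∈ horizontalSpan K δ r k) y (by simp)
    (fun a b ha hb => by rw [mul_add]; exact add_mem ha hb) fun a d => ?_
  rw [mul_smul_comm]
  refine Submodule.smul_mem _ _ ?_
  induction hx using Submodule.span_induction with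
  | mem x h =>
    obtain ⟨⟨e, he⟩, rfl⟩ := h
    simp only
    rw [diag_mul_diag]
    exact Submodule.smul_mem _ _ (Submodule.subset_span ⟨⟨_, he.mul_right d⟩, rfl⟩)
  | zero => simp
  | add a b _ _ ha hb => rw [add_mul]; exact add_mem ha hb
  | smul c a _ ha => rw [smul_mul_assoc]; exact Submodule.smul_mem _ _ ha

/-- Concatenation never destroys outer horizontal edges, so the linear span is already a two-sided
ideal. Membership in J_k can thus be tested on coefficients of diagrams. -/
theorem mem_horizontalSpan_of_mem_idealJ {k : ℕ} {x : Brauer K δ r}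
    (hx : x ∈ Brauer.idealJ K δ r k) : x ∈ horizontalSpan K δ r k := by
  rw [idealJ, TwoSidedIdeal.mem_asIdeal] at hx
  let I : TwoSidedIdeal (Brauer K δ r) := TwoSidedIdeal.mk' (horizontalSpan K δ r k)
    (zero_mem _) (fun h h' => add_mem h h') (fun h => neg_mem h)
    (fun h => mul_mem_horizontalSpan _ h) (fun h => mul_mem_horizontalSpan' _ h)
  have hI : ∀ x, x ∈ I ↔ x ∈ horizontalSpan K δ r k := fun x => TwoSidedIdeal.mem_mk' _ _ _ _ _ _ _
  rw [← hI]
  refine TwoSidedIdeal.span_le.2 ?_ hx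
  rintro _ ⟨d, rfl⟩
  exact (hI _).2 (Submodule.subset_span ⟨d, rfl⟩)

/-- The coefficient of a diagram. -/
def coeffDiag (d : Diagram r) : Brauer K δ r →ₗ[K] K := Finsupp.lapply d

theorem coeffDiag_self (d : Diagram r) : coeffDiag d (Brauer.diag d : Brauer K δ r) = 1 :=
  Finsupp.single_eq_same

theorem coeffDiag_of_ne {d e : Diagram r} (h : e ≠ d) :
    coeffDiag d (Brauer.diag e : Brauer K δ r) = 0 :=
  Finsupp.single_eq_of_ne' h

theorem coeffDiag_eq_zero {k : ℕ} {x : Brauer K δ r} (hx : x ∈ Brauer.idealJ K δ r k)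
    {d : Diagram r} (hd : ¬ d.HasHorizontal k) : coeffDiag d x = 0 := by
  have h : horizontalSpan K δ r k ≤ LinearMap.ker (coeffDiag d) := by
    refine Submodule.span_le.2 ?_
    rintro _ ⟨⟨e, he⟩, rfl⟩
    exact coeffDiag_of_ne fun h => hd (h ▸ he)
  exact h (mem_horizontalSpan_of_mem_idealJ hx)

/-- The `l` closed loops contribute `δ ^ l`, which cancels one of the two factors `δ⁻¹ ^ l`. -/
theorem idem_mul_idem (hδ : δ ≠ 0) (l : Fin (r + 1)) :
    Brauer.idem K δ l * Brauer.idem K δ l = Brauer.idem K δ l := by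
  rw [idem, smul_mul_smul_comm, diag_mul_diag, Diagram.arcs_mul_arcs,
    Diagram.loops_arcs _ (Nat.lt_succ_iff.1 l.2), smul_smul, mul_assoc, ← mul_pow,
    inv_mul_cancel₀ hδ, one_pow, mul_one]

theorem idem_mem_idealJ {l m : Fin (r + 1)} (h : l < m) :
    Brauer.idem K δ m ∈ Brauer.idealJ K δ r (l + 1) := by
  have : Brauer.idem K δ m = (algebraMap K _ (δ⁻¹ ^ (m : ℕ))) * Brauer.diag (Diagram.arcs m) := by
    rw [idem, Algebra.smul_def]
  rw [this]
  exact Ideal.mul_mem_left _ _ (diag_mem_idealJ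
    (Diagram.hasHorizontal_arcs (Nat.lt_succ_iff.1 m.2) (Nat.succ_le_of_lt h)))

theorem ofHypAlg_single (l : Fin (r + 1)) (σ : Hyp (r - l)) (c : K) :
    ofHypAlg K δ l (MonoidAlgebra.single σ c) =
      c • Brauer.diag (Diagram.ofPerm (Hyp.shift l σ)) := by
  simp [ofHypAlg, ofHyp, MonoidAlgebra.lift_single]

theorem ofHypAlg_single_mul_idem (l : Fin (r + 1)) (σ : Hyp (r - l)) (c : K) :
    ofHypAlg K δ l (MonoidAlgebra.single σ c) * Brauer.idem K δ l =
      (c * δ⁻¹ ^ (l : ℕ)) •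
        Brauer.diag ((Diagram.arcs l).mul (Diagram.ofPerm (Hyp.shift l σ))) := by
  rw [ofHypAlg_single, idem, smul_mul_smul_comm, ofPerm_mul_diag, Diagram.shift_mul_arcs]

/-- The diagrams occurring in `a e_l` have exactly `l` horizontal edges and differ for different σ,
with coefficients `δ⁻¹ ^ l` times those of `a`; elements of J_{l+1} have coefficient zero there. -/
theorem eq_zero_of_ofHypAlg_mul_idem_mem (hδ : δ ≠ 0) (l : Fin (r + 1)) {a : HypAlg K (r - l)}
    (h : ofHypAlg K δ l a * Brauer.idem K δ l ∈ Brauer.idealJ K δ r (l + 1)) : a = 0 := by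
  have key : ∀ (a : HypAlg K (r - l)) σ,
      coeffDiag ((Diagram.arcs l).mul (Diagram.ofPerm (Hyp.shift l σ)))
        (ofHypAlg K δ l a * Brauer.idem K δ l) = a.coeff σ * δ⁻¹ ^ (l : ℕ) := by
    intro a σ
    induction a using MonoidAlgebra.induction_linear with
    | zero => simp
    | add a b ha hb =>
      rw [map_add, add_mul, map_add, ha, hb, ← add_mul]
      rfl
    | single τ c =>
      rw [ofHypAlg_single_mul_idem, map_smul]
      by_cases hτ : τ = σ
      · subst hτ
        rw [coeffDiag_self, smul_eq_mul, mul_one, MonoidAlgebra.coeff_single, Finsupp.single_apply, if_pos rfl]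
      · rw [coeffDiag_of_ne fun e => hτ (Diagram.arcs_mul_shift_injective l e),
          MonoidAlgebra.coeff_single, Finsupp.single_apply, if_neg hτ, smul_zero, zero_mul]
  ext σ
  have h1 := key a σ
  rw [coeffDiag_eq_zero h (Diagram.not_hasHorizontal_arcs_mul_ofPerm (Nat.lt_succ_iff.1 l.2) _)]
    at h1
  exact (mul_eq_zero.1 h1.symm).resolve_right (pow_ne_zero _ (inv_ne_zero hδ))

/-- For a diagram `d`, the product e_l d e_l is a multiple of one diagram with the arcs of e_l in
both rows. Either it has a further horizontal edge and lies in J_{l+1}, or it comes from a signed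
permutation. -/
theorem exists_sub_mem_idealJ (hδ : δ ≠ 0) (l : Fin (r + 1)) (x : Brauer K δ r) :
    ∃ a : HypAlg K (r - l), Brauer.idem K δ l * x * Brauer.idem K δ l -
      ofHypAlg K δ l a * Brauer.idem K δ l ∈ Brauer.idealJ K δ r (l + 1) := by
  refine Brauer.induction (P := fun x => ∃ a : HypAlg K (r - l),
    Brauer.idem K δ l * x * Brauer.idem K δ l - ofHypAlg K δ l a * Brauer.idem K δ l ∈
      Brauer.idealJ K δ r (l + 1)) x ⟨0, by simp⟩ ?_ ?_
  · rintro x y ⟨a, ha⟩ ⟨b, hb⟩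
    refine ⟨a + b, ?_⟩
    convert add_mem ha hb using 1
    rw [map_add]
    noncomm_ring
  · intro c d
    set e := (Diagram.arcs l : Diagram r)
    obtain ⟨c', hc'⟩ : ∃ c' : K, Brauer.idem K δ l * (c • Brauer.diag d) * Brauer.idem K δ l =
        c' • Brauer.diag ((e.mul d).mul e) := by
      rw [idem, smul_mul_smul_comm, smul_mul_smul_comm, diag_mul_diag, smul_mul_assoc,
        diag_mul_diag, smul_smul, smul_smul]
      exact ⟨_, rfl⟩
    rw [hc']
    by_cases h : ((e.mul d).mul e).HasHorizontal (l + 1)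
    · refine ⟨0, ?_⟩
      rw [map_zero, zero_mul, sub_zero, Algebra.smul_def]
      exact Ideal.mul_mem_left _ _ (diag_mem_idealJ h)
    · obtain ⟨σ, hσ⟩ := Diagram.exists_eq_arcs_mul_shift l
        (fun v hv => glue_upper (s := (e.mul d).rel) (p := .inl v) (q := .inl (reflect v))
          (glue_upper (p := .inl v) (q := .inl (reflect v)) (Diagram.arcs_rel_inl_reflect hv)))
        (fun v hv => glue_lower (Diagram.arcs_rel_inr_reflect hv)) h
      -- The factor `δ ^ l` compensates the normalization of e_l.
      refine ⟨MonoidAlgebra.single σ (c' * δ ^ (l : ℕ)), ?_⟩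
      rw [ofHypAlg_single_mul_idem, hσ, mul_assoc, ← mul_pow, mul_inv_cancel₀ hδ, one_pow, mul_one,
        sub_self]
      exact zero_mem _

end Brauer

/-! ### The symbol of an element of the Brauer algebra -/

section Symbol

open _root_.TypeC.Brauer

variable {K : Type*} [Field K] {δ : K} {r : ℕ} (hδ : δ ≠ 0) (l : Fin (r + 1))

/-- The element `a` of the group algebra of `W_{r-l}` with `e_l x e_l ≡ a e_l` modulo `J_{l+1}`. -/
def symbol (x : Brauer K δ r) : HypAlg K (r - l) := (exists_sub_mem_idealJ hδ l x).choose

theorem symbol_spec (x : Brauer K δ r) : idem K δ l * x * idem K δ l -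
    ofHypAlg K δ l (symbol hδ l x) * idem K δ l ∈ idealJ K δ r (l + 1) :=
  (exists_sub_mem_idealJ hδ l x).choose_spec

variable {l}

/-- Uniqueness of the symbol. Linearity, compatibility with the group algebra and invariance under
e_l all reduce to it. -/
theorem symbol_eq {x : Brauer K δ r} {a : HypAlg K (r - l)} (h : idem K δ l * x * idem K δ l -
    ofHypAlg K δ l a * idem K δ l ∈ idealJ K δ r (l + 1)) : symbol hδ l x = a := by
  refine sub_eq_zero.1 (eq_zero_of_ofHypAlg_mul_idem_mem hδ l ?_)
  convert sub_mem h (symbol_spec hδ l x) using 1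
  rw [map_sub]
  noncomm_ring

theorem symbol_eq_zero {x : Brauer K δ r} (hx : x ∈ idealJ K δ r (l + 1)) :
    symbol hδ l x = 0 := by
  refine symbol_eq hδ ?_
  rw [map_zero, zero_mul, sub_zero]
  exact Ideal.mul_mem_right _ _ (Ideal.mul_mem_left _ _ hx)

theorem symbol_add (x y : Brauer K δ r) : symbol hδ l (x + y) = symbol hδ l x + symbol hδ l y := by
  refine symbol_eq hδ ?_
  convert add_mem (symbol_spec hδ l x) (symbol_spec hδ l y) using 1
  rw [map_add]
  noncomm_ring

theorem symbol_smul (c : K) (x : Brauer K δ r) : symbol hδ l (c • x) = c • symbol hδ l x := by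
  refine symbol_eq hδ ?_
  convert Ideal.mul_mem_left _ (algebraMap K _ c) (symbol_spec hδ l x) using 1
  rw [map_smul, ← Algebra.smul_def, mul_smul_comm, smul_mul_assoc, smul_mul_assoc, smul_sub]

theorem symbol_ofHypAlg_mul (a : HypAlg K (r - l)) (x : Brauer K δ r) :
    symbol hδ l (ofHypAlg K δ l a * x) = a * symbol hδ l x := by
  refine symbol_eq hδ ?_
  convert Ideal.mul_mem_left _ (ofHypAlg K δ l a) (symbol_spec hδ l x) using 1
  rw [map_mul, mul_sub, ← mul_assoc (idem K δ l), ← ofHypAlg_mul_idem]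
  simp only [mul_assoc]

theorem symbol_mul_ofHypAlg (x : Brauer K δ r) (a : HypAlg K (r - l)) :
    symbol hδ l (x * ofHypAlg K δ l a) = symbol hδ l x * a := by
  refine symbol_eq hδ ?_
  convert Ideal.mul_mem_right (ofHypAlg K δ l a) _ (symbol_spec hδ l x) using 1
  rw [map_mul, sub_mul]
  congr 1
  · simp only [mul_assoc, ofHypAlg_mul_idem]
  · rw [mul_assoc, ofHypAlg_mul_idem, ← mul_assoc]

theorem symbol_idem_mul (x : Brauer K δ r) : symbol hδ l (idem K δ l * x) = symbol hδ l x := by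
  refine symbol_eq hδ ?_
  rw [← mul_assoc, idem_mul_idem hδ]
  exact symbol_spec hδ l x

theorem symbol_mul_idem (x : Brauer K δ r) : symbol hδ l (x * idem K δ l) = symbol hδ l x := by
  refine symbol_eq hδ ?_
  rw [← mul_assoc, mul_assoc _ _ (idem K δ l), idem_mul_idem hδ]
  exact symbol_spec hδ l x

theorem symbol_one : symbol hδ l (1 : Brauer K δ r) = 1 := by
  refine symbol_eq hδ ?_
  rw [mul_one, map_one, one_mul, idem_mul_idem hδ, sub_self]
  exact zero_mem _

end Symbol

/-! ### Induced modules -/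

section Induced

open _root_.TypeC.Brauer

variable {K : Type*} [Field K] {δ : K} {r : ℕ} {Q : Type*} [Ring Q] [Algebra K Q]
  {π : Brauer K δ r →ₐ[K] Q} {l : Fin (r + 1)}
  {M : Type*} [AddCommGroup M] [Module K M] [Module (HypAlg K (r - l))ᵐᵒᵖ M]

instance : IsScalarTower K (Brauer K δ r)ᵐᵒᵖ (Corner π l) where
  smul_assoc c b x := Corner.ext <| by
    change x.val * π (c • b.unop) = c • (x.val * π b.unop)
    rw [map_smul, mul_smul_comm]

/-- The element `e_l` of `e_l Q`. -/
def Corner.idem (π : Brauer K δ r →ₐ[K] Q) (l : Fin (r + 1)) : Corner π l :=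
  ⟨π (Brauer.idem K δ l), 1, mul_one _⟩

theorem Corner.val_idem : (Corner.idem π l).val = π (Brauer.idem K δ l) := rfl

theorem Corner.val_op_smul (b : Brauer K δ r) (x : Corner π l) :
    (MulOpposite.op b • x).val = x.val * π b := rfl

theorem Corner.val_hypAlg_smul (a : HypAlg K (r - l)) (x : Corner π l) :
    (a • x).val = π (ofHypAlg K δ l a) * x.val := rfl

theorem Corner.exists_eq (hπ : Function.Surjective π) (x : Corner π l) :
    ∃ b : Brauer K δ r, x = MulOpposite.op b • Corner.idem π l := by
  obtain ⟨_, y, rfl⟩ := x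
  obtain ⟨b, rfl⟩ := hπ y
  exact ⟨b, rfl⟩

variable (π l M) in
/-- The map `m ↦ m ⊗ e_l`. -/
def unitMap : M →+ TensorCorner π l M where
  toFun m := Submodule.Quotient.mk (Corner.idem π l ⊗ₜ m)
  map_zero' := by rw [TensorProduct.tmul_zero]; rfl
  map_add' m n := by rw [TensorProduct.tmul_add]; rfl

theorem unitMap_apply (m : M) :
    unitMap π l M m = Submodule.Quotient.mk (Corner.idem π l ⊗ₜ m) := rfl

theorem mk_tmul (b : Brauer K δ r) (m : M) :
    (Submodule.Quotient.mk ((MulOpposite.op b • Corner.idem π l) ⊗ₜ m) : TensorCorner π l M) =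
      MulOpposite.op b • unitMap π l M m := rfl

theorem unitMap_op_smul (a : HypAlg K (r - l)) (m : M) :
    unitMap π l M (MulOpposite.op a • m) = MulOpposite.op (ofHypAlg K δ l a) • unitMap π l M m := by
  rw [← mk_tmul, unitMap_apply, eq_comm, Submodule.Quotient.eq]
  refine Submodule.subset_span ⟨a, Corner.idem π l, m, ?_⟩
  congr 2
  refine Corner.ext ?_
  rw [Corner.val_op_smul, Corner.val_hypAlg_smul, Corner.val_idem, ← map_mul, ← map_mul,
    ofHypAlg_mul_idem]

theorem op_idem_smul_unitMap (hδ : δ ≠ 0) (m : M) :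
    MulOpposite.op (Brauer.idem K δ l) • unitMap π l M m = unitMap π l M m := by
  rw [← mk_tmul, unitMap_apply]
  congr 2
  refine Corner.ext ?_
  rw [Corner.val_op_smul, Corner.val_idem, ← map_mul, idem_mul_idem hδ]

theorem op_idem_mul_smul_unitMap (hδ : δ ≠ 0) (x : Brauer K δ r) (m : M) :
    MulOpposite.op (Brauer.idem K δ l * x) • unitMap π l M m =
      MulOpposite.op x • unitMap π l M m := by
  rw [MulOpposite.op_mul, mul_smul, op_idem_smul_unitMap hδ]

/-- Since e_l Q is the image of e_l B, the elements m ⊗ e_l generate the induced module over the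
Brauer algebra. -/
theorem tensorCorner_induction (hπ : Function.Surjective π) {P : TensorCorner π l M → Prop}
    (z : TensorCorner π l M) (h0 : P 0) (hadd : ∀ x y, P x → P y → P (x + y))
    (hs : ∀ (x : Brauer K δ r) m, P (MulOpposite.op x • unitMap π l M m)) : P z := by
  obtain ⟨w, rfl⟩ := Submodule.Quotient.mk_surjective _ z
  induction w using TensorProduct.induction_on with
  | zero => exact h0
  | tmul x m =>
    obtain ⟨b, rfl⟩ := Corner.exists_eq hπ x
    exact hs b m
  | add x y hx hy => exact hadd _ _ hx hy

theorem op_smul_eq_zero (hπ : Function.Surjective π) {j : Brauer K δ r}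
    (hj : ∀ b, π (b * j) = 0) (z : TensorCorner π l M) : MulOpposite.op j • z = 0 := by
  refine tensorCorner_induction hπ (P := fun z => MulOpposite.op j • z = 0) z (smul_zero _)
    (fun x y hx hy => by rw [smul_add, hx, hy, add_zero]) fun x m => ?_
  rw [← mul_smul, ← MulOpposite.op_mul, ← mk_tmul]
  have : MulOpposite.op (x * j) • Corner.idem π l = 0 := by
    refine Corner.ext ?_
    rw [Corner.val_op_smul, hj, mul_zero, map_zero]
  rw [this, TensorProduct.zero_tmul]
  rfl

/-! ### The retraction of an induced module onto the original module -/

section Retraction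

variable [IsScalarTower K (HypAlg K (r - l))ᵐᵒᵖ M] (hδ : δ ≠ 0)
  (hπ : Function.Surjective π) (hJ : ∀ x, π x = 0 → x ∈ idealJ K δ r (l + 1))

/-- The symbol, as a map on a quotient of the Brauer algebra. -/
def quotSymbol : Q →ₗ[K] HypAlg K (r - l) where
  toFun q := symbol hδ l (Function.surjInv hπ q)
  -- The chosen preimages are additive up to the kernel of π, which lies in J_{l+1}, where the
  -- symbol vanishes. The difference is written with the scalar `-1` so that `symbol_add` and
  -- `symbol_smul` suffice.
  map_add' p q := by
    rw [← symbol_add, ← sub_eq_zero, sub_eq_add_neg, ← neg_one_smul K (symbol hδ l (_ + _)),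
      ← symbol_smul, ← symbol_add]
    refine symbol_eq_zero hδ (hJ _ ?_)
    simp [Function.surjInv_eq]
    abel
  map_smul' c q := by
    rw [RingHom.id_apply, ← symbol_smul, ← sub_eq_zero, sub_eq_add_neg,
      ← neg_one_smul K (symbol hδ l (c • _)), ← symbol_smul, ← symbol_add]
    refine symbol_eq_zero hδ (hJ _ ?_)
    simp [Function.surjInv_eq]

theorem quotSymbol_apply (x : Brauer K δ r) : quotSymbol hδ hπ hJ (π x) = symbol hδ l x := by
  change symbol hδ l (Function.surjInv hπ (π x)) = _
  rw [← sub_eq_zero, sub_eq_add_neg, ← neg_one_smul K (symbol hδ l x), ← symbol_smul, ← symbol_add]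
  refine symbol_eq_zero hδ (hJ _ ?_)
  simp [Function.surjInv_eq]

variable (M) in
/-- The map `m ⊗ x ↦ m φ(x)` before passing to the tensor product over the group algebra. -/
def preRetraction : Corner π l ⊗[K] M →ₗ[K] M :=
  TensorProduct.lift (LinearMap.mk₂ K
    (fun (x : Corner π l) (m : M) => MulOpposite.op (quotSymbol hδ hπ hJ x.val) • m)
    (fun x y m => by rw [map_add, map_add, MulOpposite.op_add, add_smul])
    (fun c x m => by rw [map_smul, map_smul, MulOpposite.op_smul, smul_assoc])
    (fun x m n => smul_add _ _ _)
    (fun c x m => smul_comm _ _ _))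

theorem preRetraction_tmul (b : Brauer K δ r) (m : M) :
    preRetraction M hδ hπ hJ ((MulOpposite.op b • Corner.idem π l) ⊗ₜ m) =
      MulOpposite.op (symbol hδ l b) • m := by
  rw [preRetraction, TensorProduct.lift.tmul, LinearMap.mk₂_apply, Corner.val_op_smul,
    Corner.val_idem, ← map_mul, quotSymbol_apply, symbol_idem_mul]

theorem preRetraction_balanced {z : Corner π l ⊗[K] M} (hz : z ∈ balanced π l M) :
    preRetraction M hδ hπ hJ z = 0 := by
  -- `balanced` is a span over the Brauer algebra while the map is only `K`-linear, so the induction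
  -- must carry all translates of `z`.
  suffices h : ∀ b : Brauer K δ r, preRetraction M hδ hπ hJ (MulOpposite.op b • z) = 0 by
    simpa using h 1
  induction hz using Submodule.span_induction with
  | mem z h =>
    obtain ⟨a, x, m, rfl⟩ := h
    obtain ⟨c, rfl⟩ := Corner.exists_eq hπ x
    intro b
    have e1 : MulOpposite.op b • a • MulOpposite.op c • Corner.idem π l =
        MulOpposite.op (ofHypAlg K δ l a * c * b) • Corner.idem π l := by
      refine Corner.ext ?_
      simp only [Corner.val_op_smul, Corner.val_hypAlg_smul, Corner.val_idem, ← map_mul]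
      rw [← mul_assoc, ← mul_assoc, ← mul_assoc, ofHypAlg_mul_idem]
    rw [smul_sub, TensorProduct.smul_tmul', TensorProduct.smul_tmul', e1, ← mul_smul,
      ← MulOpposite.op_mul, map_sub, preRetraction_tmul, preRetraction_tmul, mul_assoc,
      symbol_ofHypAlg_mul, MulOpposite.op_mul, mul_smul, sub_self]
  | zero => simp
  | add x y _ _ hx hy => intro b; rw [smul_add, map_add, hx, hy, add_zero]
  | smul a x _ hx =>
    intro b
    rw [← mul_smul]
    exact hx (a.unop * b)

variable (M) in
/-- The map `X ⊗ e_l Q → X` that sends `m ⊗ x` to `m φ(x)`, where `φ` is the symbol. -/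
def retraction : TensorCorner π l M →+ M :=
  QuotientAddGroup.lift (balanced π l M).toAddSubgroup (preRetraction M hδ hπ hJ).toAddMonoidHom
    fun _ hz => preRetraction_balanced hδ hπ hJ hz

theorem retraction_smul_unitMap (x : Brauer K δ r) (m : M) :
    retraction M hδ hπ hJ (MulOpposite.op x • unitMap π l M m) =
      MulOpposite.op (symbol hδ l x) • m :=
  preRetraction_tmul hδ hπ hJ x m

theorem retraction_unitMap (m : M) : retraction M hδ hπ hJ (unitMap π l M m) = m := by
  have := retraction_smul_unitMap hδ hπ hJ 1 m
  rwa [MulOpposite.op_one, one_smul, symbol_one, MulOpposite.op_one, one_smul] at this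

theorem retraction_op_smul_ofHypAlg (a : HypAlg K (r - l)) (z : TensorCorner π l M) :
    retraction M hδ hπ hJ (MulOpposite.op (ofHypAlg K δ l a) • z) =
      MulOpposite.op a • retraction M hδ hπ hJ z := by
  refine tensorCorner_induction hπ (P := fun z =>
    retraction M hδ hπ hJ (MulOpposite.op (ofHypAlg K δ l a) • z) =
      MulOpposite.op a • retraction M hδ hπ hJ z) z (by simp) ?_ ?_
  · intro x y hx hy
    rw [smul_add, map_add, hx, hy, map_add, smul_add]
  · intro x m
    rw [← mul_smul, ← MulOpposite.op_mul, retraction_smul_unitMap, retraction_smul_unitMap,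
      symbol_mul_ofHypAlg, MulOpposite.op_mul, mul_smul]

theorem retraction_op_smul_idem (z : TensorCorner π l M) :
    retraction M hδ hπ hJ (MulOpposite.op (Brauer.idem K δ l) • z) = retraction M hδ hπ hJ z := by
  refine tensorCorner_induction hπ (P := fun z => retraction M hδ hπ hJ
    (MulOpposite.op (Brauer.idem K δ l) • z) = retraction M hδ hπ hJ z) z (by simp) ?_ ?_
  · intro x y hx hy
    rw [smul_add, map_add, hx, hy, map_add]
  · intro x m
    rw [← mul_smul, ← MulOpposite.op_mul, retraction_smul_unitMap, retraction_smul_unitMap,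
      symbol_mul_idem]

theorem retraction_op_smul_of_mem {j : Brauer K δ r} (hj : j ∈ idealJ K δ r (l + 1))
    (z : TensorCorner π l M) : retraction M hδ hπ hJ (MulOpposite.op j • z) = 0 := by
  refine tensorCorner_induction hπ (P := fun z => retraction M hδ hπ hJ
    (MulOpposite.op j • z) = 0) z (by simp) ?_ ?_
  · intro x y hx hy
    rw [smul_add, map_add, hx, hy, add_zero]
  · intro x m
    rw [← mul_smul, ← MulOpposite.op_mul, retraction_smul_unitMap,
      symbol_eq_zero hδ (Ideal.mul_mem_left _ _ hj), MulOpposite.op_zero, zero_smul]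

/-- Modulo `J_{l+1}`, multiplication by `e_l` is the retraction onto `X ⊗ e_l`. -/
theorem op_idem_smul_induction {P : TensorCorner π l M → Prop} (h0 : P 0)
    (hadd : ∀ x y, P x → P y → P (x + y))
    (hs : ∀ j ∈ idealJ K δ r (l + 1), ∀ m, P (MulOpposite.op j • unitMap π l M m))
    (z : TensorCorner π l M) : P (MulOpposite.op (Brauer.idem K δ l) • z -
      unitMap π l M (retraction M hδ hπ hJ z)) := by
  refine tensorCorner_induction hπ (P := fun z => P (MulOpposite.op (Brauer.idem K δ l) • z -
      unitMap π l M (retraction M hδ hπ hJ z))) z (by simpa using h0) ?_ ?_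
  · intro x y hx hy
    have := hadd _ _ hx hy
    rw [smul_add, map_add, map_add]
    convert this using 1
    abel
  · intro x m
    -- Here j = e_l x e_l - φ(x) e_l acts on m ⊗ e_l; the outcome is exactly the difference for z =
    -- m ⊗ e_l x.
    have := hs _ (symbol_spec hδ l x) m
    rwa [ofHypAlg_mul_idem, mul_assoc, ← mul_sub, op_idem_mul_smul_unitMap hδ, MulOpposite.op_sub,
      sub_smul, ← unitMap_op_smul, MulOpposite.op_mul, mul_smul,
      ← retraction_smul_unitMap hδ hπ hJ] at this

end Retraction

/-! ### Induction and localization of homomorphisms -/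

section Functoriality

variable {M' : Type*} [AddCommGroup M'] [Module K M'] [Module (HypAlg K (r - l))ᵐᵒᵖ M']
  [IsScalarTower K (HypAlg K (r - l))ᵐᵒᵖ M']

variable (π l) in
/-- The map `e_l B → e_l Q`. -/
def cornerMap : Corner (AlgHom.id K (Brauer K δ r)) l →ₗ[(Brauer K δ r)ᵐᵒᵖ] Corner π l where
  toFun x := ⟨π x.val, by
    obtain ⟨_, y, rfl⟩ := x
    exact ⟨π y, (map_mul π _ _).symm⟩⟩
  map_add' x y := Corner.ext (map_add π x.val y.val)
  map_smul' b x := Corner.ext (map_mul π x.val b.unop)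

theorem cornerMap_val (x : Corner (AlgHom.id K (Brauer K δ r)) l) :
    (cornerMap π l x).val = π x.val := rfl

variable (π) [IsScalarTower K (HypAlg K (r - l))ᵐᵒᵖ M] in
/-- The homomorphism `M ⊗ e_l B → M' ⊗ e_l Q` induced by a homomorphism `M → M'`. -/
def tensorCornerMap (h : M →ₗ[(HypAlg K (r - l))ᵐᵒᵖ] M') :
    IndBig δ l M →ₗ[(Brauer K δ r)ᵐᵒᵖ] TensorCorner π l M' :=
  Submodule.mapQ _ _
    (TensorProduct.AlgebraTensorModule.map (cornerMap π l) (h.restrictScalars K)) (by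
      refine Submodule.span_le.2 ?_
      rintro _ ⟨a, x, m, rfl⟩
      refine Submodule.subset_span ⟨a, cornerMap π l x, h m, ?_⟩
      rw [map_sub, TensorProduct.AlgebraTensorModule.map_tmul,
        TensorProduct.AlgebraTensorModule.map_tmul, LinearMap.restrictScalars_apply,
        LinearMap.restrictScalars_apply, map_smul h]
      congr 2
      refine Corner.ext ?_
      rw [cornerMap_val, Corner.val_hypAlg_smul, Corner.val_hypAlg_smul, cornerMap_val]
      exact map_mul π _ _)

theorem tensorCornerMap_unitMap [IsScalarTower K (HypAlg K (r - l))ᵐᵒᵖ M]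
    (h : M →ₗ[(HypAlg K (r - l))ᵐᵒᵖ] M') (m : M) :
    tensorCornerMap π h (unitMap _ l M m) = unitMap π l M' (h m) := rfl

variable (hδ : δ ≠ 0) (hπ : Function.Surjective π)
  (hJ : ∀ x, π x = 0 → x ∈ idealJ K δ r (l + 1))

/-- The retraction `M ⊗ e_l B → M`. -/
def bigRetraction [IsScalarTower K (HypAlg K (r - l))ᵐᵒᵖ M] : IndBig δ l M →+ M :=
  retraction M hδ Function.surjective_id fun x hx => by
    rw [show x = 0 from hx]; exact zero_mem _

/-- The homomorphism `M → M'` induced by a homomorphism `M ⊗ e_l B → M' ⊗ e_l Q`. -/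
def localize (F : IndBig δ l M →ₗ[(Brauer K δ r)ᵐᵒᵖ] TensorCorner π l M') :
    M →ₗ[(HypAlg K (r - l))ᵐᵒᵖ] M' where
  toFun m := retraction M' hδ hπ hJ (F (unitMap _ l M m))
  map_add' m n := by rw [map_add, map_add, map_add]
  map_smul' a m := by
    obtain ⟨a, rfl⟩ := MulOpposite.op_surjective a
    rw [unitMap_op_smul, map_smul, retraction_op_smul_ofHypAlg, RingHom.id_apply]

theorem localize_apply (F : IndBig δ l M →ₗ[(Brauer K δ r)ᵐᵒᵖ] TensorCorner π l M') (m : M) :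
    localize hδ hπ hJ F m = retraction M' hδ hπ hJ (F (unitMap _ l M m)) := rfl

/-- The identity behind functoriality of localization. After applying e_l, an element `z` agrees
with its retraction tensored with e_l up to terms from J_{l+1}; `F` commutes with e_l and with
J_{l+1}, and the second retraction ignores e_l and kills J_{l+1}. -/
theorem retraction_apply [IsScalarTower K (HypAlg K (r - l))ᵐᵒᵖ M]
    (F : IndBig δ l M →ₗ[(Brauer K δ r)ᵐᵒᵖ] TensorCorner π l M')
    (z : IndBig δ l M) :
    retraction M' hδ hπ hJ (F z) = localize hδ hπ hJ F (bigRetraction hδ z) := by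
  have key := op_idem_smul_induction (M := M) hδ (π := AlgHom.id K (Brauer K δ r))
    Function.surjective_id (l := l) (fun x hx => by rw [show x = 0 from hx]; exact zero_mem _)
    (P := fun z => retraction M' hδ hπ hJ (F z) = 0) (by simp)
    (fun x y hx hy => by rw [map_add, map_add, hx, hy, add_zero])
    (fun j hj m => by rw [map_smul, retraction_op_smul_of_mem hδ hπ hJ hj]) z
  rw [map_sub, map_sub, map_smul, retraction_op_smul_idem, sub_eq_zero] at key
  exact key

theorem localize_tensorCornerMap [IsScalarTower K (HypAlg K (r - l))ᵐᵒᵖ M]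
    (h : M →ₗ[(HypAlg K (r - l))ᵐᵒᵖ] M') :
    localize hδ hπ hJ (tensorCornerMap π h) = h := by
  ext1 m
  rw [localize_apply, tensorCornerMap_unitMap, retraction_unitMap]

end Functoriality

end Induced

open _root_.TypeC.Brauer

/-! ### Finiteness -/

section Finiteness

variable {K : Type*} [Field K] {δ : K} {r : ℕ}

instance : Finite (Diagram r) :=
  Finite.of_injective (fun d : Diagram r => fun x y => d.rel x y) fun _ _ h =>
    Diagram.ext (Setoid.ext fun x y => iff_of_eq (congrFun (congrFun h x) y))

instance : Module.Finite K (Brauer K δ r) := inferInstanceAs (Module.Finite K (Diagram r →₀ K))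

instance {l : Fin (r + 1)} : Module.Finite K (Corner (AlgHom.id K (Brauer K δ r)) l) :=
  inferInstanceAs (Module.Finite K (LinearMap.range _))

instance {n : ℕ} {lam : BiPartition n} : Finite (BiTableau lam) :=
  Finite.of_injective (fun t : BiTableau lam => t.entry) fun t s h => by
    rcases t with ⟨t, ht⟩
    rcases s with ⟨s, hs⟩
    simp only at h
    subst h
    rfl

instance {n : ℕ} {lam : BiPartition n} : Finite (Tabloid lam) :=
  inferInstanceAs (Finite (Quotient (rowEquiv lam)))

instance {n : ℕ} {lam : BiPartition n} : Module.Finite K (PermMod K lam) :=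
  inferInstanceAs (Module.Finite K (Tabloid lam →₀ K))

instance {n : ℕ} {lam : BiPartition n} : IsNoetherian (HypAlg K n)ᵐᵒᵖ (PermMod K lam) :=
  isNoetherian_of_tower K inferInstance

instance {n : ℕ} {lam : BiPartition n} : IsArtinian (HypAlg K n)ᵐᵒᵖ (PermMod K lam) :=
  isArtinian_of_tower K inferInstance

instance {l : Fin (r + 1)} {lam : BiPartition (r - l)} :
    IsNoetherian (Brauer K δ r)ᵐᵒᵖ (IndBig δ l (PermMod K lam)) := by
  have : IsNoetherian (Brauer K δ r)ᵐᵒᵖ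
      (Corner (AlgHom.id K (Brauer K δ r)) l ⊗[K] PermMod K lam) :=
    isNoetherian_of_tower K inferInstance
  infer_instance

instance {l : Fin (r + 1)} {lam : BiPartition (r - l)} :
    IsArtinian (Brauer K δ r)ᵐᵒᵖ (IndBig δ l (PermMod K lam)) := by
  have : IsArtinian (Brauer K δ r)ᵐᵒᵖ
      (Corner (AlgHom.id K (Brauer K δ r)) l ⊗[K] PermMod K lam) :=
    isArtinian_of_tower K inferInstance
  infer_instance

end Finiteness

/-! ### The Young modules of the hyperoctahedral group -/

section YoungHyp

variable {K : Type*} [Field K] {n : ℕ} {lam mu : BiPartition n}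

/-- The image is f({t}) k_t, which lies on the line M(λ) k_t; the scalar is recovered as the
coefficient of {t}. -/
theorem map_polytabloid (f : PermMod K lam →ₗ[(HypAlg K n)ᵐᵒᵖ] PermMod K lam)
    (t : BiTableau lam) : f (polytabloid K t) = coeff K t (f (polytabloid K t)) • polytabloid K t := by
  obtain ⟨c, hc⟩ := smul_colSum_eq K t (f (tabloidOf K t))
  rw [← map_smul] at hc
  change f (polytabloid K t) = _ at hc
  rw [hc, map_smul, coeff_polytabloid, smul_eq_mul, mul_one]

/-- The character by which the endomorphisms of the permutation module act on polytabloids. -/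
def polyChar (t : BiTableau lam) : Module.End (HypAlg K n)ᵐᵒᵖ (PermMod K lam) →+* K where
  toFun f := coeff K t (f (polytabloid K t))
  map_one' := coeff_polytabloid K t
  map_mul' f g := by
    rw [Module.End.mul_apply, map_polytabloid g, f.map_smul_of_tower, map_smul, smul_eq_mul,
      mul_comm, map_smul, coeff_polytabloid, smul_eq_mul, mul_one]
  map_zero' := by rw [LinearMap.zero_apply, map_zero]
  map_add' f g := by rw [LinearMap.add_apply, map_add]

theorem apply_polytabloid (f : Module.End (HypAlg K n)ᵐᵒᵖ (PermMod K lam)) (t : BiTableau lam) :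
    f (polytabloid K t) = polyChar t f • polytabloid K t := map_polytabloid f t

variable {Y Z : Submodule (HypAlg K n)ᵐᵒᵖ (PermMod K lam)}

theorem IsYoungHyp.polytabloid_mem (hY : IsYoungHyp K lam Y) (t : BiTableau lam) :
    polytabloid K t ∈ Y := hY.2.2 (Submodule.subset_span ⟨t, rfl⟩)

/-- The projection fixes the polytabloid, which lies in S(λ) ⊆ Y. -/
theorem IsYoungHyp.polyChar_ne_zero (hY : IsYoungHyp K lam Y) (h : IsCompl Y Z)
    (t : BiTableau lam) : polyChar t (Y.projection Z h) ≠ 0 := by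
  intro h0
  have h1 := apply_polytabloid (Y.projection Z h) t
  rw [h0, zero_smul, Submodule.projection_apply_of_mem_left h (hY.polytabloid_mem t)] at h1
  exact polytabloid_ne_zero K t h1

/-- The projection sends the polytabloid to a nonzero multiple of itself, so `Y` contains it and
with it the whole Specht module. -/
theorem isYoungHyp_of_polyChar_ne_zero (hY : Indecomposable (HypAlg K n)ᵐᵒᵖ Y) (h : IsCompl Y Z)
    {t : BiTableau lam} (ht : polyChar t (Y.projection Z h) ≠ 0) : IsYoungHyp K lam Y := by
  refine ⟨hY, ⟨Z, h⟩, specht_le K (t := t) ?_⟩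
  have h1 := apply_polytabloid (Y.projection Z h) t
  have h2 : polyChar t (Y.projection Z h) • polytabloid K t ∈ Y :=
    h1 ▸ Submodule.projection_apply_mem h _
  have h3 := Y.smul_of_tower_mem (polyChar t (Y.projection Z h))⁻¹ h2
  rwa [smul_smul, inv_mul_cancel₀ ht, one_smul] at h3

variable (K lam) in
theorem exists_isYoungHyp : ∃ Y, IsYoungHyp K lam Y := by
  obtain ⟨t⟩ := nonempty_biTableau lam
  obtain ⟨Y, Z, hY, h, hc⟩ := exists_summand_character_ne_zero (polyChar (K := K) t)
  exact ⟨Y, isYoungHyp_of_polyChar_ne_zero hY h hc⟩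

theorem IsYoungHyp.nonempty_equiv {Y' : Submodule (HypAlg K n)ᵐᵒᵖ (PermMod K lam)}
    (hY : IsYoungHyp K lam Y) (hY' : IsYoungHyp K lam Y') :
    Nonempty (Y ≃ₗ[(HypAlg K n)ᵐᵒᵖ] Y') := by
  obtain ⟨t⟩ := nonempty_biTableau lam
  obtain ⟨Z, h⟩ := hY.2.1
  obtain ⟨Z', h'⟩ := hY'.2.1
  exact nonempty_equiv_of_character_ne_zero (polyChar t) hY.1 hY'.1
    (Submodule.projectionOnto_comp_subtype h) (hY.polyChar_ne_zero h t)
    (Submodule.projectionOnto_comp_subtype h') (hY'.polyChar_ne_zero h' t)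

/-- The witness is the component of {t} in `Y`. So k_t does not annihilate Y(λ), a fact that
survives any isomorphism. -/
theorem IsYoungHyp.exists_smul_colSum (hY : IsYoungHyp K lam Y) (t : BiTableau lam) :
    ∃ y : Y, ((MulOpposite.op (colSum K t) • y : Y) : PermMod K lam) = polytabloid K t := by
  obtain ⟨Z, h⟩ := hY.2.1
  refine ⟨Y.projectionOnto Z h (tabloidOf K t), ?_⟩
  rw [← map_smul]
  exact Submodule.projection_apply_of_mem_left h (hY.polytabloid_mem t)

/-- As k_t does not annihilate `Y`, it cannot annihilate a module M(μ) that contains a copy of `Y`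
as a summand. -/
theorem IsYoungHyp.dominates (hY : IsYoungHyp K lam Y)
    (h : IsSummand (HypAlg K n)ᵐᵒᵖ Y (PermMod K mu)) : lam.Dominates mu := by
  obtain ⟨t⟩ := nonempty_biTableau lam
  obtain ⟨y, hy⟩ := hY.exists_smul_colSum t
  obtain ⟨i, p, hp⟩ := h.exists_comp_eq_id
  refine dominates_of_smul_colSum_ne_zero K (t := t) (m := i y) fun h0 => ?_
  rw [← map_smul] at h0
  have h1 := LinearMap.congr_fun hp (MulOpposite.op (colSum K t) • y)
  rw [LinearMap.comp_apply, h0, map_zero, LinearMap.id_apply] at h1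
  rw [← h1] at hy
  exact polytabloid_ne_zero K t hy.symm

end YoungHyp

/-! ### The Young modules of the Brauer algebra -/

section Young

variable {K : Type*} [Field K] {δ : K} {r : ℕ} (hδ : δ ≠ 0) {l : Fin (r + 1)}

theorem idealJ_of_id_eq_zero (x : Brauer K δ r) (hx : AlgHom.id K (Brauer K δ r) x = 0) :
    x ∈ idealJ K δ r (l + 1) := by
  rw [show x = 0 from hx]
  exact zero_mem _

theorem idealJ_of_mk_eq_zero (x : Brauer K δ r)
    (hx : Ideal.Quotient.mkₐ K (idealJ K δ r (l + 1)) x = 0) : x ∈ idealJ K δ r (l + 1) :=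
  Ideal.Quotient.eq_zero_iff_mem.1 hx

variable {M M' M₂ : Type*} [AddCommGroup M] [Module K M] [Module (HypAlg K (r - l))ᵐᵒᵖ M]
  [AddCommGroup M'] [Module K M'] [Module (HypAlg K (r - l))ᵐᵒᵖ M']
  [IsScalarTower K (HypAlg K (r - l))ᵐᵒᵖ M']
  [AddCommGroup M₂] [Module K M₂] [Module (HypAlg K (r - l))ᵐᵒᵖ M₂]
  [IsScalarTower K (HypAlg K (r - l))ᵐᵒᵖ M₂]

/-- The homomorphism `M → M'` induced by a homomorphism `Ind_l M → Ind_l M'`. -/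
def localizeBig (F : IndBig δ l M →ₗ[(Brauer K δ r)ᵐᵒᵖ] IndBig δ l M') :
    M →ₗ[(HypAlg K (r - l))ᵐᵒᵖ] M' :=
  localize hδ Function.surjective_id idealJ_of_id_eq_zero F

/-- The homomorphism `M → M'` induced by a homomorphism `Ind_l M → ind_l M'`. -/
def localizeLayer (F : IndBig δ l M →ₗ[(Brauer K δ r)ᵐᵒᵖ] IndLayer δ l M') :
    M →ₗ[(HypAlg K (r - l))ᵐᵒᵖ] M' :=
  localize hδ (Ideal.Quotient.mkₐ_surjective K _) idealJ_of_mk_eq_zero F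

theorem localizeBig_comp (F : IndBig δ l M' →ₗ[(Brauer K δ r)ᵐᵒᵖ] IndBig δ l M₂)
    (G : IndBig δ l M →ₗ[(Brauer K δ r)ᵐᵒᵖ] IndBig δ l M') :
    localizeBig hδ (F ∘ₗ G) = localizeBig hδ F ∘ₗ localizeBig hδ G := by
  ext1 m
  exact retraction_apply hδ _ _ F _

theorem localizeLayer_comp (F : IndBig δ l M' →ₗ[(Brauer K δ r)ᵐᵒᵖ] IndLayer δ l M₂)
    (G : IndBig δ l M →ₗ[(Brauer K δ r)ᵐᵒᵖ] IndBig δ l M') :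
    localizeLayer hδ (F ∘ₗ G) = localizeLayer hδ F ∘ₗ localizeBig hδ G := by
  ext1 m
  exact retraction_apply hδ _ _ F _

theorem localizeLayer_surjective [IsScalarTower K (HypAlg K (r - l))ᵐᵒᵖ M]
    {F : IndBig δ l M →ₗ[(Brauer K δ r)ᵐᵒᵖ] IndLayer δ l M'}
    (hF : Function.Surjective F) : Function.Surjective (localizeLayer hδ F) := by
  intro y
  obtain ⟨z, hz⟩ := hF (unitMap _ l M' y)
  refine ⟨bigRetraction hδ z, ?_⟩
  rw [localizeLayer, ← retraction_apply, hz, retraction_unitMap]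

/-- A homomorphism to `ind_l M'` is surjective if it is so after localization. -/
theorem surjective_of_localizeLayer_surjective
    {F : IndBig δ l M →ₗ[(Brauer K δ r)ᵐᵒᵖ] IndLayer δ l M'}
    (hF : Function.Surjective (localizeLayer hδ F)) : Function.Surjective F := by
  have hunit : ∀ y, unitMap _ l M' y ∈ LinearMap.range F := by
    intro y
    obtain ⟨m, hm⟩ := hF y
    -- J_{l+1} acts as zero on the layer, so there e_l is the retraction onto the elements y ⊗ e_l
    -- with no error term.
    have key := op_idem_smul_induction (M := M') hδ
      (Ideal.Quotient.mkₐ_surjective K (idealJ K δ r (l + 1))) (l := l) idealJ_of_mk_eq_zero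
      (P := fun z => z = 0) rfl (fun x y hx hy => by rw [hx, hy, add_zero])
      (fun j hj m => op_smul_eq_zero (Ideal.Quotient.mkₐ_surjective K _)
        (fun b => Ideal.Quotient.eq_zero_iff_mem.2 (Ideal.mul_mem_left _ b hj)) _)
      (F (unitMap _ l M m))
    rw [sub_eq_zero] at key
    refine ⟨MulOpposite.op (Brauer.idem K δ l) • unitMap _ l M m, ?_⟩
    rw [map_smul, key]
    exact congrArg _ hm
  intro z
  refine tensorCorner_induction (Ideal.Quotient.mkₐ_surjective K (idealJ K δ r (l + 1)))
    (P := fun z => z ∈ LinearMap.range F) z (zero_mem _) (fun x y hx hy => add_mem hx hy)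
    fun x m => Submodule.smul_mem _ _ (hunit m)

/-- Endomorphisms of `Ind_l M` act on `M`. -/
def localizeEnd (M : Type*) [AddCommGroup M] [Module K M] [Module (HypAlg K (r - l))ᵐᵒᵖ M]
    [IsScalarTower K (HypAlg K (r - l))ᵐᵒᵖ M] : Module.End (Brauer K δ r)ᵐᵒᵖ (IndBig δ l M) →+*
      Module.End (HypAlg K (r - l))ᵐᵒᵖ M where
  toFun F := localizeBig hδ F
  map_one' := by ext1 m; exact retraction_unitMap hδ _ _ m
  map_mul' F G := localizeBig_comp hδ F G
  map_zero' := by ext1 m; exact map_zero (bigRetraction (l := l) (M := M) hδ)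
  map_add' F G := by ext1 m; exact map_add (bigRetraction (l := l) (M := M) hδ) _ _

/-- Ind_m X is generated by elements u ⊗ e_m, which e_m fixes; since e_m lies in J_{l+1}, their
images are killed by the retraction to `M'`. -/
theorem localizeBig_eq_zero {m : Fin (r + 1)} (hlm : l < m) {X : Type*} [AddCommGroup X]
    [Module K X] [Module (HypAlg K (r - m))ᵐᵒᵖ X]
    (a : IndBig δ m X →ₗ[(Brauer K δ r)ᵐᵒᵖ] IndBig δ l M')
    (b : IndBig δ l M →ₗ[(Brauer K δ r)ᵐᵒᵖ] IndBig δ m X) : localizeBig hδ (a ∘ₗ b) = 0 := by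
  ext1 v
  change bigRetraction hδ (a (b (unitMap _ l M v))) = 0
  refine tensorCorner_induction (π := AlgHom.id K (Brauer K δ r)) Function.surjective_id
    (P := fun z => bigRetraction hδ (a z) = 0) _ (by rw [map_zero, map_zero])
    (fun x y hx hy => by rw [map_add, map_add, hx, hy, add_zero]) fun x u => ?_
  rw [← op_idem_mul_smul_unitMap hδ, map_smul]
  exact retraction_op_smul_of_mem hδ _ _ (Ideal.mul_mem_right _ _ (idem_mem_idealJ hlm)) _

/-- The character of the endomorphism ring of `M(l, λ)` that detects the Young module. -/
def youngChar (x : Index r) (t : BiTableau x.2) :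
    Module.End (Brauer K δ r)ᵐᵒᵖ (BPermMod δ x) →+* K :=
  (polyChar t).comp (localizeEnd hδ (PermMod K x.2))

theorem youngChar_apply (x : Index r) (t : BiTableau x.2)
    (F : Module.End (Brauer K δ r)ᵐᵒᵖ (BPermMod δ x)) :
    youngChar hδ x t F = polyChar t (localizeBig hδ F) := rfl

variable {x : Index r} {N P : Submodule (Brauer K δ r)ᵐᵒᵖ (BPermMod δ x)}

/-- The surjection from M(l, λ) via `N` to the layer absorbs the projection onto `N`. If the
character vanished, its localization M(λ) → Y(λ) would kill the polytabloid, hence all of M(λ) k_t;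
being surjective, it would force Y(λ) k_t = 0. -/
theorem IsYoung.youngChar_ne_zero (hN : IsYoung δ x N) (h : IsCompl N P) (t : BiTableau x.2) :
    youngChar hδ x t (N.projection P h) ≠ 0 := by
  obtain ⟨-, -, Y, hY, f, hf⟩ := hN
  set F : IndBig δ x.1 (PermMod K x.2) →ₗ[(Brauer K δ r)ᵐᵒᵖ] IndLayer δ x.1 Y :=
    f ∘ₗ N.projectionOnto P h
  have hFs : Function.Surjective F := hf.comp (Submodule.projectionOnto_surjective h)
  have hFp : F ∘ₗ N.projection P h = F := by
    refine LinearMap.ext fun z => congrArg f ?_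
    exact Submodule.projectionOnto_projection h z
  have hL := localizeLayer_comp hδ F (N.projection P h)
  rw [hFp] at hL
  intro h0
  have h1 : localizeLayer hδ F (polytabloid K t) = 0 := by
    rw [hL, LinearMap.comp_apply, apply_polytabloid (localizeBig hδ _) t, ← youngChar_apply, h0,
      zero_smul, map_zero]
  obtain ⟨y, hy⟩ := hY.exists_smul_colSum t
  obtain ⟨m, rfl⟩ := localizeLayer_surjective hδ hFs y
  obtain ⟨c, hc⟩ := smul_colSum_eq K t m
  rw [← map_smul, hc, LinearMap.map_smul_of_tower, h1, smul_zero] at hy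
  exact polytabloid_ne_zero K t hy.symm

/-- Restrict to `N` the map to the layer induced by the projection M(λ) → Y(λ). Surjectivity can be
checked after localization, where the nonzero character makes the composite bijective on Y(λ). -/
theorem isYoung_of_youngChar_ne_zero (hN : Indecomposable (Brauer K δ r)ᵐᵒᵖ N) (h : IsCompl N P)
    {t : BiTableau x.2} (ht : youngChar hδ x t (N.projection P h) ≠ 0) : IsYoung δ x N := by
  obtain ⟨Y, hY⟩ := exists_isYoungHyp K x.2
  obtain ⟨Z, hZ⟩ := hY.2.1
  set p := Y.projectionOnto Z hZ
  set F : IndBig δ x.1 (PermMod K x.2) →ₗ[(Brauer K δ r)ᵐᵒᵖ] IndLayer δ x.1 Y :=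
    tensorCornerMap _ p
  have hF : localizeLayer hδ F = p := localize_tensorCornerMap hδ _ _ p
  refine ⟨hN, ⟨P, h⟩, Y, hY, F ∘ₗ N.subtype, ?_⟩
  have hu : Function.Bijective (p ∘ₗ localizeBig hδ (N.projection P h) ∘ₗ Y.subtype) := by
    refine bijective_of_character_ne_zero (polyChar t) hY.1
      (Submodule.projectionOnto_comp_subtype hZ) ?_
    have : Y.subtype ∘ₗ (p ∘ₗ localizeBig hδ (N.projection P h) ∘ₗ Y.subtype) ∘ₗ p =
      Y.projection Z hZ * localizeBig hδ (N.projection P h) * Y.projection Z hZ := rfl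
    rw [this, map_mul, map_mul]
    exact mul_ne_zero (mul_ne_zero (hY.polyChar_ne_zero hZ t) ht) (hY.polyChar_ne_zero hZ t)
  have hs : Function.Surjective (F ∘ₗ N.projection P h) := by
    refine surjective_of_localizeLayer_surjective hδ ?_
    rw [localizeLayer_comp, hF]
    exact Function.Surjective.of_comp (g := Y.subtype) hu.2
  exact Function.Surjective.of_comp (g := N.projectionOnto P h) hs

theorem exists_isYoung (hδ : δ ≠ 0) (x : Index r) : ∃ N, IsYoung δ x N := by
  obtain ⟨t⟩ := nonempty_biTableau x.2
  obtain ⟨N, P, hN, h, hc⟩ := exists_summand_character_ne_zero (youngChar hδ x t)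
  exact ⟨N, isYoung_of_youngChar_ne_zero hδ hN h hc⟩

theorem IsYoung.nonempty_equiv {N' : Submodule (Brauer K δ r)ᵐᵒᵖ (BPermMod δ x)}
    (hN : IsYoung δ x N) (hδ : δ ≠ 0) (hN' : IsYoung δ x N') : Nonempty (N ≃ₗ[(Brauer K δ r)ᵐᵒᵖ] N') := by
  obtain ⟨t⟩ := nonempty_biTableau x.2
  obtain ⟨P, h⟩ := hN.2.1
  obtain ⟨P', h'⟩ := hN'.2.1
  exact nonempty_equiv_of_character_ne_zero (youngChar hδ x t) hN.1 hN'.1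
    (Submodule.projectionOnto_comp_subtype h) (hN.youngChar_ne_zero hδ h t)
    (Submodule.projectionOnto_comp_subtype h') (hN'.youngChar_ne_zero hδ h' t)

theorem IsYoung.occursOnce (hN : IsYoung δ x N) (hδ : δ ≠ 0) :
    OccursOnce (Brauer K δ r)ᵐᵒᵖ N (BPermMod δ x) := by
  obtain ⟨t⟩ := nonempty_biTableau x.2
  obtain ⟨P, h⟩ := hN.2.1
  exact occursOnce_of_character_ne_zero (youngChar hδ x t) hN.1 h (hN.youngChar_ne_zero hδ h t)

/-- The projection onto `N` factors through any module that has `N` as a summand. -/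
theorem IsYoung.exists_factorization (hN : IsYoung δ x N) {X : Type*} [AddCommGroup X]
    [Module (Brauer K δ r)ᵐᵒᵖ X] (h : IsSummand (Brauer K δ r)ᵐᵒᵖ N X) (t : BiTableau x.2) :
    ∃ (a : X →ₗ[(Brauer K δ r)ᵐᵒᵖ] BPermMod δ x) (b : BPermMod δ x →ₗ[(Brauer K δ r)ᵐᵒᵖ] X),
      youngChar hδ x t (a ∘ₗ b) ≠ 0 := by
  obtain ⟨P, hP⟩ := hN.2.1
  obtain ⟨i, p, hp⟩ := h.exists_comp_eq_id
  refine ⟨N.subtype ∘ₗ p, i ∘ₗ N.projectionOnto P hP, ?_⟩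
  have : (N.subtype ∘ₗ p) ∘ₗ (i ∘ₗ N.projectionOnto P hP) = N.projection P hP := by
    rw [LinearMap.comp_assoc, ← LinearMap.comp_assoc _ i p, hp]
    rfl
  rw [this]
  exact hN.youngChar_ne_zero hδ hP t

theorem IsYoung.not_isSummand (hN : IsYoung δ x N) (hδ : δ ≠ 0) {y : Index r} (hxy : x.1 < y.1) :
    ¬ IsSummand (Brauer K δ r)ᵐᵒᵖ N (BPermMod δ y) := by
  intro h
  obtain ⟨t⟩ := nonempty_biTableau x.2
  obtain ⟨a, b, hab⟩ := hN.exists_factorization hδ h t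
  refine hab ?_
  rw [youngChar_apply, localizeBig_eq_zero hδ hxy]
  exact map_zero _

/-- One direction localizes a factorization through M(l, μ) to one through M(μ), the other induces
it back. In both, the nonzero character makes the resulting endomorphism of the Young module
bijective, which splits it off. -/
theorem IsYoung.isSummand_iff {lam mu : BiPartition (r - l)}
    {N : Submodule (Brauer K δ r)ᵐᵒᵖ (BPermMod δ ⟨l, lam⟩)} (hN : IsYoung δ ⟨l, lam⟩ N)
    (hδ : δ ≠ 0) {Y : Submodule (HypAlg K (r - l))ᵐᵒᵖ (PermMod K lam)} (hY : IsYoungHyp K lam Y) :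
    IsSummand (Brauer K δ r)ᵐᵒᵖ N (BPermMod δ ⟨l, mu⟩) ↔
      IsSummand (HypAlg K (r - l))ᵐᵒᵖ Y (PermMod K mu) := by
  obtain ⟨t⟩ := nonempty_biTableau lam
  obtain ⟨Z, hZ⟩ := hY.2.1
  obtain ⟨P, hP⟩ := hN.2.1
  have hYc := hY.polyChar_ne_zero hZ t
  have hNc := hN.youngChar_ne_zero hδ hP t
  constructor
  · intro h
    obtain ⟨a, b, hab⟩ := hN.exists_factorization hδ h t
    refine isSummand_of_bijective (f := localizeBig hδ b ∘ₗ Y.subtype)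
      (g := Y.projectionOnto Z hZ ∘ₗ localizeBig hδ a) ?_
    refine bijective_of_character_ne_zero (polyChar t) hY.1
      (Submodule.projectionOnto_comp_subtype hZ) ?_
    have : Y.subtype ∘ₗ ((Y.projectionOnto Z hZ ∘ₗ localizeBig hδ a) ∘ₗ
        (localizeBig hδ b ∘ₗ Y.subtype)) ∘ₗ Y.projectionOnto Z hZ =
      Y.projection Z hZ * (localizeBig hδ a ∘ₗ localizeBig hδ b) * Y.projection Z hZ := rfl
    rw [this, ← localizeBig_comp, map_mul, map_mul]
    exact mul_ne_zero (mul_ne_zero hYc hab) hYc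
  · intro h
    obtain ⟨i, p, hp⟩ := h.exists_comp_eq_id
    let A : IndBig δ l (PermMod K mu) →ₗ[(Brauer K δ r)ᵐᵒᵖ] IndBig δ l (PermMod K lam) :=
      tensorCornerMap _ (Y.subtype ∘ₗ p)
    let B : IndBig δ l (PermMod K lam) →ₗ[(Brauer K δ r)ᵐᵒᵖ] IndBig δ l (PermMod K mu) :=
      tensorCornerMap _ (i ∘ₗ Y.projectionOnto Z hZ)
    have hA : localizeBig hδ A = Y.subtype ∘ₗ p := localize_tensorCornerMap hδ _ _ _
    have hB : localizeBig hδ B = i ∘ₗ Y.projectionOnto Z hZ := localize_tensorCornerMap hδ _ _ _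
    have hAB : youngChar hδ ⟨l, lam⟩ t (A ∘ₗ B) ≠ 0 := by
      rw [youngChar_apply, localizeBig_comp, hA, hB, LinearMap.comp_assoc,
        ← LinearMap.comp_assoc _ i p, hp]
      exact hYc
    refine isSummand_of_bijective (f := B ∘ₗ N.subtype) (g := N.projectionOnto P hP ∘ₗ A) ?_
    refine bijective_of_character_ne_zero (youngChar hδ ⟨l, lam⟩ t) hN.1
      (Submodule.projectionOnto_comp_subtype hP) ?_
    have : N.subtype ∘ₗ ((N.projectionOnto P hP ∘ₗ A) ∘ₗ (B ∘ₗ N.subtype)) ∘ₗ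
        N.projectionOnto P hP = N.projection P hP * (A ∘ₗ B) * N.projection P hP := rfl
    rw [this, map_mul, map_mul]
    exact mul_ne_zero (mul_ne_zero hNc hAB) hNc

theorem IsYoung.isSummand_of_equiv {N : Type*} [AddCommGroup N] [Module (Brauer K δ r)ᵐᵒᵖ N]
    (hP : IsYoung δ x P) (e : N ≃ₗ[(Brauer K δ r)ᵐᵒᵖ] P) :
    IsSummand (Brauer K δ r)ᵐᵒᵖ N (BPermMod δ x) :=
  hP.2.1.elim fun Q hQ => ⟨P, Q, hQ, ⟨e⟩⟩

/-- Each module is a summand of the other's permutation module. This excludes `l < m` and `m < l`,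
and then gives dominance in both directions. -/
theorem IsYoung.index_eq {x y : Index r} {N : Submodule (Brauer K δ r)ᵐᵒᵖ (BPermMod δ x)}
    {P : Submodule (Brauer K δ r)ᵐᵒᵖ (BPermMod δ y)} (hN : IsYoung δ x N) (hδ : δ ≠ 0)
    (hP : IsYoung δ y P) (e : N ≃ₗ[(Brauer K δ r)ᵐᵒᵖ] P) : x = y := by
  have h1 := hP.isSummand_of_equiv e
  have h2 := hN.isSummand_of_equiv e.symm
  have hxy : x.1 = y.1 := le_antisymm (not_lt.1 fun h => hP.not_isSummand hδ h h2)
    (not_lt.1 fun h => hN.not_isSummand hδ h h1)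
  obtain ⟨l, lam⟩ := x
  obtain ⟨m, mu⟩ := y
  obtain rfl : l = m := hxy
  obtain ⟨Y, hY⟩ := exists_isYoungHyp K lam
  obtain ⟨Y', hY'⟩ := exists_isYoungHyp K mu
  rw [(hY.dominates ((hN.isSummand_iff hδ hY).1 h1)).antisymm
    (hY'.dominates ((hP.isSummand_iff hδ hY').1 h2))]

end Young

end TypeC

end

theorem mainTheorem10 {K : Type*} [Field K] (δ : K) (hδ : δ ≠ 0) (r : ℕ) :
    (∀ x : TypeC.Index r,
      (∃ Y, TypeC.IsYoungHyp K x.2 Y) ∧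
      (∀ Y Y', TypeC.IsYoungHyp K x.2 Y → TypeC.IsYoungHyp K x.2 Y' →
        Nonempty (Y ≃ₗ[(TypeC.HypAlg K (r - x.1))ᵐᵒᵖ] Y')) ∧
      (∃ N, TypeC.IsYoung δ x N) ∧
      (∀ N N', TypeC.IsYoung δ x N → TypeC.IsYoung δ x N' →
        Nonempty (N ≃ₗ[(TypeC.Brauer K δ r)ᵐᵒᵖ] N'))) ∧
    (∀ (x : TypeC.Index r) (N), TypeC.IsYoung δ x N →
      TypeC.OccursOnce (TypeC.Brauer K δ r)ᵐᵒᵖ N (TypeC.BPermMod δ x)) ∧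
    (∀ (x y : TypeC.Index r) (N), TypeC.IsYoung δ x N → x.1 < y.1 →
      ¬ TypeC.IsSummand (TypeC.Brauer K δ r)ᵐᵒᵖ N (TypeC.BPermMod δ y)) ∧
    (∀ (l : Fin (r + 1)) (lam mu : TypeC.BiPartition (r - l)) (Y) (N),
      TypeC.IsYoungHyp K lam Y → TypeC.IsYoung δ ⟨l, lam⟩ N →
      (TypeC.IsSummand (TypeC.Brauer K δ r)ᵐᵒᵖ N (TypeC.BPermMod δ ⟨l, mu⟩) ↔
        TypeC.IsSummand (TypeC.HypAlg K (r - l))ᵐᵒᵖ Y (TypeC.PermMod K mu)) ∧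
      (TypeC.IsSummand (TypeC.HypAlg K (r - l))ᵐᵒᵖ Y (TypeC.PermMod K mu) →
        lam.Dominates mu)) ∧
    (∀ (x y : TypeC.Index r) (N) (P), TypeC.IsYoung δ x N → TypeC.IsYoung δ y P →
      Nonempty (N ≃ₗ[(TypeC.Brauer K δ r)ᵐᵒᵖ] P) → x = y) := by
  refine ⟨fun x => ⟨TypeC.exists_isYoungHyp K x.2, fun Y Y' hY hY' => hY.nonempty_equiv hY',
      TypeC.exists_isYoung hδ x, fun N N' hN hN' => hN.nonempty_equiv hδ hN'⟩,
    fun x N hN => hN.occursOnce hδ, fun x y N hN hxy => hN.not_isSummand hδ hxy,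
    fun l lam mu Y N hY hN => ⟨hN.isSummand_iff hδ hY, hY.dominates⟩, ?_⟩
  rintro x y N P hN hP ⟨e⟩
  exact hN.index_eq hδ hP e
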